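/- Consider a server with a library of $M\ge 1$ files and $L\ge 1$ users on a shared error-free link of rate $R>0$; file $i$ has size $F_i>0$, hence transmission time $s_i=F_i/R$. The requests of user $j$ for file $i$ form a Poisson process of rate $\lambda_{ij}>0$, all these processes being independent. User $j$ has a cache for $C_j\ge 0$ files managed by the LRU rule: a file that is requested and found in the cache (a hit), or that is received from the server, moves to the front of the cache, and the least recently used file is evicted if the capacity is exceeded. A request for a file that is not in the user's cache (a miss) is forwarded to the server. The server keeps a multicast queue of entries $(i,\mathbb L_i)$, where $\mathbb L_i$ is the set of users waiting for file $i$. A forwarded request of user $j$ for file $i$ is merged (that is, $j$ is added to $\mathbb L_i$) with the entry of file $i$ that is in the queue and not yet in transmission, if there is one; otherwise a new entry $(i,\{j\})$ is appended at the tail. Entries are transmitted one at a time from head to tail, and at the end of the transmission of $(i,\mathbb L_i)$ that entry leaves the queue and all users in $\mathbb L_i$ receive file $i$. Let $X_t=(X_t^0,X_t^1,\dots,X_t^L)$, where $X_t^0$ is the content of the multicast queue (including the entry in transmission) and $X_t^j$ gives the positions of the files in the cache of user $j$ at time $t$. Let $R_t$ be the residual time of the transmission in progress ($0$ if there is none),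 and let $D_k$ be the queuing delay of the $k$-th request that reaches the server, from its arrival to the beginning of the transmission that serves it. An initial condition is any probability distribution of $(X_0,R_0)$ on the possible states, with $(X_0,R_0)$ independent of the requests after time $0$. A stationary distribution of a process is a probability measure $\pi$ such that, for some initial condition, the process has one-dimensional marginal $\pi$ at all times; a stationary law of a process is a probability measure $Q$ on trajectories such that, for some initial condition, the trajectory of the process after time $t$ has law $Q$ for all $t$. (1) $\{X_t\}_{t\ge 0}$ has exactly one stationary distribution $\pi_X$ and exactly one stationary law $Q_X$. For every initial condition, as $t\to\infty$, the law of $X_t$ converges to $\pi_X$ and the law of the trajectory $(X_{t+u})_{u\ge0}$ converges to $Q_X$, both in total variation. (2) Suppose that $C_j<M$ for at least one user $j$. Then, for every initial condition, almost surely infinitely many requests reach the server, so that all $D_k$ are defined. The process $\{D_k\}$ has exactly one stationary distribution $\pi_D$ and exactly one stationary law $Q_D$. For every initial condition, as $k\to\infty$, the law of $D_k$ converges to $\pi_D$ and the law of $(D_{k+m})_{m\ge0}$ converges to $Q_D$, both in total variation. -/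

import Mathlib

open MeasureTheory ProbabilityTheory Filter Topology
open scoped NNReal

noncomputable section

/-! ### Stochastic processes, stationarity and total variation -/

/-- Total variation distance of two probability measures: `sup_A |μ(A) - ν(A)|`. -/
def tvDist {E : Type*} [MeasurableSpace E] (μ ν : Measure E) : ℝ :=
  ⨆ A : {A : Set E // MeasurableSet A}, |μ.real A.1 - ν.real A.1|

/-- The law of the whole trajectory `(Y_{t+u})_u` after time `t`, on the product `σ`-algebra. -/
def trajectoryLaw {T E Ω : Type*} [Add T] [MeasurableSpace E] [MeasurableSpace Ω]
    (P : Measure Ω) (Y : T → Ω → E) (t : T) : Measure (T → E) :=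
  P.map (fun ω u => Y (t + u) ω)

/-- Let `P c` be the law of the system started from the initial condition `c`.  The probability
measure `π` is a stationary distribution of the process `Y` if for some initial condition `Y_t` has
law `π` at all times `t`. -/
def IsStationaryDistribution {T E Ω ι : Type*} [MeasurableSpace E] [MeasurableSpace Ω]
    (P : ι → Measure Ω) (Y : T → Ω → E) (π : Measure E) : Prop :=
  IsProbabilityMeasure π ∧ ∃ c, ∀ t, (P c).map (Y t) = π

/-- The probability measure `Q` on trajectories is the law of a (strictly) stationary version of the
process `Y`: for some initial condition, `(Y_{t+u})_u` has law `Q` for every `t`. -/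
def IsStationaryProcessLaw {T E Ω ι : Type*} [Add T] [MeasurableSpace E] [MeasurableSpace Ω]
    (P : ι → Measure Ω) (Y : T → Ω → E) (Q : Measure (T → E)) : Prop :=
  IsProbabilityMeasure Q ∧ ∃ c, ∀ t, trajectoryLaw (P c) Y t = Q

/-! ### The network -/

/-- One server with `M` files and `L` users with caches on a shared link. -/
structure MulticastNetwork (M L : ℕ) where
  /-- number of files that the cache of user `j` can hold -/
  capacity : Fin L → ℕ
  /-- rate of the Poisson process of requests for file `i` at user `j` -/
  rate : Fin M → Fin L → ℝ
  /-- size of file `i` in bits -/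
  fileSize : Fin M → ℝ
  /-- rate of the shared link in bits per second -/
  linkRate : ℝ
  rate_pos : ∀ i j, 0 < rate i j
  fileSize_pos : ∀ i, 0 < fileSize i
  linkRate_pos : 0 < linkRate

/-- The state `X_t` of the system: `queue` is the multicast queue, from head to tail, each entry
being a file with the set of users waiting for it (while the queue is nonempty, its head is in
transmission); `cache j` lists the files in the cache of user `j`, the most recently used first,
so the list carries the position of each file in the cache. -/
structure SystemState (M L : ℕ) where
  queue : List (Fin M × Finset (Fin L))
  cache : Fin L → List (Fin M)

/-- `SystemState M L` is countable and carries the discrete `σ`-algebra. -/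
instance (M L : ℕ) : MeasurableSpace (SystemState M L) := ⊤

/-- The pair `(X_t, R_t)`, with `R_t` the residual time of the transmission in progress
(`0` when the server is idle). -/
abbrev FullState (M L : ℕ) : Type := SystemState M L × ℝ

/-- Interarrival times: `ω p n` is the time between the `n`-th and the `(n+1)`-th request (numbered
from one, counting time zero as the zeroth) for file `p.1` at user `p.2`. -/
abbrev RequestInput (M L : ℕ) : Type := Fin M × Fin L → ℕ → ℝ

/-- Merging of a request of user `j` for file `i` with the entries not yet in transmission: user `j`
is added to the entry of file `i` if there is one, else a new entry is appended at the tail. -/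
def mergeRequest {M L : ℕ} (i : Fin M) (j : Fin L) :
    List (Fin M × Finset (Fin L)) → List (Fin M × Finset (Fin L))
  | [] => [(i, {j})]
  | e :: q => if e.1 = i then (i, insert j e.2) :: q else e :: mergeRequest i j q

/-- Arrival at the multicast queue; the entry in transmission is never merged with. -/
def enqueue {M L : ℕ} (i : Fin M) (j : Fin L) :
    List (Fin M × Finset (Fin L)) → List (Fin M × Finset (Fin L))
  | [] => [(i, {j})]
  | e :: q => e :: mergeRequest i j q

/-- Least-recently-used update of a cache holding `c` files when file `i` is used or received: file
`i` moves to the front, and the last file is evicted if there is no room for it. -/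
def lruUpdate {M : ℕ} (c : ℕ) (i : Fin M) (l : List (Fin M)) : List (Fin M) :=
  (i :: l.erase i).take c

/-! ### Merging the request processes in order of time -/

/-- Time of the `n`-th request (`n = 0, 1, …`) of the stream `p`. -/
def streamTime {M L : ℕ} (ω : RequestInput M L) (p : Fin M × Fin L) (n : ℕ) : ℝ :=
  ∑ m ∈ Finset.range (n + 1), ω p m

/-- The stream at which `a` is least (ties, which have probability zero, are broken in a fixed
order). -/
def earliest {M L : ℕ} [NeZero M] [NeZero L] (a : Fin M × Fin L → ℝ) : Fin M × Fin L :=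
  ((Finset.univ : Finset (Fin M × Fin L)).toList.argmin a).getD (0, 0)

/-- How many of the first `n` requests of the whole network come from each stream. -/
def streamCount {M L : ℕ} [NeZero M] [NeZero L] (ω : RequestInput M L) :
    ℕ → Fin M × Fin L → ℕ
  | 0 => fun _ => 0
  | n + 1 =>
    let k := streamCount ω n
    let p := earliest fun q => streamTime ω q (k q)
    Function.update k p (k p + 1)

/-- File and user of the `n`-th request (`n = 0, 1, …`) of the whole network. -/
def requestPair {M L : ℕ} [NeZero M] [NeZero L] (ω : RequestInput M L) (n : ℕ) :
    Fin M × Fin L :=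
  earliest fun q => streamTime ω q (streamCount ω n q)

/-- Time of the `n`-th request (`n = 0, 1, …`) of the whole network. -/
def requestTime {M L : ℕ} [NeZero M] [NeZero L] (ω : RequestInput M L) (n : ℕ) : ℝ :=
  streamTime ω (requestPair ω n) (streamCount ω n (requestPair ω n))

/-- Number of requests of the whole network in `[0, t]`. -/
def requestCount {M L : ℕ} [NeZero M] [NeZero L] (ω : RequestInput M L) (t : ℝ) : ℕ :=
  sInf {n | t < requestTime ω n}

namespace MulticastNetwork

variable {M L : ℕ} (N : MulticastNetwork M L)

/-- Transmission time of file `i`. -/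
def serviceTime (i : Fin M) : ℝ := N.fileSize i / N.linkRate

/-- Transmission time of the file at the head of a queue (`0` for the empty queue). -/
def headTime : List (Fin M × Finset (Fin L)) → ℝ
  | [] => 0
  | e :: _ => N.serviceTime e.1

/-- At the end of the transmission of file `i`, the users in `U` receive it into their caches. -/
def deliver (i : Fin M) (U : Finset (Fin L)) (c : Fin L → List (Fin M)) : Fin L → List (Fin M) :=
  fun j => if j ∈ U then lruUpdate (N.capacity j) i (c j) else c j

/-- The system after `d` units of time without a request, from queue, caches and residual
transmission time: entries are transmitted from head to tail. -/
def serve : List (Fin M × Finset (Fin L)) → (Fin L → List (Fin M)) → ℝ → ℝ → FullState M L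
  | [], c, _, _ => (⟨[], c⟩, 0)
  | e :: q, c, r, d =>
    if d < r then (⟨e :: q, c⟩, r - d)
    else serve q (N.deliver e.1 e.2 c) (N.headTime q) (d - r)

/-- The system after `d` units of time without a request. -/
def advance (d : ℝ) (z : FullState M L) : FullState M L :=
  N.serve z.1.queue z.1.cache z.2 d

/-- The effect of a request of user `p.2` for file `p.1`: a hit only updates the user's cache; a
miss is forwarded to the server. -/
def request (p : Fin M × Fin L) (z : FullState M L) : FullState M L :=
  if p.1 ∈ z.1.cache p.2 then
    (⟨z.1.queue, Function.update z.1.cache p.2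
      (lruUpdate (N.capacity p.2) p.1 (z.1.cache p.2))⟩, z.2)
  else
    (⟨enqueue p.1 p.2 z.1.queue, z.1.cache⟩,
      if z.1.queue = [] then N.serviceTime p.1 else z.2)

/-- Queuing delay, from arrival to the beginning of the transmission, of a request for file `i` that
reaches the server in state `z`: the residual transmission time plus the transmission times of the
entries between the one in transmission and the one of file `i` (or the tail). -/
def queuingDelay (i : Fin M) (z : FullState M L) : ℝ :=
  match z.1.queue with
  | [] => 0
  | _ :: q => z.2 + ((q.takeWhile fun e => e.1 ≠ i).map fun e => N.serviceTime e.1).sum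

/-- The possible states: the entries not in transmission are for distinct files, every entry has a
user, a cache holds distinct files within its capacity, and the residual transmission time fits the
file in transmission. -/
def Valid (z : FullState M L) : Prop :=
  (z.1.queue.tail.map Prod.fst).Nodup ∧
  (∀ e ∈ z.1.queue, e.2.Nonempty) ∧
  (∀ j, (z.1.cache j).Nodup ∧ (z.1.cache j).length ≤ N.capacity j) ∧
  (z.1.queue = [] → z.2 = 0) ∧
  (z.1.queue ≠ [] → 0 < z.2 ∧ z.2 ≤ N.headTime z.1.queue)

/-! ### Probability -/

/-- Initial conditions: probability distributions of `(X_0, R_0)`. -/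
def InitialLaw : Type :=
  {μ : Measure (FullState M L) // IsProbabilityMeasure μ ∧ ∀ᵐ z ∂μ, N.Valid z}

/-- The request streams are independent Poisson processes: all interarrival times are independent,
those of the stream `p` being exponential with rate `rate p.1 p.2`. -/
def requestLaw : Measure (RequestInput M L) :=
  Measure.infinitePi fun p : Fin M × Fin L =>
    Measure.infinitePi fun _ : ℕ => expMeasure (N.rate p.1 p.2)

/-- The initial state and the requests are independent. -/
def law (μ : N.InitialLaw) : Measure (FullState M L × RequestInput M L) :=
  μ.1.prod N.requestLaw

/-! ### The processes -/

variable [NeZero M] [NeZero L]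

/-- The system at time zero (`n = 0`), and just after the first `n` requests (`n ≥ 1`), started from
`ω.1` and driven by the requests `ω.2`. -/
def afterRequest (ω : FullState M L × RequestInput M L) : ℕ → FullState M L
  | 0 => ω.1
  | n + 1 => N.request (requestPair ω.2 n)
      (N.advance (requestTime ω.2 n - if n = 0 then 0 else requestTime ω.2 (n - 1))
        (afterRequest ω n))

/-- The system just before the `n`-th request (`n = 0, 1, …`). -/
def beforeRequest (n : ℕ) (ω : FullState M L × RequestInput M L) : FullState M L :=
  N.advance (requestTime ω.2 n - if n = 0 then 0 else requestTime ω.2 (n - 1))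
    (N.afterRequest ω n)

/-- The pair `(X_t, R_t)`. -/
def fullStateAt (t : ℝ≥0) (ω : FullState M L × RequestInput M L) : FullState M L :=
  let n := requestCount ω.2 t
  N.advance (t - if n = 0 then 0 else requestTime ω.2 (n - 1)) (N.afterRequest ω n)

/-- The continuous-time process `X_t`. -/
def stateAt (t : ℝ≥0) (ω : FullState M L × RequestInput M L) : SystemState M L :=
  (N.fullStateAt t ω).1

/-- The `n`-th request of the network is a miss. -/
def IsMiss (ω : FullState M L × RequestInput M L) (n : ℕ) : Prop :=
  (requestPair ω.2 n).1 ∉ (N.beforeRequest n ω).1.cache (requestPair ω.2 n).2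

/-- The delay `D_k` of the `k`-th request (`k = 0, 1, …`) reaching the server, that is, of the
`k`-th miss. -/
def delay (k : ℕ) (ω : FullState M L × RequestInput M L) : ℝ :=
  let n := Nat.nth (N.IsMiss ω) k
  N.queuingDelay (requestPair ω.2 n).1 (N.beforeRequest n ω)

end MulticastNetwork

end

/-!
For an initial state `z` (with the residual time) and requests `ω`, let `S t (z, ω)` be the pair of
the state at time `t` and the requests still to come, seen from `t` (`shiftAt`).
By the lack of memory of the exponential law the coming requests are again distributed as the
original ones and independent of the state, so that `S` is a Markov shift (`isMarkovShift_shiftAt`,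
structure `IsMarkovShift`). The same holds for `missShift`, the lapse of time until just after the
first miss (`isMarkovShift_missShift`), and the delays are read off its iterates
(`delay_eq_iterate`). Both the state and the delay are functionals of the shifted pair, hence it
suffices to treat the two Markov shifts.

For a Markov shift it is enough to find one time `t₀`, one state `z₀` and one `ε > 0` such that `z₀`
is reached at time `t₀` from every admissible state with probability at least `ε`. This is Doeblin's
condition with a Dirac mass: any two laws at time `n * t₀` differ by at most `(1 - ε) ^ n` in total
variation, which gives an invariant law (`IsMarkovShift.exists_invariant`), its uniqueness and the
convergence of the trajectories (`IsMarkovShift.tendsto_tvDist_trajectoryLaw`,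
`existsUnique_stationary_of_shift`).

Both atoms come from the same scenario. The entries waiting in an admissible queue are for distinct
files, so that the server is idle after at most `drainTime` without a request. If now each user
requests each file, in a fixed order and with pauses longer than `drainTime`, the caches end up in the
state `resetCache`, whatever they were (`foldl_touch_allRequests`). In continuous time the idle server
with these caches is the atom: the scenario fits into a fixed time, until whose end no other request
need occur (`exists_atom_shiftAt`).

Counted in misses the scenario does not have a fixed length, as some of the requests may be hits, and
the number `m` of misses depends on the initial caches. The missing ones are supplied afterwards: as
`C_j < M` for some `j`, there is a file outside the cache of user `j`; request it, and keep requesting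
it while it is in transmission. Each of these requests is a miss, and from the second on they merge
with one another, so that their number leaves no trace in the queue and the caches. After another
pause a further miss leads to a state which does not depend on `m` either, not even through the
residual time, because the transmission starts with that miss (`exists_atom_missShift`).
-/

/-! ### Total variation distance and stationarity -/

section TotalVariation

variable {E F : Type*} [MeasurableSpace E] [MeasurableSpace F]

theorem tvDist_nonneg (μ ν : Measure E) : 0 ≤ tvDist μ ν :=
  Real.iSup_nonneg fun _ => abs_nonneg _

theorem tvDist_le {μ ν : Measure E} {b : ℝ}
    (h : ∀ A, MeasurableSet A → |μ.real A - ν.real A| ≤ b) : tvDist μ ν ≤ b :=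
  haveI : Nonempty {A : Set E // MeasurableSet A} := ⟨⟨∅, MeasurableSet.empty⟩⟩
  ciSup_le fun A => h A.1 A.2

theorem abs_sub_le_tvDist (μ ν : Measure E) [IsProbabilityMeasure μ] [IsProbabilityMeasure ν]
    {A : Set E} (hA : MeasurableSet A) : |μ.real A - ν.real A| ≤ tvDist μ ν := by
  refine le_ciSup (f := fun A : {A : Set E // MeasurableSet A} => |μ.real A.1 - ν.real A.1|)
    ⟨1, ?_⟩ ⟨A, hA⟩
  rintro _ ⟨B, rfl⟩
  have h1 := measureReal_nonneg (μ := μ) (s := B.1)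
  have h2 := measureReal_nonneg (μ := ν) (s := B.1)
  have h3 := measureReal_le_one (μ := μ) (s := B.1)
  have h4 := measureReal_le_one (μ := ν) (s := B.1)
  exact abs_le.2 ⟨by linarith, by linarith⟩

theorem tvDist_map_le (μ ν : Measure E) [IsProbabilityMeasure μ] [IsProbabilityMeasure ν]
    {f : E → F} (hf : Measurable f) : tvDist (μ.map f) (ν.map f) ≤ tvDist μ ν := by
  refine tvDist_le fun A hA => ?_
  rw [map_measureReal_apply hf hA, map_measureReal_apply hf hA]
  exact abs_sub_le_tvDist μ ν (hf hA)

theorem eq_of_tvDist_eq_zero {μ ν : Measure E} [IsProbabilityMeasure μ] [IsProbabilityMeasure ν]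
    (h : tvDist μ ν = 0) : μ = ν := by
  ext A hA
  have h1 : |μ.real A - ν.real A| ≤ 0 := h ▸ abs_sub_le_tvDist μ ν hA
  have h2 : μ.real A = ν.real A := by linarith [abs_nonpos_iff.1 h1]
  exact (measureReal_eq_measureReal_iff).1 h2

end TotalVariation

/-- If one initial condition makes the process stationary and the laws of the trajectories from any
two initial conditions merge in total variation, then the stationary marginal and the stationary
trajectory law exist, are unique, and attract every initial condition. -/
theorem existsUnique_stationary_and_tendsto {T E Ω ι : Type*} [AddZeroClass T] [Preorder T]
    [IsDirectedOrder T] [Nonempty T] [MeasurableSpace E] [MeasurableSpace Ω]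
    (P : ι → Measure Ω) [∀ c, IsProbabilityMeasure (P c)] (Y : T → Ω → E)
    (hY : ∀ c t, AEMeasurable (fun ω u => Y (t + u) ω) (P c)) (c₀ : ι)
    (hstat : ∀ t, trajectoryLaw (P c₀) Y t = trajectoryLaw (P c₀) Y 0)
    (hmerge : ∀ c c', Tendsto
      (fun t => tvDist (trajectoryLaw (P c) Y t) (trajectoryLaw (P c') Y t)) atTop (𝓝 0)) :
    (∃! π : Measure E, IsStationaryDistribution P Y π) ∧
    (∃! Q : Measure (T → E), IsStationaryProcessLaw P Y Q) ∧
    (∀ π : Measure E, IsStationaryDistribution P Y π → ∀ c,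
      Tendsto (fun t => tvDist ((P c).map (Y t)) π) atTop (𝓝 0)) ∧
    (∀ Q : Measure (T → E), IsStationaryProcessLaw P Y Q → ∀ c,
      Tendsto (fun t => tvDist (trajectoryLaw (P c) Y t) Q) atTop (𝓝 0)) := by
  have hprob : ∀ c t, IsProbabilityMeasure (trajectoryLaw (P c) Y t) := fun c t =>
    Measure.isProbabilityMeasure_map (hY c t)
  have hmarg : ∀ c t, (P c).map (Y t) = (trajectoryLaw (P c) Y t).map (fun y => y 0) := by
    intro c t
    rw [trajectoryLaw, AEMeasurable.map_map_of_aemeasurable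
      (measurable_pi_apply 0).aemeasurable (hY c t)]
    congr 1
    funext ω
    simp
  set Q₀ := trajectoryLaw (P c₀) Y 0 with hQ₀
  set π₀ := Q₀.map (fun y => y 0) with hπ₀
  have : IsProbabilityMeasure Q₀ := hprob c₀ 0
  have : IsProbabilityMeasure π₀ :=
    Measure.isProbabilityMeasure_map (measurable_pi_apply 0).aemeasurable
  have hQlim : ∀ c, Tendsto (fun t => tvDist (trajectoryLaw (P c) Y t) Q₀) atTop (𝓝 0) := by
    intro c
    simpa only [hstat] using hmerge c c₀
  have hπlim : ∀ c, Tendsto (fun t => tvDist ((P c).map (Y t)) π₀) atTop (𝓝 0) := by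
    intro c
    refine squeeze_zero (fun t => tvDist_nonneg _ _) (fun t => ?_) (hQlim c)
    rw [hmarg c t]
    have := hprob c t
    exact tvDist_map_le _ _ (measurable_pi_apply 0)
  have hQstat : IsStationaryProcessLaw P Y Q₀ := ⟨inferInstance, c₀, hstat⟩
  have hπstat : IsStationaryDistribution P Y π₀ :=
    ⟨inferInstance, c₀, fun t => by rw [hmarg, hstat]⟩
  have hQuniq : ∀ Q, IsStationaryProcessLaw P Y Q → Q = Q₀ := by
    rintro Q ⟨hQ, c, hc⟩
    have := hQlim c
    simp only [hc] at this
    exact eq_of_tvDist_eq_zero (tendsto_nhds_unique tendsto_const_nhds this)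
  have hπuniq : ∀ π, IsStationaryDistribution P Y π → π = π₀ := by
    rintro π ⟨hπ, c, hc⟩
    have := hπlim c
    simp only [hc] at this
    exact eq_of_tvDist_eq_zero (tendsto_nhds_unique tendsto_const_nhds this)
  exact ⟨⟨π₀, hπstat, hπuniq⟩, ⟨Q₀, hQstat, hQuniq⟩,
    fun π hπ c => hπuniq π hπ ▸ hπlim c, fun Q hQ c => hQuniq Q hQ ▸ hQlim c⟩

/-! ### Kernels with an atom charged uniformly -/

section Doeblin

variable {E : Type*} [MeasurableSpace E]

/-- One step of a kernel that charges `z` with mass at least `ε` from everywhere shrinks the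
oscillation of a bounded function by the factor `1 - ε`: every average contains `ε f(z)`. -/
theorem integral_mem_Icc_of_atom (κ : Measure E) [IsProbabilityMeasure κ] {z : E}
    {ε : ℝ} (hε : ε ≤ κ.real {z}) {f : E → ℝ} (hf : Measurable f)
    {a d : ℝ} (hfa : ∀ x, f x ∈ Set.Icc a (a + d)) :
    ∫ x, f x ∂κ ∈ Set.Icc (ε * f z + (1 - ε) * a) (ε * f z + (1 - ε) * a + (1 - ε) * d) := by
  have hint : Integrable f κ := Integrable.of_mem_Icc a (a + d) hf.aemeasurable (ae_of_all _ hfa)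
  have key : ∀ g : E → ℝ, Measurable g → Integrable g κ → (∀ x, 0 ≤ g x) →
      ε * g z ≤ ∫ x, g x ∂κ := by
    intro g hg hgi h0
    have h1 : ∫ x in {z}, g x ∂κ ≤ ∫ x, g x ∂κ := setIntegral_le_integral hgi (ae_of_all _ h0)
    rw [integral_singleton' hg.stronglyMeasurable z, smul_eq_mul] at h1
    exact (mul_le_mul_of_nonneg_right hε (h0 z)).trans h1
  have h1 := key (fun x => f x - a) (by fun_prop) (hint.sub (integrable_const a))
    fun x => by linarith [(hfa x).1]
  have h2 := key (fun x => a + d - f x) (by fun_prop) ((integrable_const _).sub hint)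
    fun x => by linarith [(hfa x).2]
  rw [integral_sub hint (integrable_const _)] at h1
  rw [integral_sub (integrable_const _) hint] at h2
  simp only [integral_const, probReal_univ, smul_eq_mul, one_mul] at h1 h2
  constructor <;> nlinarith

variable (K : Kernel E E) [IsMarkovKernel K]

theorem isProbabilityMeasure_iterate_bind (μ : Measure E) [IsProbabilityMeasure μ] (n : ℕ) :
    IsProbabilityMeasure ((fun m : Measure E => m.bind K)^[n] μ) := by
  induction n with
  | zero => simpa
  | succ n ih => rw [Function.iterate_succ_apply']; infer_instance

/-- After `n` steps of the kernel, the means of a bounded function from all initial distributions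
lie in a common interval whose length has shrunk by `(1 - ε) ^ n`. -/
theorem exists_integral_iterate_mem_Icc {z : E} {ε : ℝ}
    (hε : ∀ x, ε ≤ (K x).real {z}) (n : ℕ) {f : E → ℝ} (hf : Measurable f)
    {a d : ℝ} (hfa : ∀ x, f x ∈ Set.Icc a (a + d)) :
    ∃ b, ∀ (μ : Measure E) [IsProbabilityMeasure μ],
      ∫ x, f x ∂((fun m : Measure E => m.bind K)^[n] μ) ∈ Set.Icc b (b + (1 - ε) ^ n * d) := by
  induction n generalizing f a d with
  | zero =>
    refine ⟨a, fun μ hμ => ?_⟩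
    have hint : Integrable f μ := Integrable.of_mem_Icc a (a + d) hf.aemeasurable (ae_of_all _ hfa)
    have h1 := integral_mono (integrable_const a) hint fun x => (hfa x).1
    have h2 := integral_mono hint (integrable_const (a + d)) fun x => (hfa x).2
    simp only [integral_const, probReal_univ, smul_eq_mul, one_mul] at h1 h2
    simpa using ⟨h1, h2⟩
  | succ n ih =>
    have hf' : Measurable fun x => ∫ y, f y ∂(K x) :=
      (hf.stronglyMeasurable.integral_kernel).measurable
    obtain ⟨b, hb⟩ := ih hf' fun x => integral_mem_Icc_of_atom (K x) (hε x) hf hfa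
    refine ⟨b, fun μ hμ => ?_⟩
    have := isProbabilityMeasure_iterate_bind K μ n
    have hint := Kernel.integral_comp (η := K)
      (κ := Kernel.const Unit ((fun m : Measure E => m.bind K)^[n] μ)) (a := ()) (f := f)
      (Integrable.of_mem_Icc a (a + d) hf.aemeasurable (ae_of_all _ hfa))
    rw [Kernel.comp_apply, Kernel.const_apply] at hint
    rw [Function.iterate_succ_apply', hint, pow_succ, mul_assoc]
    exact hb μ

theorem abs_integral_iterate_sub_le {z : E} {ε : ℝ}
    (hε : ∀ x, ε ≤ (K x).real {z}) (n : ℕ) {f : E → ℝ} (hf : Measurable f)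
    (hf1 : ∀ x, f x ∈ Set.Icc 0 1) (μ ν : Measure E) [IsProbabilityMeasure μ]
    [IsProbabilityMeasure ν] :
    |∫ x, f x ∂((fun m : Measure E => m.bind K)^[n] μ) -
      ∫ x, f x ∂((fun m : Measure E => m.bind K)^[n] ν)| ≤ (1 - ε) ^ n := by
  obtain ⟨b, hb⟩ := exists_integral_iterate_mem_Icc K hε n hf (a := 0) (d := 1)
    (by simpa using hf1)
  have h1 := hb μ
  have h2 := hb ν
  rw [mul_one] at h1 h2
  exact abs_le.2 ⟨by linarith [h1.1, h2.2], by linarith [h1.2, h2.1]⟩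

/-- Existence of an invariant distribution: the occupation measure of the excursions from the atom
`z`, that is, the sum of the iterates of `δ_z` under the kernel killed on its return to `z`; its
mass is finite because each step is killed with probability at least `ε`. -/
theorem exists_invariant_of_atom {z : E} (hz : MeasurableSet {z}) {ε : ℝ} (hε0 : 0 < ε)
    (hε : ∀ x, ε ≤ (K x).real {z}) :
    ∃ π : Measure E, IsProbabilityMeasure π ∧ π.bind K = π := by
  classical
  set K₀ : Kernel E E := K.restrict hz.compl with hK₀
  set m : ℕ → Measure E := fun n => (fun m : Measure E => m.bind K₀)^[n] (Measure.dirac z) with hm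
  have hm_succ : ∀ n, m (n + 1) = (m n).bind K₀ := fun n => Function.iterate_succ_apply' _ _ _
  set r : ENNReal := ENNReal.ofReal (1 - ε) with hr
  have hr1 : r < 1 := by
    rw [hr, ← ENNReal.ofReal_one]
    exact (ENNReal.ofReal_lt_ofReal_iff one_pos).2 (by linarith)
  have hmass : ∀ n, m n Set.univ ≤ r ^ n := by
    intro n
    induction n with
    | zero => simp [hm]
    | succ n ih =>
      rw [hm_succ, Measure.bind_apply MeasurableSet.univ K₀.measurable.aemeasurable]
      calc ∫⁻ x, K₀ x Set.univ ∂(m n) ≤ ∫⁻ _, r ∂(m n) := by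
            refine lintegral_mono fun x => ?_
            rw [hK₀, Kernel.restrict_apply, Measure.restrict_apply_univ, hr,
              ← ofReal_measureReal]
            refine ENNReal.ofReal_le_ofReal ?_
            rw [measureReal_compl hz, probReal_univ]
            linarith [hε x]
        _ ≤ r ^ (n + 1) := by
            rw [lintegral_const, pow_succ, mul_comm]
            gcongr
  set occ : Measure E := Measure.sum m with hocc
  have hfin : occ Set.univ ≠ ⊤ := by
    rw [hocc, Measure.sum_apply _ MeasurableSet.univ]
    refine ne_top_of_le_ne_top ?_ (ENNReal.tsum_le_tsum hmass)
    rw [ENNReal.tsum_geometric]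
    exact ENNReal.inv_ne_top.2 (tsub_pos_of_lt hr1).ne'
  have hpos : occ Set.univ ≠ 0 := by
    have h1 : m 0 Set.univ ≤ occ Set.univ := by
      rw [hocc, Measure.sum_apply _ MeasurableSet.univ]
      exact ENNReal.le_tsum 0
    have h2 : m 0 Set.univ = 1 := by simp [hm]
    intro h
    rw [h, h2] at h1
    simp at h1
  have hbind : ∀ A, MeasurableSet A → occ.bind K A = ∫⁻ x, K x A ∂occ := fun A hA =>
    Measure.bind_apply hA K.measurable.aemeasurable
  -- off the atom the killed and the full kernel agree, which shifts the sum by one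
  have hoff : ∀ A, MeasurableSet A → A ⊆ {z}ᶜ → occ.bind K A = occ A := by
    intro A hA hAz
    have h0 : m 0 A = 0 := by
      have : z ∉ A := fun h => hAz h rfl
      simp [hm, Measure.dirac_apply' _ hA, this]
    rw [hbind A hA, hocc, lintegral_sum_measure, Measure.sum_apply _ hA,
      tsum_eq_zero_add' (f := fun n => m n A) ENNReal.summable, h0, zero_add]
    refine tsum_congr fun n => ?_
    rw [hm_succ, Measure.bind_apply hA K₀.measurable.aemeasurable]
    refine lintegral_congr fun x => ?_
    rw [hK₀, Kernel.restrict_apply, Measure.restrict_apply hA, Set.inter_eq_left.2 hAz]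
  have htot : occ.bind K Set.univ = occ Set.univ := by
    rw [hbind _ MeasurableSet.univ]
    simp
  have hinv : occ.bind K = occ := by
    have hatom : occ.bind K {z} = occ {z} := by
      have h1 := measure_add_measure_compl (μ := occ.bind K) hz
      have h2 := measure_add_measure_compl (μ := occ) hz
      rw [htot, ← h2, hoff _ hz.compl subset_rfl] at h1
      exact (ENNReal.add_left_inj (measure_ne_top_of_subset (Set.subset_univ _) hfin)).1 h1
    ext A hA
    rw [← measure_inter_add_sdiff A hz, ← measure_inter_add_sdiff (μ := occ) A hz,
      hoff (A \ {z}) (hA.diff hz) fun x hx => hx.2]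
    by_cases hzA : z ∈ A
    · rw [Set.inter_eq_right.2 (Set.singleton_subset_iff.2 hzA), hatom]
    · rw [Set.inter_singleton_eq_empty.2 hzA]
      simp
  refine ⟨(occ Set.univ)⁻¹ • occ, ⟨?_⟩, ?_⟩
  · rw [Measure.smul_apply, smul_eq_mul, ENNReal.inv_mul_cancel hpos hfin]
  · rw [Measure.bind_smul, hinv]

end Doeblin

/-! ### Markov processes driven by a shifted noise -/

theorem map_prod_eq_bind {E Ω F : Type*} [MeasurableSpace E] [MeasurableSpace Ω]
    [MeasurableSpace F] (μ : Measure E) (ρ : Measure Ω) [SFinite ρ] {g : E × Ω → F}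
    (hg : Measurable g) :
    (μ.prod ρ).map g = μ.bind fun z => ρ.map fun ω => g (z, ω) := by
  have h1 : Measurable fun z : E => ρ.map (Prod.mk z : Ω → E × Ω) := Measurable.map_prodMk_left
  have h2 : (fun z => ρ.map fun ω => g (z, ω)) = fun z => (ρ.map (Prod.mk z)).map g := by
    funext z
    rw [Measure.map_map hg measurable_prodMk_left]
    rfl
  have h3 : Measurable fun z => ρ.map fun ω => g (z, ω) := by
    rw [h2]
    exact (Measure.measurable_map g hg).comp h1
  ext A hA
  rw [Measure.map_apply hg hA, Measure.prod_apply (hg hA), Measure.bind_apply hA h3.aemeasurable]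
  refine lintegral_congr fun z => ?_
  exact (Measure.map_apply (hg.comp measurable_prodMk_left) hA).symm

/-- `S t` moves a pair (state, future noise) forward by time `t`.  The noise left over after time
`t` is again distributed like `ρ` and is independent of the state reached; `V` is a set of admissible
states that the motion does not leave, and the states reached satisfy the flow equation. -/
structure IsMarkovShift {T E Ω : Type*} [Add T] [MeasurableSpace E] [MeasurableSpace Ω]
    (ρ : Measure Ω) (V : Set E) (S : T → E × Ω → E × Ω) : Prop where
  measurable : ∀ t, Measurable (S t)
  map_eq : ∀ z ∈ V, ∀ t,
    ρ.map (fun ω => S t (z, ω)) = (ρ.map fun ω => (S t (z, ω)).1).prod ρ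
  mem : ∀ z ∈ V, ∀ t, ∀ᵐ ω ∂ρ, (S t (z, ω)).1 ∈ V
  add : ∀ z ∈ V, ∀ s t, ∀ᵐ ω ∂ρ, (S (s + t) (z, ω)).1 = (S t (S s (z, ω))).1

namespace IsMarkovShift

variable {T E Ω F : Type*} [MeasurableSpace E] [MeasurableSpace Ω] [MeasurableSpace F]

/-- The transition kernel of the state over time `t`. -/
noncomputable def kern [Add T] {ρ : Measure Ω} [IsProbabilityMeasure ρ] {V : Set E}
    {S : T → E × Ω → E × Ω} (h : IsMarkovShift ρ V S) (t : T) : Kernel E E where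
  toFun z := ρ.map fun ω => (S t (z, ω)).1
  measurable' := by
    have h1 : (fun z => ρ.map fun ω => (S t (z, ω)).1) =
        fun z => (ρ.map (Prod.mk z)).map fun x => (S t x).1 := by
      funext z
      rw [Measure.map_map (h.measurable t).fst measurable_prodMk_left]
      rfl
    rw [h1]
    exact (Measure.measurable_map _ (h.measurable t).fst).comp Measurable.map_prodMk_left

section Basic

variable [Add T] {ρ : Measure Ω} [IsProbabilityMeasure ρ] {V : Set E} {S : T → E × Ω → E × Ω}
  (h : IsMarkovShift ρ V S)
include h

theorem kern_apply (t : T) (z : E) : h.kern t z = ρ.map fun ω => (S t (z, ω)).1 := rfl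

omit [IsProbabilityMeasure ρ] in
theorem measurable_fst_section (t : T) (z : E) : Measurable fun ω => (S t (z, ω)).1 :=
  (h.measurable t).fst.comp measurable_prodMk_left

theorem isMarkovKernel_kern (t : T) : IsMarkovKernel (h.kern t) :=
  ⟨fun z => Measure.isProbabilityMeasure_map (h.measurable_fst_section t z).aemeasurable⟩

theorem kern_compl_eq_zero (hV : MeasurableSet V) (t : T) {z : E} (hz : z ∈ V) :
    h.kern t z Vᶜ = 0 := by
  rw [h.kern_apply, Measure.map_apply (h.measurable_fst_section t z) hV.compl]
  exact h.mem z hz t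

theorem map_fst_eq_bind (μ : Measure E) (t : T) :
    (μ.prod ρ).map (fun x => (S t x).1) = μ.bind (h.kern t) :=
  map_prod_eq_bind μ ρ (h.measurable t).fst

theorem map_prod_eq (μ : Measure E) (hμ : ∀ᵐ z ∂μ, z ∈ V) (t : T) :
    (μ.prod ρ).map (S t) = (μ.bind (h.kern t)).prod ρ := by
  have hm : Measurable fun z : E => ρ.map (Prod.mk z : Ω → E × Ω) := Measurable.map_prodMk_left
  rw [map_prod_eq_bind μ ρ (h.measurable t), Measure.prod,
    Measure.bind_bind (h.kern t).measurable.aemeasurable hm.aemeasurable]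
  refine Measure.bind_congr_right ?_
  filter_upwards [hμ] with z hz
  rw [h.map_eq z hz t, Measure.prod]
  rfl

theorem ae_bind_mem (hV : MeasurableSet V) {μ : Measure E} (hμ : ∀ᵐ z ∂μ, z ∈ V) (t : T) :
    ∀ᵐ z ∂(μ.bind (h.kern t)), z ∈ V := by
  change μ.bind (h.kern t) Vᶜ = 0
  rw [Measure.bind_apply hV.compl (h.kern t).measurable.aemeasurable, lintegral_eq_zero_iff
    ((h.kern t).measurable_coe hV.compl)]
  filter_upwards [hμ] with z hz
  exact h.kern_compl_eq_zero hV t hz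

/-- The Chapman–Kolmogorov equation. -/
theorem bind_kern_add {μ : Measure E} (hμ : ∀ᵐ z ∂μ, z ∈ V) (s t : T) :
    μ.bind (h.kern (s + t)) = (μ.bind (h.kern s)).bind (h.kern t) := by
  rw [Measure.bind_bind (h.kern s).measurable.aemeasurable (h.kern t).measurable.aemeasurable]
  refine Measure.bind_congr_right ?_
  filter_upwards [hμ] with z hz
  have h1 : (fun ω => (S (s + t) (z, ω)).1) =ᵐ[ρ] fun ω => (S t (S s (z, ω))).1 := h.add z hz s t
  rw [h.kern_apply, Measure.map_congr h1, ← h.map_fst_eq_bind, h.kern_apply, ← h.map_eq z hz s]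
  exact (Measure.map_map (h.measurable t).fst
    ((h.measurable s).comp measurable_prodMk_left)).symm

/-- The law of the trajectory after time `t` is the law of the trajectory started from the
distribution of the state at time `t`. -/
theorem trajectoryLaw_eq {Y : T → E × Ω → F} (hY : ∀ t, Measurable (Y t))
    (hshift : ∀ z ∈ V, ∀ t, ∀ᵐ ω ∂ρ, ∀ u, Y (t + u) (z, ω) = Y u (S t (z, ω)))
    {μ : Measure E} (hμ : ∀ᵐ z ∂μ, z ∈ V) (t : T) :
    trajectoryLaw (μ.prod ρ) Y t =
      ((μ.bind (h.kern t)).prod ρ).map (fun x u => Y u x) := by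
  have hm : Measurable fun x : E × Ω => fun u => Y u x := measurable_pi_iff.2 hY
  have hm' : Measurable fun x : E × Ω => fun u => Y (t + u) x :=
    measurable_pi_iff.2 fun u => hY _
  rw [← h.map_prod_eq μ hμ t, Measure.map_map hm (h.measurable t), trajectoryLaw,
    map_prod_eq_bind _ _ hm', map_prod_eq_bind _ _ (hm.comp (h.measurable t))]
  refine Measure.bind_congr_right ?_
  filter_upwards [hμ] with z hz
  refine Measure.map_congr ?_
  filter_upwards [hshift z hz t] with ω hω
  funext u
  exact hω u

end Basic

section Doeblin

variable [AddCommMonoid T] {ρ : Measure Ω} [IsProbabilityMeasure ρ] {V : Set E}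
  {S : T → E × Ω → E × Ω} (h : IsMarkovShift ρ V S) (hV : MeasurableSet V) {t₀ : T} {z₀ : E}
  (hz₀ : MeasurableSet {z₀}) {ε : ℝ} (hε0 : 0 < ε)
  (hε : ∀ z ∈ V, ε ≤ ρ.real {ω | (S t₀ (z, ω)).1 = z₀})
include h hV hz₀ hε

/-- A uniformly charged atom makes a kernel that agrees with the transition kernel over time `t₀`
on the admissible states, and that charges the atom from every state.  Off `V` the kernel jumps to
the atom. -/
theorem exists_kernel_of_atom : ∃ K : Kernel E E, IsMarkovKernel K ∧
    (∀ μ : Measure E, (∀ᵐ z ∂μ, z ∈ V) → μ.bind K = μ.bind (h.kern t₀)) ∧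
    (V.Nonempty → ε ≤ 1 ∧ (∀ z, ε ≤ (K z).real {z₀}) ∧ (0 < ε → ∀ z, K z Vᶜ = 0)) := by
  classical
  have hK := h.isMarkovKernel_kern t₀
  refine ⟨Kernel.piecewise hV (h.kern t₀) (Kernel.const E (Measure.dirac z₀)), inferInstance,
    fun μ hμ => ?_, fun hne => ?_⟩
  · refine Measure.bind_congr_right ?_
    filter_upwards [hμ] with z hz
    rw [Kernel.piecewise_apply, if_pos hz]
  · have h1 : ∀ z ∈ V, ε ≤ (h.kern t₀ z).real {z₀} := by
      intro z hz
      rw [h.kern_apply, map_measureReal_apply (h.measurable_fst_section t₀ z) hz₀]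
      exact hε z hz
    obtain ⟨v, hv⟩ := hne
    have hε1 : ε ≤ 1 := (h1 v hv).trans measureReal_le_one
    refine ⟨hε1, fun z => ?_, fun hε0 z => ?_⟩
    · rw [Kernel.piecewise_apply]
      split_ifs with hz
      · exact h1 z hz
      · rw [Kernel.const_apply, measureReal_def, Measure.dirac_apply' _ hz₀]
        simpa using hε1
    · rw [Kernel.piecewise_apply]
      split_ifs with hz
      · exact h.kern_compl_eq_zero hV t₀ hz
      · -- the atom is admissible: it has positive probability to be reached from `v`
        have hz₀V : z₀ ∈ V := by
          by_contra hcon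
          have h2 : (h.kern t₀ v).real {z₀} = 0 := by
            rw [measureReal_def, measure_mono_null (Set.singleton_subset_iff.2 hcon)
              (h.kern_compl_eq_zero hV t₀ hv), ENNReal.toReal_zero]
          linarith [h1 v hv]
        rw [Kernel.const_apply, Measure.dirac_apply' _ hV.compl]
        simp [hz₀V]

/-- Merging of the laws of the state, tested against functions with values in `[0, 1]`. -/
theorem abs_integral_bind_sub_le (hVne : V.Nonempty) {μ ν : Measure E} [IsProbabilityMeasure μ]
    [IsProbabilityMeasure ν] (hμ : ∀ᵐ z ∂μ, z ∈ V) (hν : ∀ᵐ z ∂ν, z ∈ V) {f : E → ℝ}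
    (hf : Measurable f) (hf1 : ∀ x, f x ∈ Set.Icc 0 1) (s : T) (n : ℕ) :
    |∫ x, f x ∂(μ.bind (h.kern (s + n • t₀))) - ∫ x, f x ∂(ν.bind (h.kern (s + n • t₀)))|
      ≤ (1 - ε) ^ n := by
  obtain ⟨K, hK, hKV, hKε⟩ := h.exists_kernel_of_atom hV hz₀ hε
  have hkern := fun t => h.isMarkovKernel_kern t
  have key : ∀ μ : Measure E, (∀ᵐ z ∂μ, z ∈ V) → ∀ n : ℕ,
      (fun m : Measure E => m.bind K)^[n] (μ.bind (h.kern s)) =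
        μ.bind (h.kern (s + n • t₀)) := by
    intro μ hμ n
    induction n with
    | zero => simp
    | succ n ih =>
      rw [Function.iterate_succ_apply', ih, hKV _ (h.ae_bind_mem hV hμ _), succ_nsmul, ← add_assoc,
        h.bind_kern_add hμ (s + n • t₀)]
  rw [← key μ hμ n, ← key ν hν n]
  exact abs_integral_iterate_sub_le K (hKε hVne).2.1 n hf hf1 _ _

include hε0

theorem exists_invariant (hVne : V.Nonempty) :
    ∃ π : Measure E, IsProbabilityMeasure π ∧ (∀ᵐ z ∂π, z ∈ V) ∧ ∀ t, π.bind (h.kern t) = π := by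
  obtain ⟨K, hK, hKV, hKε⟩ := h.exists_kernel_of_atom hV hz₀ hε
  have hkern := fun t => h.isMarkovKernel_kern t
  obtain ⟨hε1, hKz, hK0⟩ := hKε hVne
  obtain ⟨π, hπ, hinv⟩ := exists_invariant_of_atom K hz₀ hε0 hKz
  have hπV : ∀ᵐ z ∂π, z ∈ V := by
    change π Vᶜ = 0
    rw [← hinv, Measure.bind_apply hV.compl K.measurable.aemeasurable]
    simp [hK0 hε0]
  refine ⟨π, hπ, hπV, fun t => ?_⟩
  -- the kernels commute, so the law at time `t` is invariant too, and invariant laws merge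
  have hinv' : (π.bind (h.kern t)).bind K = π.bind (h.kern t) := by
    rw [hKV _ (h.ae_bind_mem hV hπV t), ← h.bind_kern_add hπV, add_comm, h.bind_kern_add hπV,
      ← hKV π hπV, hinv]
  refine eq_of_tvDist_eq_zero (le_antisymm ?_ (tvDist_nonneg _ _))
  have hlim : Tendsto (fun n : ℕ => (1 - ε) ^ n) atTop (𝓝 0) :=
    tendsto_pow_atTop_nhds_zero_of_lt_one (by linarith) (by linarith)
  refine ge_of_tendsto' hlim fun n => tvDist_le fun A hA => ?_
  have h1 := abs_integral_iterate_sub_le K hKz n (f := A.indicator fun _ => (1 : ℝ))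
    (measurable_const.indicator hA)
    (fun x => ⟨Set.indicator_nonneg (fun _ _ => zero_le_one) _,
      Set.indicator_le_self' (fun _ _ => zero_le_one) _⟩) (π.bind (h.kern t)) π
  rw [Function.iterate_fixed hinv', Function.iterate_fixed hinv] at h1
  simpa [integral_indicator_const, hA] using h1

/-- Merging of the laws of the trajectories. -/
theorem tendsto_tvDist_trajectoryLaw [PartialOrder T] [CanonicallyOrderedAdd T]
    (hVne : V.Nonempty) {Y : T → E × Ω → F}
    (hY : ∀ t, Measurable (Y t))
    (hshift : ∀ z ∈ V, ∀ t, ∀ᵐ ω ∂ρ, ∀ u, Y (t + u) (z, ω) = Y u (S t (z, ω)))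
    {μ ν : Measure E} [IsProbabilityMeasure μ] [IsProbabilityMeasure ν]
    (hμ : ∀ᵐ z ∂μ, z ∈ V) (hν : ∀ᵐ z ∂ν, z ∈ V) :
    Tendsto (fun t => tvDist (trajectoryLaw (μ.prod ρ) Y t) (trajectoryLaw (ν.prod ρ) Y t))
      atTop (𝓝 0) := by
  have hkern := fun t => h.isMarkovKernel_kern t
  have hε1 : ε ≤ 1 := by
    obtain ⟨v, hv⟩ := hVne
    exact (hε v hv).trans measureReal_le_one
  have hlim : Tendsto (fun n : ℕ => (1 - ε) ^ n) atTop (𝓝 0) :=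
    tendsto_pow_atTop_nhds_zero_of_lt_one (by linarith) (by linarith)
  have hm : Measurable fun x : E × Ω => fun u => Y u x := measurable_pi_iff.2 hY
  have bound : ∀ (s : T) (n : ℕ), tvDist (trajectoryLaw (μ.prod ρ) Y (s + n • t₀))
      (trajectoryLaw (ν.prod ρ) Y (s + n • t₀)) ≤ (1 - ε) ^ n := by
    intro s n
    refine tvDist_le fun A hA => ?_
    have hA' := hm hA
    have key : ∀ μ : Measure E, IsProbabilityMeasure μ → (∀ᵐ z ∂μ, z ∈ V) →
        (trajectoryLaw (μ.prod ρ) Y (s + n • t₀)).real A =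
          ∫ z, ρ.real (Prod.mk z ⁻¹' ((fun x u => Y u x) ⁻¹' A))
            ∂(μ.bind (h.kern (s + n • t₀))) := by
      intro μ _ hμ
      rw [h.trajectoryLaw_eq hY hshift hμ, map_measureReal_apply hm hA, measureReal_def,
        Measure.prod_apply hA']
      exact (integral_toReal (measurable_measure_prodMk_left hA').aemeasurable
        (ae_of_all _ fun z => measure_lt_top _ _)).symm
    rw [key μ inferInstance hμ, key ν inferInstance hν]
    exact h.abs_integral_bind_sub_le hV hz₀ hε hVne hμ hν
      (measurable_measure_prodMk_left hA').ennreal_toReal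
      (fun z => ⟨measureReal_nonneg, measureReal_le_one⟩) s n
  rw [Metric.tendsto_nhds]
  intro δ hδ
  obtain ⟨n, hn⟩ := (hlim.eventually (gt_mem_nhds hδ)).exists
  filter_upwards [eventually_ge_atTop (n • t₀)] with t ht
  obtain ⟨s, rfl⟩ := le_iff_exists_add'.1 ht
  rw [Real.dist_eq, sub_zero, abs_of_nonneg (tvDist_nonneg _ _)]
  exact (bound s n).trans_lt hn

end Doeblin

end IsMarkovShift

/-! ### The requests that remain after a time or after the first request -/

section Input

variable {M L : ℕ}

/-- The requests seen from time `d` on, if none has occurred by then. -/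
noncomputable def waitInput (d : ℝ) (ω : RequestInput M L) : RequestInput M L :=
  fun q => Function.update (ω q) 0 (ω q 0 - d)

theorem waitInput_waitInput (d u : ℝ) (ω : RequestInput M L) :
    waitInput u (waitInput d ω) = waitInput (d + u) ω := by
  funext q
  simp [waitInput, sub_sub]

theorem streamTime_waitInput (d : ℝ) (ω : RequestInput M L) (q : Fin M × Fin L) (n : ℕ) :
    streamTime (waitInput d ω) q n = -d + streamTime ω q n := by
  simp only [streamTime, Finset.sum_range_succ', waitInput]
  simp
  ring

variable [NeZero M] [NeZero L]

theorem earliest_congr {a b : Fin M × Fin L → ℝ} (h : ∀ q q', a q < a q' ↔ b q < b q') :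
    earliest a = earliest b := by
  have : (fun q q' => a q < a q') = fun q q' => b q < b q' := by
    funext q q'
    exact propext (h q q')
  simp only [earliest, List.argmin]
  congr 3

theorem earliest_const_add (c : ℝ) (a : Fin M × Fin L → ℝ) :
    earliest (fun q => c + a q) = earliest a :=
  earliest_congr fun q q' => by simp

theorem earliest_le (a : Fin M × Fin L → ℝ) (q : Fin M × Fin L) : a (earliest a) ≤ a q := by
  unfold earliest
  cases h : List.argmin a (Finset.univ : Finset (Fin M × Fin L)).toList with
  | none =>
    rw [List.argmin_eq_none] at h
    have : q ∈ (Finset.univ : Finset (Fin M × Fin L)).toList := by simp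
    simp [h] at this
  | some p => exact List.le_of_mem_argmin (by simp) h

theorem earliest_eq_of_lt {a : Fin M × Fin L → ℝ} {p : Fin M × Fin L} (h : ∀ q, q ≠ p → a p < a q) :
    earliest a = p := by
  by_contra hne
  exact absurd (earliest_le a p) (not_le.2 (h _ hne))

/-- The requests seen just after the first one: its stream has lost an interarrival time, the other
streams have waited. -/
noncomputable def tailInput (ω : RequestInput M L) : RequestInput M L := fun q =>
  if q = requestPair ω 0 then fun n => ω q (n + 1)
  else Function.update (ω q) 0 (ω q 0 - requestTime ω 0)

theorem requestPair_zero (ω : RequestInput M L) :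
    requestPair ω 0 = earliest fun q => ω q 0 := by
  simp [requestPair, streamTime, streamCount]

theorem requestTime_zero (ω : RequestInput M L) :
    requestTime ω 0 = ω (requestPair ω 0) 0 := by
  simp [requestTime, streamTime, streamCount]

theorem requestTime_zero_le (ω : RequestInput M L) (q : Fin M × Fin L) :
    requestTime ω 0 ≤ ω q 0 := by
  rw [requestTime_zero, requestPair_zero]
  exact earliest_le (fun q => ω q 0) q

theorem streamCount_waitInput (d : ℝ) (ω : RequestInput M L) (n : ℕ) :
    streamCount (waitInput d ω) n = streamCount ω n := by
  induction n with
  | zero => rfl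
  | succ n ih => simp only [streamCount, ih, streamTime_waitInput, earliest_const_add]

theorem requestPair_waitInput (d : ℝ) (ω : RequestInput M L) (n : ℕ) :
    requestPair (waitInput d ω) n = requestPair ω n := by
  simp only [requestPair, streamCount_waitInput, streamTime_waitInput, earliest_const_add]

theorem requestTime_waitInput (d : ℝ) (ω : RequestInput M L) (n : ℕ) :
    requestTime (waitInput d ω) n = requestTime ω n - d := by
  rw [requestTime, requestPair_waitInput, streamCount_waitInput, streamTime_waitInput, requestTime]
  ring

theorem tailInput_waitInput (d : ℝ) (ω : RequestInput M L) :
    tailInput (waitInput d ω) = tailInput ω := by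
  funext q
  simp only [tailInput, requestPair_waitInput, requestTime_waitInput]
  split_ifs
  · funext n
    simp [waitInput]
  · simp [waitInput]

theorem streamTime_tailInput (ω : RequestInput M L) (q : Fin M × Fin L) (n : ℕ) :
    streamTime (tailInput ω) q n =
      -requestTime ω 0 + streamTime ω q (n + if q = requestPair ω 0 then 1 else 0) := by
  by_cases h : q = requestPair ω 0
  · rw [if_pos h, streamTime, streamTime, Finset.sum_range_succ' _ (n + 1), requestTime_zero]
    simp only [tailInput, if_pos h]
    rw [h]
    ring
  · rw [if_neg h, add_zero, streamTime, streamTime, Finset.sum_range_succ',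
      Finset.sum_range_succ' (fun m => ω q m)]
    simp only [tailInput, if_neg h]
    simp
    ring

theorem streamCount_succ (ω : RequestInput M L) (n : ℕ) :
    streamCount ω (n + 1) = Function.update (streamCount ω n) (requestPair ω n)
      (streamCount ω n (requestPair ω n) + 1) := rfl

theorem streamCount_succ_eq (ω : RequestInput M L) (n : ℕ) (q : Fin M × Fin L) :
    streamCount ω (n + 1) q =
      streamCount (tailInput ω) n q + if q = requestPair ω 0 then 1 else 0 := by
  induction n generalizing q with
  | zero =>
    rw [streamCount_succ]
    by_cases h : q = requestPair ω 0
    · subst h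
      simp [streamCount]
    · simp [streamCount, h]
  | succ n ih =>
    have h1 : requestPair ω (n + 1) = requestPair (tailInput ω) n := by
      rw [requestPair, ← earliest_const_add (-requestTime ω 0), requestPair]
      simp only [streamTime_tailInput, ih]
    rw [streamCount_succ ω, h1, streamCount_succ (tailInput ω)]
    by_cases h : q = requestPair (tailInput ω) n
    · subst h
      simp only [Function.update_self, ih]
      omega
    · simp only [Function.update_of_ne h, ih]

theorem requestPair_succ (ω : RequestInput M L) (n : ℕ) :
    requestPair ω (n + 1) = requestPair (tailInput ω) n := by
  rw [requestPair, ← earliest_const_add (-requestTime ω 0), requestPair]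
  simp only [streamTime_tailInput, streamCount_succ_eq]

theorem requestTime_succ (ω : RequestInput M L) (n : ℕ) :
    requestTime ω (n + 1) = requestTime ω 0 + requestTime (tailInput ω) n := by
  rw [requestTime, requestTime.eq_def (tailInput ω), requestPair_succ, streamCount_succ_eq, streamTime_tailInput]
  ring

end Input

/-! ### The motion of the state -/

namespace MulticastNetwork

variable {M L : ℕ} (N : MulticastNetwork M L)

theorem serviceTime_pos (i : Fin M) : 0 < N.serviceTime i :=
  div_pos (N.fileSize_pos i) N.linkRate_pos

theorem serve_add (l : List (Fin M × Finset (Fin L))) (c : Fin L → List (Fin M)) (r d : ℝ) {u : ℝ}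
    (hu : 0 ≤ u) : N.serve l c r (d + u) = N.advance u (N.serve l c r d) := by
  induction l generalizing c r d with
  | nil => simp [serve, advance]
  | cons e q ih =>
    by_cases h : d < r
    · simp only [serve, advance, if_pos h]
      have h1 : d + u < r ↔ u < r - d := by constructor <;> intro <;> linarith
      simp only [h1, sub_sub, sub_sub_eq_add_sub, add_comm u d]
    · have h1 : ¬ d + u < r := by linarith
      simp only [serve, if_neg h, if_neg h1]
      rw [add_sub_right_comm, ih]

theorem advance_advance (d : ℝ) {u : ℝ} (hu : 0 ≤ u) (z : FullState M L) :
    N.advance u (N.advance d z) = N.advance (d + u) z :=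
  (N.serve_add _ _ _ _ hu).symm

theorem nodup_lruUpdate (c : ℕ) (i : Fin M) {l : List (Fin M)} (hl : l.Nodup) :
    (lruUpdate c i l).Nodup := by
  refine List.Nodup.sublist (List.take_sublist _ _) ?_
  exact List.nodup_cons.2 ⟨fun h => (hl.mem_erase_iff.1 h).1 rfl, hl.erase _⟩

theorem length_lruUpdate_le (c : ℕ) (i : Fin M) (l : List (Fin M)) :
    (lruUpdate c i l).length ≤ c := by
  simp [lruUpdate]

theorem valid_serve {l : List (Fin M × Finset (Fin L))} {c : Fin L → List (Fin M)} {r d : ℝ}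
    (hd : 0 ≤ d) (h : N.Valid (⟨l, c⟩, r)) : N.Valid (N.serve l c r d) := by
  induction l generalizing c r d with
  | nil =>
    obtain ⟨h1, h2, h3, -, -⟩ := h
    exact ⟨h1, h2, h3, fun _ => rfl, fun h => absurd rfl h⟩
  | cons e q ih =>
    obtain ⟨h1, h2, h3, -, h5⟩ := h
    obtain ⟨h6, h7⟩ := h5 (List.cons_ne_nil _ _)
    by_cases hdr : d < r
    · simp only [serve, if_pos hdr]
      refine ⟨h1, h2, h3, fun h => absurd h (List.cons_ne_nil _ _), fun _ => ⟨?_, ?_⟩⟩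
      · simpa using hdr
      · dsimp only at h7 ⊢
        linarith
    · simp only [serve, if_neg hdr]
      refine ih (sub_nonneg.2 (not_lt.1 hdr)) ⟨?_, ?_, ?_, ?_, ?_⟩
      · exact h1.sublist ((List.tail_sublist q).map _)
      · exact fun e' he' => h2 e' (List.mem_cons_of_mem _ he')
      · intro j
        simp only [deliver]
        split_ifs
        · exact ⟨nodup_lruUpdate _ _ (h3 j).1, length_lruUpdate_le _ _ _⟩
        · exact h3 j
      · rintro rfl
        rfl
      · intro hq
        refine ⟨?_, le_rfl⟩
        cases q with
        | nil => exact absurd rfl hq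
        | cons e' q' => exact N.serviceTime_pos _

theorem valid_advance {d : ℝ} (hd : 0 ≤ d) {z : FullState M L} (h : N.Valid z) :
    N.Valid (N.advance d z) := N.valid_serve hd h

theorem map_fst_mergeRequest (i : Fin M) (j : Fin L) (q : List (Fin M × Finset (Fin L))) :
    (mergeRequest i j q).map Prod.fst =
      if i ∈ q.map Prod.fst then q.map Prod.fst else q.map Prod.fst ++ [i] := by
  induction q with
  | nil => simp [mergeRequest]
  | cons e q ih =>
    by_cases h : e.1 = i
    · simp [mergeRequest, h]
    · have h' : i ≠ e.1 := fun h' => h h'.symm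
      simp only [mergeRequest, if_neg h, List.map_cons, ih, List.mem_cons, h', false_or]
      split_ifs <;> simp

theorem nonempty_of_mem_mergeRequest {i : Fin M} {j : Fin L} {q : List (Fin M × Finset (Fin L))}
    (h : ∀ e ∈ q, e.2.Nonempty) : ∀ e ∈ mergeRequest i j q, e.2.Nonempty := by
  induction q with
  | nil => simp [mergeRequest]
  | cons e q ih =>
    intro e' he'
    by_cases hi : e.1 = i
    · simp only [mergeRequest, if_pos hi, List.mem_cons] at he'
      rcases he' with rfl | he'
      · exact Finset.insert_nonempty _ _
      · exact h _ (List.mem_cons_of_mem _ he')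
    · simp only [mergeRequest, if_neg hi, List.mem_cons] at he'
      rcases he' with rfl | he'
      · exact h _ List.mem_cons_self
      · exact ih (fun e he => h e (List.mem_cons_of_mem _ he)) e' he'

theorem valid_request (p : Fin M × Fin L) {z : FullState M L} (h : N.Valid z) :
    N.Valid (N.request p z) := by
  obtain ⟨⟨q, c⟩, r⟩ := z
  obtain ⟨h1, h2, h3, h4, h5⟩ := h
  dsimp only at h1 h2 h3 h4 h5
  unfold request
  split_ifs with hp hq
  · refine ⟨h1, h2, fun j => ?_, h4, h5⟩
    by_cases hj : j = p.2
    · subst hj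
      simpa using ⟨nodup_lruUpdate _ _ (h3 _).1, length_lruUpdate_le _ _ _⟩
    · simpa [Function.update_of_ne hj] using h3 j
  · dsimp only at hq
    subst hq
    refine ⟨by simp [enqueue], by simp [enqueue], h3, by simp [enqueue], fun _ => ?_⟩
    exact ⟨N.serviceTime_pos _, le_rfl⟩
  · dsimp only at hq
    cases q with
    | nil => exact absurd rfl hq
    | cons e q =>
      refine ⟨?_, ?_, h3, by simp [enqueue], fun _ => h5 hq⟩
      · simp only [enqueue, List.tail_cons, map_fst_mergeRequest]
        split_ifs with hi
        · exact h1
        · exact List.Nodup.append h1 (List.nodup_singleton _)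
            (List.disjoint_singleton.2 hi)
      · intro e' he'
        simp only [enqueue, List.mem_cons] at he'
        rcases he' with rfl | he'
        · exact h2 _ List.mem_cons_self
        · exact nonempty_of_mem_mergeRequest (fun e he => h2 e (List.mem_cons_of_mem _ he)) e' he'

/-! ### Draining the queue -/

/-- A time after which the server is idle if there is no request meanwhile: the files of the entries
not in transmission are distinct. -/
noncomputable def drainTime : ℝ := 2 * ∑ i, N.serviceTime i

theorem serviceTime_le_drainTime_half (i : Fin M) :
    N.serviceTime i ≤ ∑ i, N.serviceTime i :=
  Finset.single_le_sum (fun i _ => (N.serviceTime_pos i).le) (Finset.mem_univ i)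

theorem drainTime_nonneg : 0 ≤ N.drainTime :=
  mul_nonneg zero_le_two (Finset.sum_nonneg fun i _ => (N.serviceTime_pos i).le)

/-- Left without requests, the state `z` becomes idle with caches `c`. -/
def DrainsTo (z : FullState M L) (c : Fin L → List (Fin M)) : Prop :=
  N.advance N.drainTime z = (⟨[], c⟩, 0)

theorem exists_serve_eq_idle (l : List (Fin M × Finset (Fin L))) (c : Fin L → List (Fin M))
    {r d : ℝ} (h : r + (l.tail.map fun e => N.serviceTime e.1).sum ≤ d) :
    ∃ c', N.serve l c r d = (⟨[], c'⟩, 0) := by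
  induction l generalizing c r d with
  | nil => exact ⟨c, rfl⟩
  | cons e q ih =>
    have hsum : ∀ q : List (Fin M × Finset (Fin L)),
        0 ≤ (q.map fun e => N.serviceTime e.1).sum := fun q =>
      List.sum_nonneg fun x hx => by
        obtain ⟨e, -, rfl⟩ := List.mem_map.1 hx
        exact (N.serviceTime_pos _).le
    have h1 : ¬ d < r := by
      have := hsum q
      simp only [List.tail_cons] at h
      linarith
    simp only [serve, if_neg h1]
    refine ih _ ?_
    cases q with
    | nil => simp [headTime]; linarith
    | cons e' q' =>
      simp only [headTime, List.tail_cons, List.map_cons, List.sum_cons] at h ⊢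
      linarith

theorem exists_drainsTo {z : FullState M L} (hz : N.Valid z) : ∃ c, N.DrainsTo z c := by
  obtain ⟨⟨q, c⟩, r⟩ := z
  obtain ⟨h1, -, -, h4, h5⟩ := hz
  dsimp only at h1 h4 h5
  refine N.exists_serve_eq_idle q c ?_
  have hr : r ≤ ∑ i, N.serviceTime i := by
    cases q with
    | nil =>
      rw [h4 rfl]
      exact Finset.sum_nonneg fun i _ => (N.serviceTime_pos i).le
    | cons e q => exact (h5 (List.cons_ne_nil _ _)).2.trans (N.serviceTime_le_drainTime_half _)
  have hs : (q.tail.map fun e => N.serviceTime e.1).sum ≤ ∑ i, N.serviceTime i := by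
    have h6 : (q.tail.map fun e => N.serviceTime e.1) =
        (q.tail.map Prod.fst).map N.serviceTime := by
      rw [List.map_map]
      rfl
    rw [h6, ← List.sum_toFinset _ h1]
    exact Finset.sum_le_sum_of_subset_of_nonneg (Finset.subset_univ _)
      fun i _ _ => (N.serviceTime_pos i).le
  rw [drainTime]
  dsimp only
  linarith

variable {N}

theorem DrainsTo.advance_eq {z : FullState M L} {c : Fin L → List (Fin M)} (h : N.DrainsTo z c)
    {d : ℝ} (hd : N.drainTime ≤ d) : N.advance d z = (⟨[], c⟩, 0) := by
  have h1 : N.advance d z = N.advance (d - N.drainTime) (N.advance N.drainTime z) := by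
    rw [N.advance_advance _ (sub_nonneg.2 hd)]
    congr 1
    ring
  rw [h1, h]
  rfl

variable (N)

/-- The effect on the caches of a request that meets an idle server, once it has been dealt with:
hits and misses act alike. -/
def touch (c : Fin L → List (Fin M)) (p : Fin M × Fin L) : Fin L → List (Fin M) :=
  Function.update c p.2 (lruUpdate (N.capacity p.2) p.1 (c p.2))

theorem request_idle_of_mem {p : Fin M × Fin L} {c : Fin L → List (Fin M)} (h : p.1 ∈ c p.2) :
    N.request p (⟨[], c⟩, 0) = (⟨[], N.touch c p⟩, 0) := by
  simp [request, h, touch]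

theorem request_idle_of_notMem {p : Fin M × Fin L} {c : Fin L → List (Fin M)} (h : p.1 ∉ c p.2) :
    N.request p (⟨[], c⟩, 0) = (⟨[(p.1, {p.2})], c⟩, N.serviceTime p.1) := by
  simp [request, h, enqueue]

theorem deliver_singleton (p : Fin M × Fin L) (c : Fin L → List (Fin M)) :
    N.deliver p.1 {p.2} c = N.touch c p := by
  funext j
  by_cases h : j = p.2
  · subst h
    simp [deliver, touch]
  · simp [deliver, touch, h]

theorem drainsTo_request_idle (p : Fin M × Fin L) (c : Fin L → List (Fin M)) :
    N.DrainsTo (N.request p (⟨[], c⟩, 0)) (N.touch c p) := by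
  by_cases h : p.1 ∈ c p.2
  · rw [N.request_idle_of_mem h]
    rfl
  · rw [N.request_idle_of_notMem h, DrainsTo, MulticastNetwork.advance]
    have h1 : ¬ N.drainTime < N.serviceTime p.1 := by
      have := N.serviceTime_le_drainTime_half p.1
      have := N.serviceTime_pos p.1
      rw [drainTime]
      linarith
    simp only [serve, if_neg h1, N.deliver_singleton p]

/-! ### Requesting every file at every user resets the caches -/

theorem lruUpdate_take (C : ℕ) (i : Fin M) (x : List (Fin M)) :
    lruUpdate C i (x.take C) = (i :: x.erase i).take C := by
  cases C with
  | zero => simp [lruUpdate]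
  | succ C =>
    simp only [lruUpdate, List.take_succ_cons, List.cons.injEq, true_and]
    induction x generalizing C with
    | nil => simp
    | cons a x ih =>
      by_cases h : a = i
      · subst h
        simp
      · have h' : ¬ (a == i) = true := by simpa using h
        rw [List.take_succ_cons, List.erase_cons_tail h', List.erase_cons_tail h']
        cases C with
        | zero => simp
        | succ C =>
          rw [List.take_succ_cons, List.take_succ_cons, ih]

theorem foldl_lruUpdate (C : ℕ) {l : List (Fin M)} (hl : l.Nodup) (hC : l.length ≤ C)
    {is : List (Fin M)} (his : is.Nodup) :
    is.foldl (fun x i => lruUpdate C i x) l =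
      (is.reverse ++ l.filter fun a => a ∉ is).take C := by
  induction is using List.reverseRecOn with
  | nil => simp [List.take_of_length_le hC]
  | append_singleton is i ih =>
    have hnd := List.nodup_append.1 his
    have hi : i ∉ is := fun h => hnd.2.2 i h i (by simp) rfl
    rw [List.foldl_append, ih hnd.1, List.foldl_cons, List.foldl_nil, lruUpdate_take,
      List.erase_append_right _ (by simpa using hi), (hl.filter _).erase_eq_filter,
      List.filter_filter]
    simp only [List.reverse_append, List.reverse_singleton, List.cons_append]
    congr 3
    refine List.filter_congr fun a _ => ?_
    by_cases h : a = i <;> simp [h]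

theorem foldl_touch_apply (ps : List (Fin M × Fin L)) (c : Fin L → List (Fin M)) (j : Fin L) :
    ps.foldl N.touch c j =
      ((ps.filter fun p => p.2 = j).map Prod.fst).foldl
        (fun x i => lruUpdate (N.capacity j) i x) (c j) := by
  induction ps generalizing c with
  | nil => rfl
  | cons p ps ih =>
    rw [List.foldl_cons, ih]
    by_cases h : p.2 = j
    · subst h
      simp [touch]
    · have h' : j ≠ p.2 := fun h' => h h'.symm
      simp [touch, h, Function.update_of_ne h']

/-- All pairs of a file and a user, in a fixed order. -/
noncomputable def allRequests (M L : ℕ) : List (Fin M × Fin L) := Finset.univ.toList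

/-- The caches after one request for every file by every user. -/
noncomputable def resetCache : Fin L → List (Fin M) :=
  fun j => (((allRequests M L).filter fun p => p.2 = j).map Prod.fst).reverse.take (N.capacity j)

theorem foldl_touch_allRequests {c : Fin L → List (Fin M)}
    (hc : ∀ j, (c j).Nodup ∧ (c j).length ≤ N.capacity j) :
    (allRequests M L).foldl N.touch c = N.resetCache := by
  funext j
  have hnd : (((allRequests M L).filter fun p => p.2 = j).map Prod.fst).Nodup := by
    refine List.Nodup.map_on ?_ ((Finset.nodup_toList _).filter _)
    intro p hp q hq hpq
    simp only [List.mem_filter, decide_eq_true_eq] at hp hq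
    exact Prod.ext hpq (hp.2.trans hq.2.symm)
  rw [N.foldl_touch_apply, foldl_lruUpdate _ (hc j).1 (hc j).2 hnd, resetCache]
  congr 1
  have : (c j).filter (fun a => a ∉ ((allRequests M L).filter fun p => p.2 = j).map Prod.fst) = [] := by
    rw [List.filter_eq_nil_iff]
    intro a _
    simp [allRequests]
  rw [this, List.append_nil]

variable {N} in
theorem DrainsTo.cache_valid {z : FullState M L} (hz : N.Valid z) {c : Fin L → List (Fin M)}
    (h : N.DrainsTo z c) (j : Fin L) : (c j).Nodup ∧ (c j).length ≤ N.capacity j := by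
  have h1 := N.valid_advance N.drainTime_nonneg hz
  rw [h] at h1
  exact h1.2.2.1 j

end MulticastNetwork

/-! ### The process as an iterated shift -/

namespace MulticastNetwork

variable {M L : ℕ} (N : MulticastNetwork M L)

/-- Lapse of the time `d` without a request, for the state and for the requests to come. -/
noncomputable def wait (d : ℝ) (x : FullState M L × RequestInput M L) :
    FullState M L × RequestInput M L :=
  (N.advance d x.1, waitInput d x.2)

theorem wait_wait (d : ℝ) {u : ℝ} (hu : 0 ≤ u) (x : FullState M L × RequestInput M L) :
    N.wait u (N.wait d x) = N.wait (d + u) x := by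
  simp only [wait, N.advance_advance d hu, waitInput_waitInput]

variable [NeZero M] [NeZero L]

/-- Lapse of the time until just after the first request. -/
noncomputable def step (x : FullState M L × RequestInput M L) :
    FullState M L × RequestInput M L :=
  (N.request (requestPair x.2 0) (N.advance (requestTime x.2 0) x.1), tailInput x.2)

theorem step_wait {d : ℝ} (x : FullState M L × RequestInput M L) (hd : d ≤ requestTime x.2 0) :
    N.step (N.wait d x) = N.step x := by
  simp only [step, wait, requestPair_waitInput, requestTime_waitInput, tailInput_waitInput,
    N.advance_advance d (sub_nonneg.2 hd), add_sub_cancel]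

theorem afterRequest_succ (x : FullState M L × RequestInput M L) (n : ℕ) :
    N.afterRequest x (n + 1) = N.afterRequest (N.step x) n := by
  induction n with
  | zero => simp [afterRequest, step]
  | succ n ih =>
    rw [afterRequest, ih, afterRequest, requestPair_succ]
    have h : (requestTime x.2 (n + 1) - if n + 1 = 0 then 0 else requestTime x.2 (n + 1 - 1)) =
        requestTime (N.step x).2 n - if n = 0 then 0 else requestTime (N.step x).2 (n - 1) := by
      cases n with
      | zero => simp [requestTime_succ, step]
      | succ n => simp [requestTime_succ x.2, step]
    rw [h]
    rfl

theorem afterRequest_eq_iterate (x : FullState M L × RequestInput M L) (n : ℕ) :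
    N.afterRequest x n = (N.step^[n] x).1 := by
  induction n generalizing x with
  | zero => rfl
  | succ n ih => rw [N.afterRequest_succ, ih, Function.iterate_succ_apply]

theorem beforeRequest_succ (x : FullState M L × RequestInput M L) (n : ℕ) :
    N.beforeRequest (n + 1) x = N.beforeRequest n (N.step x) := by
  rw [beforeRequest, beforeRequest, N.afterRequest_succ]
  congr 1
  cases n with
  | zero => simp [requestTime_succ, step]
  | succ n => simp [requestTime_succ x.2, step]

theorem beforeRequest_zero (x : FullState M L × RequestInput M L) :
    N.beforeRequest 0 x = N.advance (requestTime x.2 0) x.1 := by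
  simp [beforeRequest, afterRequest]

theorem beforeRequest_iterate (x : FullState M L × RequestInput M L) (n k : ℕ) :
    N.beforeRequest (k + n) x = N.beforeRequest k (N.step^[n] x) := by
  induction n generalizing x with
  | zero => rfl
  | succ n ih => rw [← add_assoc, N.beforeRequest_succ, ih, Function.iterate_succ_apply]

theorem requestPair_iterate (x : FullState M L × RequestInput M L) (n k : ℕ) :
    requestPair x.2 (k + n) = requestPair (N.step^[n] x).2 k := by
  induction n generalizing x with
  | zero => rfl
  | succ n ih =>
    rw [← add_assoc, requestPair_succ, Function.iterate_succ_apply, ← ih]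
    rfl

theorem iterate_step_snd (x : FullState M L × RequestInput M L) (n : ℕ) :
    (N.step^[n] x).2 = tailInput^[n] x.2 := by
  induction n generalizing x with
  | zero => rfl
  | succ n ih => rw [Function.iterate_succ_apply, ih, Function.iterate_succ_apply]; rfl

/-- The state at time `t` together with the requests after time `t`, seen from time `t`. -/
noncomputable def shiftAt (t : ℝ) (x : FullState M L × RequestInput M L) :
    FullState M L × RequestInput M L :=
  N.wait (t - if requestCount x.2 t = 0 then 0 else requestTime x.2 (requestCount x.2 t - 1))
    (N.step^[requestCount x.2 t] x)

theorem fullStateAt_eq (t : ℝ≥0) (x : FullState M L × RequestInput M L) :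
    N.fullStateAt t x = (N.shiftAt t x).1 := by
  rw [fullStateAt, shiftAt, wait, N.afterRequest_eq_iterate]

/-- The inputs for which the recursive description of the process holds: the requests are ordered in
time and only finitely many occur in bounded time. -/
structure _root_.IsRegularInput (ω : RequestInput M L) : Prop where
  nonneg : ∀ n, 0 ≤ requestTime (tailInput^[n] ω) 0
  exists_lt : ∀ t, ∃ n, t < requestTime ω n

end MulticastNetwork

namespace IsRegularInput

variable {M L : ℕ} [NeZero M] [NeZero L] {ω : RequestInput M L}

theorem tail (h : IsRegularInput ω) : IsRegularInput (tailInput ω) where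
  nonneg n := h.nonneg (n + 1)
  exists_lt t := by
    obtain ⟨n, hn⟩ := h.exists_lt (max (t + requestTime ω 0) (requestTime ω 0))
    cases n with
    | zero => exact absurd hn (not_lt.2 (le_max_right _ _))
    | succ n =>
      rw [requestTime_succ] at hn
      exact ⟨n, by linarith [le_max_left (t + requestTime ω 0) (requestTime ω 0)]⟩

theorem wait (h : IsRegularInput ω) {d : ℝ} (hd : d ≤ requestTime ω 0) :
    IsRegularInput (waitInput d ω) where
  nonneg n := by
    cases n with
    | zero =>
      rw [Function.iterate_zero_apply, requestTime_waitInput]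
      exact sub_nonneg.2 hd
    | succ n =>
      rw [Function.iterate_succ_apply, tailInput_waitInput]
      exact h.nonneg (n + 1)
  exists_lt t := by
    obtain ⟨n, hn⟩ := h.exists_lt (t + d)
    exact ⟨n, by rw [requestTime_waitInput]; linarith⟩

end IsRegularInput

section RequestCount

variable {M L : ℕ} [NeZero M] [NeZero L]

theorem requestCount_eq_zero {ω : RequestInput M L} {t : ℝ} (h : t < requestTime ω 0) :
    requestCount ω t = 0 := Nat.sInf_eq_zero.2 (Or.inl h)

theorem requestCount_eq_succ {ω : RequestInput M L} (hω : IsRegularInput ω) {t : ℝ}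
    (h : requestTime ω 0 ≤ t) :
    requestCount ω t = requestCount (tailInput ω) (t - requestTime ω 0) + 1 := by
  have h1 : 1 ≤ sInf {n | t < requestTime ω n} := by
    rw [Nat.one_le_iff_ne_zero]
    intro h0
    rcases Nat.sInf_eq_zero.1 h0 with h0 | h0
    · exact absurd h0 (not_lt.2 h)
    · obtain ⟨n, hn⟩ := hω.exists_lt t
      exact (Set.eq_empty_iff_forall_notMem.1 h0 n) hn
  have h2 : {n | t - requestTime ω 0 < requestTime (tailInput ω) n} =
      {n | t < requestTime ω (n + 1)} := by
    ext n
    simp only [Set.mem_ofPred_eq, requestTime_succ, sub_lt_iff_lt_add']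
  rw [requestCount, requestCount, h2]
  exact (Nat.sInf_add h1).symm

end RequestCount

namespace MulticastNetwork

variable {M L : ℕ} (N : MulticastNetwork M L) [NeZero M] [NeZero L]

theorem shiftAt_of_lt {t : ℝ} {x : FullState M L × RequestInput M L} (h : t < requestTime x.2 0) :
    N.shiftAt t x = N.wait t x := by
  simp [shiftAt, requestCount_eq_zero h]

theorem shiftAt_of_le {t : ℝ} {x : FullState M L × RequestInput M L} (hx : IsRegularInput x.2)
    (h : requestTime x.2 0 ≤ t) : N.shiftAt t x = N.shiftAt (t - requestTime x.2 0) (N.step x) := by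
  have h1 : (N.step x).2 = tailInput x.2 := rfl
  rw [shiftAt, shiftAt, requestCount_eq_succ hx h, h1, Function.iterate_succ_apply]
  congr 1
  cases requestCount (tailInput x.2) (t - requestTime x.2 0) with
  | zero => simp
  | succ k => simp [requestTime_succ x.2, sub_sub]

/-- Induction along the requests before time `t`. -/
theorem shiftAt_induction {p : ℝ → FullState M L × RequestInput M L → Prop}
    (wait : ∀ t x, IsRegularInput x.2 → 0 ≤ t → t < requestTime x.2 0 → p t x)
    (step : ∀ t x, IsRegularInput x.2 → requestTime x.2 0 ≤ t →
      p (t - requestTime x.2 0) (N.step x) → p t x)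
    {t : ℝ} (ht : 0 ≤ t) {x : FullState M L × RequestInput M L} (hx : IsRegularInput x.2) :
    p t x := by
  induction hn : requestCount x.2 t generalizing t x with
  | zero =>
    rcases lt_or_ge t (requestTime x.2 0) with h | h
    · exact wait t x hx ht h
    · rw [requestCount_eq_succ hx h] at hn
      omega
  | succ n ih =>
    rcases lt_or_ge t (requestTime x.2 0) with h | h
    · exact wait t x hx ht h
    · rw [requestCount_eq_succ hx h] at hn
      exact step t x hx h (ih (sub_nonneg.2 h) hx.tail (Nat.succ_injective hn))

/-- The flow equation. -/
theorem shiftAt_add {t u : ℝ} (ht : 0 ≤ t) (hu : 0 ≤ u) {x : FullState M L × RequestInput M L}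
    (hx : IsRegularInput x.2) : N.shiftAt (t + u) x = N.shiftAt u (N.shiftAt t x) := by
  revert hx
  refine fun hx => N.shiftAt_induction
    (p := fun t x => N.shiftAt (t + u) x = N.shiftAt u (N.shiftAt t x)) ?_ ?_ ht hx
  · intro t x hx ht h
    have h1 : requestTime (N.wait t x).2 0 = requestTime x.2 0 - t := requestTime_waitInput _ _ _
    rw [N.shiftAt_of_lt h]
    rcases lt_or_ge (t + u) (requestTime x.2 0) with h2 | h2
    · rw [N.shiftAt_of_lt h2, N.shiftAt_of_lt (by rw [h1]; linarith), N.wait_wait t hu]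
    · rw [N.shiftAt_of_le hx h2, N.shiftAt_of_le (x := N.wait t x) (hx.wait h.le)
        (by rw [h1]; linarith), N.step_wait x h.le, h1]
      congr 1
      ring
  · intro t x hx h ih
    rw [N.shiftAt_of_le hx h, N.shiftAt_of_le hx (by linarith), ← ih]
    congr 1
    ring

theorem valid_step {x : FullState M L × RequestInput M L} (hz : N.Valid x.1)
    (hx : 0 ≤ requestTime x.2 0) : N.Valid (N.step x).1 :=
  N.valid_request _ (N.valid_advance hx hz)

theorem valid_iterate_step {x : FullState M L × RequestInput M L} (hz : N.Valid x.1)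
    (hx : IsRegularInput x.2) (n : ℕ) : N.Valid (N.step^[n] x).1 := by
  induction n generalizing x with
  | zero => exact hz
  | succ n ih =>
    rw [Function.iterate_succ_apply]
    exact ih (N.valid_step hz (hx.nonneg 0)) hx.tail

theorem valid_shiftAt {t : ℝ} (ht : 0 ≤ t) {x : FullState M L × RequestInput M L}
    (hz : N.Valid x.1) (hx : IsRegularInput x.2) : N.Valid (N.shiftAt t x).1 := by
  revert hz
  refine N.shiftAt_induction (p := fun t x => N.Valid x.1 → N.Valid (N.shiftAt t x).1) ?_ ?_ ht hx
  · intro t x _ ht h hz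
    rw [N.shiftAt_of_lt h]
    exact N.valid_advance ht hz
  · intro t x hx h ih hz
    rw [N.shiftAt_of_le hx h]
    exact ih (N.valid_step hz (hx.nonneg 0))

end MulticastNetwork

/-! ### Measurability -/

theorem sInf_eq_iff_of_nat {s : Set ℕ} {k : ℕ} :
    sInf s = k ↔ (k ∈ s ∧ ∀ m < k, m ∉ s) ∨ (k = 0 ∧ ∀ m, m ∉ s) := by
  constructor
  · rintro rfl
    rcases s.eq_empty_or_nonempty with rfl | h
    · exact Or.inr ⟨by simp, by simp⟩
    · exact Or.inl ⟨Nat.sInf_mem h, fun m hm => Nat.notMem_of_lt_sInf hm⟩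
  · rintro (⟨h1, h2⟩ | ⟨rfl, h⟩)
    · exact le_antisymm (Nat.sInf_le h1) (not_lt.1 fun h => h2 _ h (Nat.sInf_mem ⟨k, h1⟩))
    · exact Nat.sInf_eq_zero.2 (Or.inr (Set.eq_empty_iff_forall_notMem.2 h))

theorem measurable_sInf_nat {X : Type*} [MeasurableSpace X] {p : ℕ → X → Prop}
    (hp : ∀ n, MeasurableSet {x | p n x}) : Measurable fun x => sInf {n | p n x} := by
  have hp' : ∀ n, Measurable (p n) := fun n => measurableSet_setOfPred.1 (hp n)
  refine measurable_to_countable' fun k => ?_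
  have h1 : (fun x => sInf {n | p n x}) ⁻¹' {k} =
      {x | (p k x ∧ ∀ m, m < k → ¬ p m x) ∨ (k = 0 ∧ ∀ m, ¬ p m x)} := by
    ext x
    exact sInf_eq_iff_of_nat
  rw [h1]
  exact measurableSet_setOfPred.2 (((hp' k).and (Measurable.forall fun m =>
    measurable_const.imp (hp' m).not)).or
      (measurable_const.and (Measurable.forall fun m => (hp' m).not)))

section Measurability

variable {M L : ℕ}

instance : DiscreteMeasurableSpace (SystemState M L) := ⟨fun _ => trivial⟩

instance : Countable (SystemState M L) := by
  have : Function.Injective fun x : SystemState M L => (x.queue, x.cache) := by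
    rintro ⟨q, c⟩ ⟨q', c'⟩ h
    simp only [Prod.mk.injEq] at h
    rw [h.1, h.2]
  exact this.countable

theorem measurable_waitInput : Measurable fun y : ℝ × RequestInput M L => waitInput y.1 y.2 := by
  refine measurable_pi_iff.2 fun q => measurable_pi_iff.2 fun n => ?_
  cases n with
  | zero =>
    simp only [waitInput, Function.update_self]
    fun_prop
  | succ n =>
    simp only [waitInput, ne_eq, Nat.succ_ne_zero, not_false_eq_true, Function.update_of_ne]
    fun_prop

variable [NeZero M] [NeZero L]

theorem measurable_earliest : Measurable (earliest : (Fin M × Fin L → ℝ) → Fin M × Fin L) := by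
  let G : (Fin M × Fin L → ℝ) → (Fin M × Fin L) × (Fin M × Fin L) → Prop :=
    fun a q => a q.1 < a q.2
  have hG : Measurable G := measurable_pi_iff.2 fun q =>
    measurableSet_setOfPred.1 (measurableSet_lt (measurable_pi_apply _) (measurable_pi_apply _))
  have hfac : Function.FactorsThrough (earliest (M := M) (L := L)) G := fun a b h =>
    earliest_congr fun q q' => by
      have := congrFun h (q, q')
      exact iff_of_eq this
  obtain ⟨f, hf⟩ := (Function.factorsThrough_iff _).1 hfac
  rw [hf]
  exact (measurable_of_countable f).comp hG

theorem measurable_requestPair_zero :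
    Measurable fun ω : RequestInput M L => requestPair ω 0 := by
  simp only [requestPair_zero]
  exact measurable_earliest.comp (by fun_prop)

theorem measurable_requestTime_zero :
    Measurable fun ω : RequestInput M L => requestTime ω 0 := by
  simp only [requestTime_zero]
  have h : Measurable fun y : (Fin M × Fin L) × RequestInput M L => y.2 y.1 0 :=
    measurable_from_prod_countable_right fun p => by fun_prop
  exact h.comp (measurable_requestPair_zero.prodMk measurable_id)

theorem measurable_tailInput : Measurable (tailInput : RequestInput M L → RequestInput M L) := by
  refine measurable_pi_iff.2 fun q => ?_
  unfold tailInput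
  refine Measurable.ite ?_ ?_ ?_
  · exact measurableSet_eq_fun measurable_const measurable_requestPair_zero
  · fun_prop
  · refine measurable_pi_iff.2 fun n => ?_
    cases n with
    | zero =>
      simp only [Function.update_self]
      have := measurable_requestTime_zero (M := M) (L := L)
      fun_prop
    | succ n =>
      simp only [ne_eq, Nat.succ_ne_zero, not_false_eq_true, Function.update_of_ne]
      fun_prop

theorem measurable_requestTime (n : ℕ) : Measurable fun ω : RequestInput M L => requestTime ω n := by
  induction n with
  | zero => exact measurable_requestTime_zero
  | succ n ih =>
    simp only [requestTime_succ]
    exact measurable_requestTime_zero.add (ih.comp measurable_tailInput)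

theorem measurable_requestCount :
    Measurable fun y : ℝ × RequestInput M L => requestCount y.2 y.1 :=
  measurable_sInf_nat fun n =>
    measurableSet_lt measurable_fst ((measurable_requestTime n).comp measurable_snd)

end Measurability

namespace MulticastNetwork

variable {M L : ℕ} (N : MulticastNetwork M L)

theorem measurable_advance : Measurable fun y : ℝ × FullState M L => N.advance y.1 y.2 := by
  have h : Measurable fun y : SystemState M L × (ℝ × ℝ) =>
      N.serve y.1.queue y.1.cache y.2.1 y.2.2 := by
    refine measurable_from_prod_countable_right fun x => ?_
    dsimp only
    generalize x.queue = l
    generalize x.cache = c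
    induction l generalizing c with
    | nil => exact measurable_const
    | cons e q ih =>
      refine Measurable.ite (measurableSet_lt measurable_snd measurable_fst) ?_ ?_
      · exact measurable_const.prodMk (measurable_fst.sub measurable_snd)
      · exact (ih (N.deliver e.1 e.2 c)).comp
          (measurable_const.prodMk (measurable_snd.sub measurable_fst))
  exact h.comp (measurable_snd.fst.prodMk (measurable_snd.snd.prodMk measurable_fst))

theorem measurable_request :
    Measurable fun y : (Fin M × Fin L) × FullState M L => N.request y.1 y.2 := by
  have h : Measurable fun y : ((Fin M × Fin L) × SystemState M L) × ℝ =>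
      N.request y.1.1 (y.1.2, y.2) := by
    refine measurable_from_prod_countable_right fun px => ?_
    unfold request
    dsimp only
    split_ifs <;> fun_prop
  exact h.comp ((measurable_fst.prodMk measurable_snd.fst).prodMk measurable_snd.snd)

theorem measurable_queuingDelay :
    Measurable fun y : Fin M × FullState M L => N.queuingDelay y.1 y.2 := by
  have h : Measurable fun y : (Fin M × SystemState M L) × ℝ =>
      N.queuingDelay y.1.1 (y.1.2, y.2) := by
    refine measurable_from_prod_countable_right fun px => ?_
    obtain ⟨i, ⟨q, c⟩⟩ := px
    cases q with
    | nil => exact measurable_const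
    | cons e q =>
      change Measurable fun r : ℝ =>
        r + ((q.takeWhile fun e => e.1 ≠ i).map fun e => N.serviceTime e.1).sum
      exact measurable_id.add_const _
  exact h.comp ((measurable_fst.prodMk measurable_snd.fst).prodMk measurable_snd.snd)

theorem measurableSet_valid : MeasurableSet {z | N.Valid z} := by
  refine measurableSet_setOfPred.2 (measurable_from_prod_countable_right fun x => ?_)
  have hc : ∀ q : Prop, Measurable fun _ : ℝ => q := fun _ => measurable_const
  unfold Valid
  dsimp only
  refine (hc _).and ((hc _).and ((hc _).and (((hc (x.queue = [])).imp ?_).and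
    ((hc (x.queue ≠ [])).imp (Measurable.and ?_ ?_)))))
  · exact measurableSet_setOfPred.1 (measurableSet_singleton 0)
  · exact measurableSet_setOfPred.1 measurableSet_Ioi
  · exact measurableSet_setOfPred.1 measurableSet_Iic

theorem measurable_wait :
    Measurable fun y : ℝ × (FullState M L × RequestInput M L) => N.wait y.1 y.2 :=
  (N.measurable_advance.comp (measurable_fst.prodMk measurable_snd.fst)).prodMk
    (measurable_waitInput.comp (measurable_fst.prodMk measurable_snd.snd))

variable [NeZero M] [NeZero L]

theorem measurable_step : Measurable N.step :=
  (N.measurable_request.comp ((measurable_requestPair_zero.comp measurable_snd).prodMk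
    (N.measurable_advance.comp ((measurable_requestTime_zero.comp measurable_snd).prodMk
      measurable_fst)))).prodMk (measurable_tailInput.comp measurable_snd)

theorem measurable_shiftAt :
    Measurable fun y : ℝ × (FullState M L × RequestInput M L) => N.shiftAt y.1 y.2 := by
  have h : Measurable fun y : ℕ × (ℝ × (FullState M L × RequestInput M L)) =>
      N.wait (y.2.1 - if y.1 = 0 then 0 else requestTime y.2.2.2 (y.1 - 1))
        (N.step^[y.1] y.2.2) := by
    refine measurable_from_prod_countable_right fun n => ?_
    refine N.measurable_wait.comp
      (Measurable.prodMk ?_ ((N.measurable_step.iterate n).comp measurable_snd))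
    dsimp only
    split_ifs
    · exact measurable_fst.sub measurable_const
    · exact measurable_fst.sub ((measurable_requestTime _).comp measurable_snd.snd)
  exact h.comp ((measurable_requestCount.comp
    (measurable_fst.prodMk measurable_snd.snd)).prodMk measurable_id)

end MulticastNetwork

/-! ### Exponential interarrival times -/

section Exponential

variable {r : ℝ} (hr : 0 < r)
include hr

theorem expMeasure_Iic {a : ℝ} (ha : 0 ≤ a) :
    expMeasure r (Set.Iic a) = ENNReal.ofReal (1 - Real.exp (-(r * a))) := by
  have := isProbabilityMeasure_expMeasure hr
  rw [← ofReal_cdf, cdf_expMeasure_eq hr, if_pos ha]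

theorem expMeasure_Ioi {a : ℝ} (ha : 0 ≤ a) :
    expMeasure r (Set.Ioi a) = ENNReal.ofReal (Real.exp (-(r * a))) := by
  have := isProbabilityMeasure_expMeasure hr
  rw [← Set.compl_Iic, measure_compl measurableSet_Iic (measure_ne_top _ _), measure_univ,
    expMeasure_Iic hr ha, ← ENNReal.ofReal_one, ← ENNReal.ofReal_sub _ (by
      simpa using mul_nonneg hr.le ha), sub_sub_cancel]

theorem expMeasure_Ioc {a b : ℝ} (ha : 0 ≤ a) (hab : a ≤ b) :
    expMeasure r (Set.Ioc a b) =
      ENNReal.ofReal (Real.exp (-(r * a)) - Real.exp (-(r * b))) := by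
  have := isProbabilityMeasure_expMeasure hr
  have h1 : Set.Ioc a b = Set.Iic b \ Set.Iic a := by
    ext x
    simp [and_comm]
  rw [h1, measure_sdiff (Set.Iic_subset_Iic.2 hab) measurableSet_Iic.nullMeasurableSet
    (measure_ne_top _ _), expMeasure_Iic hr ha, expMeasure_Iic hr (ha.trans hab),
    ← ENNReal.ofReal_sub _ (by simpa using mul_nonneg hr.le ha)]
  congr 1
  ring

omit hr in
theorem expMeasure_singleton (a : ℝ) : expMeasure r {a} = 0 :=
  withDensity_absolutelyContinuous _ _ Real.volume_singleton

/-- An exponential time has no memory. -/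
theorem map_restrict_expMeasure {a : ℝ} (ha : 0 ≤ a) :
    ((expMeasure r).restrict (Set.Ioi a)).map (fun x => x - a) =
      ENNReal.ofReal (Real.exp (-(r * a))) • expMeasure r := by
  have := isProbabilityMeasure_expMeasure hr
  have hm : Measurable fun x : ℝ => x - a := by fun_prop
  refine Measure.ext_of_Iic _ _ fun x => ?_
  rw [Measure.map_apply hm measurableSet_Iic, Measure.restrict_apply (hm measurableSet_Iic),
    Measure.smul_apply, smul_eq_mul]
  have h1 : (fun x => x - a) ⁻¹' Set.Iic x ∩ Set.Ioi a = Set.Ioc a (x + a) := by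
    ext y
    simp [and_comm]
  rw [h1]
  rcases lt_or_ge x 0 with hx | hx
  · rw [Set.Ioc_eq_empty (by linarith), measure_empty, ← ofReal_cdf, cdf_expMeasure_eq hr,
      if_neg (not_le.2 hx), ENNReal.ofReal_zero, mul_zero]
  · rw [expMeasure_Ioc hr ha (by linarith), expMeasure_Iic hr hx,
      ← ENNReal.ofReal_mul (Real.exp_pos _).le, mul_sub, mul_one, ← Real.exp_add]
    congr 3
    ring_nf

end Exponential

/-- The sequence that starts with `a` and goes on with `x`. -/
def consSeq (a : ℝ) (x : ℕ → ℝ) : ℕ → ℝ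
  | 0 => a
  | n + 1 => x n

theorem measurable_consSeq : Measurable fun y : ℝ × (ℕ → ℝ) => consSeq y.1 y.2 := by
  refine measurable_pi_iff.2 fun n => ?_
  cases n with
  | zero => exact measurable_fst
  | succ n => exact (measurable_pi_apply n).comp measurable_snd

theorem map_consSeq_infinitePi (ν : Measure ℝ) [IsProbabilityMeasure ν] :
    (ν.prod (Measure.infinitePi fun _ : ℕ => ν)).map (fun y => consSeq y.1 y.2) =
      Measure.infinitePi fun _ : ℕ => ν := by
  classical
  refine Measure.eq_infinitePi _ fun s t ht => ?_
  -- enlarge the finite index set to an initial segment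
  obtain ⟨K, hK⟩ := s.exists_nat_subset_range
  let t' : ℕ → Set ℝ := fun n => if n ∈ s then t n else Set.univ
  have ht' : ∀ n, MeasurableSet (t' n) := fun n => by
    by_cases h : n ∈ s <;> simp [t', h, ht]
  have h1 : Set.pi (s : Set ℕ) t = Set.pi (Finset.range (K + 1) : Set ℕ) t' := by
    ext x
    simp only [Set.mem_pi, Finset.mem_coe]
    constructor
    · intro h n _
      by_cases hn : n ∈ s
      · simpa [t', hn] using h n hn
      · simp [t', hn]
    · intro h n hn
      have := h n (Finset.range_mono (Nat.le_succ K) (hK hn))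
      simpa [t', hn] using this
  have h2 : ∏ n ∈ s, ν (t n) = ∏ n ∈ Finset.range (K + 1), ν (t' n) := by
    rw [← Finset.prod_subset (hK.trans (Finset.range_mono (Nat.le_succ K)))]
    · exact Finset.prod_congr rfl fun n hn => by simp [t', hn]
    · intro n _ hn
      simp [t', hn]
  have h3 : (fun y : ℝ × (ℕ → ℝ) => consSeq y.1 y.2) ⁻¹' Set.pi (Finset.range (K + 1) : Set ℕ) t' =
      t' 0 ×ˢ Set.pi (Finset.range K : Set ℕ) fun n => t' (n + 1) := by
    ext ⟨a, x⟩
    simp only [Set.mem_preimage, Set.mem_pi, Finset.coe_range, Set.mem_Iio, Set.mem_prod]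
    constructor
    · exact fun h => ⟨h 0 (Nat.succ_pos _), fun n hn => h (n + 1) (Nat.succ_lt_succ hn)⟩
    · rintro ⟨h0, h⟩ (_ | n) hn
      · exact h0
      · exact h n (Nat.lt_of_succ_lt_succ hn)
  rw [h1, h2, Measure.map_apply measurable_consSeq
    (MeasurableSet.pi (Finset.countable_toSet _) fun n _ => ht' n), h3, Measure.prod_prod,
    Measure.infinitePi_pi _ fun n _ => ht' (n + 1), Finset.prod_range_succ', mul_comm]

theorem measurable_update_first_sub (a : ℝ) :
    Measurable fun x : ℕ → ℝ => Function.update x 0 (x 0 - a) := by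
  refine measurable_pi_iff.2 fun n => ?_
  cases n with
  | zero => simp only [Function.update_self]; fun_prop
  | succ n =>
    simp only [ne_eq, Nat.succ_ne_zero, not_false_eq_true, Function.update_of_ne]
    fun_prop

/-- The law of the interarrival times of a Poisson process of rate `r`. -/
noncomputable def streamLaw (r : ℝ) : Measure (ℕ → ℝ) := Measure.infinitePi fun _ => expMeasure r

section StreamLaw

variable {r : ℝ} (hr : 0 < r)
include hr

theorem isProbabilityMeasure_streamLaw : IsProbabilityMeasure (streamLaw r) := by
  have := isProbabilityMeasure_expMeasure hr
  unfold streamLaw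
  infer_instance

theorem map_consSeq_streamLaw :
    ((expMeasure r).prod (streamLaw r)).map (fun y => consSeq y.1 y.2) = streamLaw r := by
  have := isProbabilityMeasure_expMeasure hr
  exact map_consSeq_infinitePi _

theorem streamLaw_first {B : Set ℝ} (hB : MeasurableSet B) :
    streamLaw r {x | x 0 ∈ B} = expMeasure r B := by
  have := isProbabilityMeasure_expMeasure hr
  have h := Measure.infinitePi_map_eval (fun _ : ℕ => expMeasure r) 0
  rw [← h, Measure.map_apply (by fun_prop) hB]
  rfl

/-- The lack of memory of a Poisson process. -/
theorem map_restrict_streamLaw {a : ℝ} (ha : 0 ≤ a) :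
    ((streamLaw r).restrict {x | a < x 0}).map (fun x => Function.update x 0 (x 0 - a)) =
      ENNReal.ofReal (Real.exp (-(r * a))) • streamLaw r := by
  have := isProbabilityMeasure_expMeasure hr
  have := isProbabilityMeasure_streamLaw hr
  have hm := measurable_update_first_sub a
  have hs : MeasurableSet {x : ℕ → ℝ | a < x 0} :=
    measurableSet_lt measurable_const (measurable_pi_apply 0)
  have h1 : (fun y : ℝ × (ℕ → ℝ) => consSeq y.1 y.2) ⁻¹' {x | a < x 0} =
      Set.Ioi a ×ˢ Set.univ := by
    ext y
    simp [consSeq]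
  have h2 : (fun x : ℕ → ℝ => Function.update x 0 (x 0 - a)) ∘ (fun y => consSeq y.1 y.2) =
      (fun y => consSeq y.1 y.2) ∘ Prod.map (fun x => x - a) id := by
    funext y n
    cases n <;> simp [consSeq]
  have hsub : Measurable fun x : ℝ => x - a := by fun_prop
  conv_lhs => rw [← map_consSeq_streamLaw hr]
  rw [Measure.restrict_map measurable_consSeq hs, h1, ← Measure.prod_restrict,
    Measure.restrict_univ, Measure.map_map hm measurable_consSeq, h2,
    ← Measure.map_map measurable_consSeq (hsub.prodMap measurable_id),
    ← Measure.map_prod_map _ _ hsub measurable_id, map_restrict_expMeasure hr ha, Measure.map_id,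
    Measure.prod_smul_left, Measure.map_smul, map_consSeq_streamLaw hr]

end StreamLaw

/-! ### Products of streams -/

section Products

variable {ι : Type*} [Fintype ι] [DecidableEq ι] {X : Type*} [MeasurableSpace X]
  (σ : ι → Measure X) [∀ i, IsProbabilityMeasure (σ i)]

omit [DecidableEq ι] in
theorem pi_smul_const (c : ι → ENNReal) (hc : ∀ i, c i ≠ ⊤) :
    Measure.pi (fun i => c i • σ i) = (∏ i, c i) • Measure.pi σ := by
  have : ∀ i, IsFiniteMeasure (c i • σ i) := fun i =>
    ⟨by simpa using (hc i).lt_top⟩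
  refine Measure.pi_eq fun s hs => ?_
  simp [Measure.pi_pi, Finset.prod_mul_distrib]

/-- Resampling one coordinate does not change a product law. -/
theorem map_update_pi (p : ι) :
    ((σ p).prod (Measure.pi σ)).map (fun y => Function.update y.2 p y.1) = Measure.pi σ := by
  have hm : Measurable fun y : X × (ι → X) => Function.update y.2 p y.1 := by
    refine measurable_pi_iff.2 fun q => ?_
    by_cases h : q = p
    · subst h
      simp only [Function.update_self]
      fun_prop
    · simp only [Function.update_of_ne h]
      fun_prop
  refine (Measure.pi_eq fun s hs => ?_).symm
  rw [Measure.map_apply hm (MeasurableSet.univ_pi hs)]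
  have h1 : (fun y : X × (ι → X) => Function.update y.2 p y.1) ⁻¹' Set.pi Set.univ s =
      s p ×ˢ Set.pi Set.univ (Function.update s p Set.univ) := by
    ext ⟨x, y⟩
    simp only [Set.mem_preimage, Set.mem_pi, Set.mem_univ, forall_true_left, Set.mem_prod]
    constructor
    · intro h
      refine ⟨by simpa using h p, fun q => ?_⟩
      by_cases hq : q = p
      · subst hq
        simp
      · simpa [Function.update_of_ne hq] using h q
    · rintro ⟨h0, h⟩ q
      by_cases hq : q = p
      · subst hq
        simpa using h0
      · simpa [Function.update_of_ne hq] using h q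
  rw [h1, Measure.prod_prod, Measure.pi_pi, ← Finset.mul_prod_erase _ _ (Finset.mem_univ p),
    ← Finset.mul_prod_erase Finset.univ (fun i => σ i (s i)) (Finset.mem_univ p)]
  simp only [Function.update_self, measure_univ, one_mul]
  congr 1
  refine Finset.prod_congr rfl fun q hq => ?_
  rw [Function.update_of_ne (Finset.ne_of_mem_erase hq)]

omit [DecidableEq ι] in
/-- Conditioning each coordinate and moving it, when this reproduces its law. -/
theorem map_restrict_pi {t : ι → Set X} {f : ι → X → X} (hf : ∀ i, Measurable (f i))
    {c : ι → ENNReal} (hc : ∀ i, c i ≠ ⊤)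
    (h : ∀ i, ((σ i).restrict (t i)).map (f i) = c i • σ i) :
    ((Measure.pi σ).restrict (Set.pi Set.univ t)).map (fun x i => f i (x i)) =
      (∏ i, c i) • Measure.pi σ := by
  rw [Measure.restrict_pi_pi, Measure.pi_map_pi fun i => (hf i).aemeasurable]
  simp only [h]
  exact pi_smul_const σ c hc

end Products

/-! ### The first request of the superposed Poisson processes -/

namespace MulticastNetwork

variable {M L : ℕ} (N : MulticastNetwork M L)

theorem isProbabilityMeasure_stream (p : Fin M × Fin L) :
    IsProbabilityMeasure (streamLaw (N.rate p.1 p.2)) :=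
  isProbabilityMeasure_streamLaw (N.rate_pos _ _)

theorem requestLaw_eq_pi :
    N.requestLaw = Measure.pi fun p : Fin M × Fin L => streamLaw (N.rate p.1 p.2) := by
  have : ∀ p : Fin M × Fin L, IsProbabilityMeasure
      (Measure.infinitePi fun _ : ℕ => expMeasure (N.rate p.1 p.2)) :=
    N.isProbabilityMeasure_stream
  exact Measure.infinitePi_eq_pi _

instance isProbabilityMeasure_requestLaw : IsProbabilityMeasure N.requestLaw := by
  have := N.isProbabilityMeasure_stream
  rw [N.requestLaw_eq_pi]
  infer_instance

theorem requestLaw_pi {t : Fin M × Fin L → Set ℝ} (ht : ∀ p, MeasurableSet (t p)) :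
    N.requestLaw {ω | ∀ p, ω p 0 ∈ t p} = ∏ p, expMeasure (N.rate p.1 p.2) (t p) := by
  have := N.isProbabilityMeasure_stream
  have h1 : {ω : RequestInput M L | ∀ p, ω p 0 ∈ t p} =
      Set.pi Set.univ fun p => {x : ℕ → ℝ | x 0 ∈ t p} := by
    ext ω
    simp
  rw [N.requestLaw_eq_pi, h1, Measure.pi_pi]
  exact Finset.prod_congr rfl fun p _ => streamLaw_first (N.rate_pos _ _) (ht p)

theorem ae_first_pos : ∀ᵐ ω ∂N.requestLaw, ∀ p, 0 < ω p 0 := by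
  have hS : MeasurableSet {ω : RequestInput M L | ∀ p, ω p 0 ∈ Set.Ioi (0 : ℝ)} := by
    simp only [Set.mem_Ioi, Set.ofPred_forall]
    exact MeasurableSet.iInter fun p => measurableSet_lt measurable_const (by fun_prop)
  refine (mem_ae_iff_prob_eq_one hS).2 ?_
  rw [N.requestLaw_pi fun _ => measurableSet_Ioi]
  refine Finset.prod_eq_one fun p _ => ?_
  rw [expMeasure_Ioi (N.rate_pos _ _) le_rfl]
  simp

/-- Integration over one stream and, independently, over all streams. -/
theorem requestLaw_eq_lintegral_update (p : Fin M × Fin L) {S : Set (RequestInput M L)}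
    (hS : MeasurableSet S) :
    N.requestLaw S = ∫⁻ x, N.requestLaw {ω | Function.update ω p x ∈ S}
      ∂(streamLaw (N.rate p.1 p.2)) := by
  have := N.isProbabilityMeasure_stream
  have hm : Measurable fun y : (ℕ → ℝ) × RequestInput M L => Function.update y.2 p y.1 :=
    measurable_update'.comp measurable_swap
  have h := map_update_pi (fun q : Fin M × Fin L => streamLaw (N.rate q.1 q.2)) p
  rw [← N.requestLaw_eq_pi] at h
  conv_lhs => rw [← h]
  rw [Measure.map_apply hm hS, Measure.prod_apply (hm hS)]
  rfl

theorem ae_first_ne {p q : Fin M × Fin L} (hpq : p ≠ q) :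
    ∀ᵐ ω ∂N.requestLaw, ω q 0 ≠ ω p 0 := by
  have := N.isProbabilityMeasure_stream
  have hD : MeasurableSet {ω : RequestInput M L | ω q 0 = ω p 0} :=
    measurableSet_eq_fun (by fun_prop) (by fun_prop)
  have hm : Measurable fun y : (ℕ → ℝ) × RequestInput M L => Function.update y.2 q y.1 :=
    measurable_update'.comp measurable_swap
  have h := map_update_pi (fun q : Fin M × Fin L => streamLaw (N.rate q.1 q.2)) q
  rw [← N.requestLaw_eq_pi] at h
  have h0 : N.requestLaw {ω | ω q 0 = ω p 0} = 0 := by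
    rw [← h, Measure.map_apply hm hD, Measure.prod_apply_symm (hm hD)]
    refine lintegral_eq_zero_of_ae_eq_zero (ae_of_all _ fun ω => ?_)
    have h1 : (fun x : ℕ → ℝ => (x, ω)) ⁻¹' ((fun y : (ℕ → ℝ) × RequestInput M L =>
        Function.update y.2 q y.1) ⁻¹' {ω | ω q 0 = ω p 0}) = {x | x 0 ∈ ({ω p 0} : Set ℝ)} := by
      ext x
      simp [Function.update_of_ne hpq]
    dsimp only
    rw [h1, streamLaw_first (N.rate_pos _ _) (measurableSet_singleton _), expMeasure_singleton]
    rfl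
  rw [ae_iff]
  simpa using h0

variable [NeZero M] [NeZero L]

theorem ae_requestTime_zero_pos : ∀ᵐ ω ∂N.requestLaw, 0 < requestTime ω 0 := by
  filter_upwards [N.ae_first_pos] with ω hω
  rw [requestTime_zero]
  exact hω _

theorem lt_requestTime_zero_iff (d : ℝ) (ω : RequestInput M L) :
    d < requestTime ω 0 ↔ ∀ p, d < ω p 0 :=
  ⟨fun h p => h.trans_le (requestTime_zero_le ω p), fun h => by
    rw [requestTime_zero]
    exact h _⟩

/-- The lack of memory of the superposed Poisson processes: given that there is no request before
time `d`, the requests after `d` have their original law. -/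
theorem map_restrict_waitInput {d : ℝ} (hd : 0 ≤ d) :
    (N.requestLaw.restrict {ω | d < requestTime ω 0}).map (waitInput d) =
      N.requestLaw {ω | d < requestTime ω 0} • N.requestLaw := by
  have := N.isProbabilityMeasure_stream
  have hw : Measurable (waitInput d : RequestInput M L → RequestInput M L) :=
    measurable_waitInput.comp measurable_prodMk_left
  have h1 : {ω : RequestInput M L | d < requestTime ω 0} =
      Set.pi Set.univ fun _ => {x : ℕ → ℝ | d < x 0} := by
    ext ω
    simp [lt_requestTime_zero_iff]
  have h2 := map_restrict_pi (fun q : Fin M × Fin L => streamLaw (N.rate q.1 q.2))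
    (t := fun _ => {x : ℕ → ℝ | d < x 0}) (f := fun _ x => Function.update x 0 (x 0 - d))
    (fun _ => measurable_update_first_sub d) (c := fun q => ENNReal.ofReal (Real.exp (-(N.rate q.1 q.2 * d))))
    (fun _ => ENNReal.ofReal_ne_top) fun q => map_restrict_streamLaw (N.rate_pos _ _) hd
  rw [← N.requestLaw_eq_pi, ← h1] at h2
  have h3 : (N.requestLaw.restrict {ω | d < requestTime ω 0}).map (waitInput d) =
      (∏ q : Fin M × Fin L, ENNReal.ofReal (Real.exp (-(N.rate q.1 q.2 * d)))) • N.requestLaw := h2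
  have h4 : (∏ q : Fin M × Fin L, ENNReal.ofReal (Real.exp (-(N.rate q.1 q.2 * d)))) =
      N.requestLaw {ω | d < requestTime ω 0} := by
    have h5 := congrArg (fun m : Measure (RequestInput M L) => m Set.univ) h3
    simp only [Measure.map_apply hw MeasurableSet.univ, Set.preimage_univ,
      Measure.restrict_apply_univ, Measure.smul_apply, measure_univ, smul_eq_mul, mul_one] at h5
    exact h5.symm
  rw [h3, h4]

/-- Given that the first request belongs to stream `p` and occurs at time `a`, stream `p` goes on with
a fresh sequence, and the other streams are conditioned not to have occurred before `a`, which they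
forget. -/
theorem exists_requestLaw_first_eq_mul (p : Fin M × Fin L) {A : Set ℝ} (hA : MeasurableSet A) :
    ∃ k : ENNReal, ∀ t : Set (RequestInput M L), MeasurableSet t →
      N.requestLaw {ω | requestTime ω 0 ∈ A ∧ requestPair ω 0 = p ∧ tailInput ω ∈ t} =
        k * N.requestLaw t := by
  have := N.isProbabilityMeasure_stream
  have hexp := fun q : Fin M × Fin L => isProbabilityMeasure_expMeasure (N.rate_pos q.1 q.2)
  let c : ℝ → ENNReal := fun a => ∏ q : Fin M × Fin L,
    if q = p then 1 else ENNReal.ofReal (Real.exp (-(N.rate q.1 q.2 * a)))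
  have hc : Measurable c := by
    refine Finset.measurable_prod _ fun q _ => ?_
    split_ifs <;> fun_prop
  refine ⟨∫⁻ a, A.indicator 1 a * c a ∂(expMeasure (N.rate p.1 p.2)), fun t ht => ?_⟩
  let shift : (ℕ → ℝ) → ℕ → ℝ := fun x n => x (n + 1)
  let Ev : Set (RequestInput M L) := {ω | ω p 0 ∈ A ∧ (∀ q, q ≠ p → ω p 0 < ω q 0) ∧
    Function.update (waitInput (ω p 0) ω) p (shift (ω p)) ∈ t}
  have hEv : MeasurableSet Ev := by
    refine MeasurableSet.inter ?_ (MeasurableSet.inter ?_ ?_)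
    · exact (measurable_pi_apply 0).comp (measurable_pi_apply p) hA
    · have : {ω : RequestInput M L | ∀ q, q ≠ p → ω p 0 < ω q 0} =
          ⋂ q, ⋂ (_ : q ≠ p), {ω | ω p 0 < ω q 0} := by
        ext ω
        simp
      change MeasurableSet {ω : RequestInput M L | ∀ q, q ≠ p → ω p 0 < ω q 0}
      rw [this]
      exact MeasurableSet.iInter fun q => MeasurableSet.iInter fun _ =>
        measurableSet_lt (by fun_prop) (by fun_prop)
    · have h1 : Measurable fun ω : RequestInput M L =>
          Function.update (waitInput (ω p 0) ω) p (shift (ω p)) := by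
        refine measurable_update'.comp (Measurable.prodMk ?_ ?_)
        · exact measurable_waitInput.comp (Measurable.prodMk (by fun_prop) measurable_id)
        · fun_prop
      exact h1 ht
  -- up to ties, `Ev` is the event in question
  have hcongr : N.requestLaw {ω | requestTime ω 0 ∈ A ∧ requestPair ω 0 = p ∧ tailInput ω ∈ t} =
      N.requestLaw Ev := by
    have hne : ∀ᵐ ω ∂N.requestLaw, ∀ q, q ≠ p → ω q 0 ≠ ω p 0 := by
      refine ae_all_iff.2 fun q => ?_
      by_cases hq : q = p
      · exact ae_of_all _ fun ω h => absurd hq h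
      · filter_upwards [N.ae_first_ne (fun h : p = q => hq h.symm)] with ω hω _ using hω
    refine measure_congr ?_
    filter_upwards [hne] with ω hω
    refine propext ?_
    change (requestTime ω 0 ∈ A ∧ requestPair ω 0 = p ∧ tailInput ω ∈ t) ↔ (ω p 0 ∈ A ∧ _ ∧ _)
    have key : requestPair ω 0 = p → requestTime ω 0 = ω p 0 ∧
        tailInput ω = Function.update (waitInput (ω p 0) ω) p (shift (ω p)) := by
      intro h
      have hT : requestTime ω 0 = ω p 0 := by rw [requestTime_zero, h]
      refine ⟨hT, ?_⟩
      funext q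
      by_cases hq : q = p
      · subst hq
        simp [tailInput, h, shift]
      · simp [tailInput, h, hq, waitInput, hT]
    constructor
    · rintro ⟨h1, h2, h3⟩
      obtain ⟨h4, h5⟩ := key h2
      rw [h4] at h1
      rw [h5] at h3
      refine ⟨h1, fun q hq => lt_of_le_of_ne ?_ (hω q hq).symm, h3⟩
      rw [← h4]
      exact requestTime_zero_le ω q
    · rintro ⟨h1, h2, h3⟩
      have h6 : requestPair ω 0 = p := by
        rw [requestPair_zero]
        exact earliest_eq_of_lt h2
      obtain ⟨h4, h5⟩ := key h6
      rw [h4, h5]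
      exact ⟨h1, h6, h3⟩
  have hmup : Measurable fun y : (ℕ → ℝ) × RequestInput M L => Function.update y.2 p y.1 :=
    measurable_update'.comp measurable_swap
  have hh : Measurable fun x => N.requestLaw {ω | Function.update ω p x ∈ Ev} :=
    measurable_measure_prodMk_left (hmup hEv)
  have hht : Measurable fun x => N.requestLaw {ω | Function.update ω p x ∈ t} :=
    measurable_measure_prodMk_left (hmup ht)
  -- the fibre over the first interarrival time `a` and the later ones `x` of stream `p`
  have hfib : ∀ a, 0 ≤ a → ∀ x, N.requestLaw {ω | Function.update ω p (consSeq a x) ∈ Ev} =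
      A.indicator 1 a * c a * N.requestLaw {ω | Function.update ω p x ∈ t} := by
    intro a ha x
    let w : RequestInput M L → RequestInput M L := fun ω q =>
      (if q = p then id else fun x : ℕ → ℝ => Function.update x 0 (x 0 - a)) (ω q)
    have hf : ∀ q : Fin M × Fin L, Measurable
        (if q = p then id else fun x : ℕ → ℝ => Function.update x 0 (x 0 - a)) := fun q => by
      split_ifs
      · exact measurable_id
      · exact measurable_update_first_sub a
    have hw : Measurable w := measurable_pi_iff.2 fun q => (hf q).comp (measurable_pi_apply q)
    have hmap : (N.requestLaw.restrict (Set.pi Set.univ fun q =>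
        if q = p then Set.univ else {x : ℕ → ℝ | a < x 0})).map w = c a • N.requestLaw := by
      rw [N.requestLaw_eq_pi]
      refine map_restrict_pi (fun q : Fin M × Fin L => streamLaw (N.rate q.1 q.2)) hf
        (fun q => ?_) fun q => ?_
      · split_ifs
        · exact ENNReal.one_ne_top
        · exact ENNReal.ofReal_ne_top
      · split_ifs
        · rw [Measure.restrict_univ, Measure.map_id, one_smul]
        · exact map_restrict_streamLaw (N.rate_pos _ _) ha
    have hupd : ∀ ω : RequestInput M L, Function.update ω p (consSeq a x) ∈ Ev ↔
        a ∈ A ∧ ω ∈ (Set.pi Set.univ fun q =>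
          if q = p then Set.univ else {x : ℕ → ℝ | a < x 0}) ∧ Function.update (w ω) p x ∈ t := by
      intro ω
      have h1 : Function.update (waitInput a (Function.update ω p (consSeq a x))) p x =
          Function.update (w ω) p x := by
        funext q
        by_cases hq : q = p
        · subst hq
          simp
        · simp [hq, w, waitInput]
      have h2 : (∀ q, q ≠ p → a < Function.update ω p (consSeq a x) q 0) ↔
          ω ∈ (Set.pi Set.univ fun q => if q = p then Set.univ else {x : ℕ → ℝ | a < x 0}) := by
        simp only [Set.mem_pi, Set.mem_univ, forall_true_left]
        refine forall_congr' fun q => ?_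
        by_cases hq : q = p
        · simp [hq]
        · simp [hq]
      have h3 : Function.update ω p (consSeq a x) p = consSeq a x := Function.update_self _ _ _
      have h4 : shift (consSeq a x) = x := rfl
      change (_ ∧ (∀ q, q ≠ p → _) ∧ _) ↔ _
      rw [h3, h4]
      change (a ∈ A ∧ (∀ q, q ≠ p → a < Function.update ω p (consSeq a x) q 0) ∧
        Function.update (waitInput a (Function.update ω p (consSeq a x))) p x ∈ t) ↔ _
      rw [h1, h2]
    simp only [hupd]
    by_cases haA : a ∈ A
    · have hE : MeasurableSet (Set.pi Set.univ fun q : Fin M × Fin L =>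
          if q = p then Set.univ else {x : ℕ → ℝ | a < x 0}) := by
        refine MeasurableSet.univ_pi fun q => ?_
        split_ifs
        · exact MeasurableSet.univ
        · exact measurableSet_lt measurable_const (measurable_pi_apply 0)
      have htx : MeasurableSet {ω : RequestInput M L | Function.update ω p x ∈ t} :=
        (hmup.comp measurable_prodMk_left) ht
      have h5 := congrArg (fun m : Measure (RequestInput M L) =>
        m {ω | Function.update ω p x ∈ t}) hmap
      simp only [Measure.map_apply hw htx, Measure.restrict_apply (hw htx), Measure.smul_apply,
        smul_eq_mul] at h5
      rw [Set.indicator_of_mem haA, Pi.one_apply, one_mul, ← h5]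
      congr 1
      ext ω
      simp only [haA, true_and, Set.mem_ofPred_eq, Set.mem_inter_iff, Set.mem_preimage]
      exact and_comm
    · simp [haA]
  rw [hcongr, N.requestLaw_eq_lintegral_update p hEv, ← map_consSeq_streamLaw (N.rate_pos p.1 p.2),
    lintegral_map hh measurable_consSeq, lintegral_prod
      (fun y : ℝ × (ℕ → ℝ) => N.requestLaw {ω | Function.update ω p (consSeq y.1 y.2) ∈ Ev})
      (hh.comp measurable_consSeq).aemeasurable,
    ← lintegral_mul_const (f := fun a => A.indicator 1 a * c a) _
      ((measurable_one.indicator hA).mul hc)]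
  have hpos : ∀ᵐ a ∂(expMeasure (N.rate p.1 p.2)), a ∈ Set.Ioi (0 : ℝ) := by
    refine (mem_ae_iff_prob_eq_one measurableSet_Ioi).2 ?_
    rw [expMeasure_Ioi (N.rate_pos _ _) le_rfl]
    simp
  refine lintegral_congr_ae ?_
  filter_upwards [hpos] with a ha
  simp only [hfib a (le_of_lt ha)]
  rw [lintegral_const_mul _ hht, ← N.requestLaw_eq_lintegral_update p ht]

/-- The joint law of the time and the stream of the first request. -/
noncomputable def firstLaw : Measure (ℝ × (Fin M × Fin L)) :=
  N.requestLaw.map fun ω => (requestTime ω 0, requestPair ω 0)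

theorem measurable_first :
    Measurable fun ω : RequestInput M L => (requestTime ω 0, requestPair ω 0) :=
  measurable_requestTime_zero.prodMk measurable_requestPair_zero

instance isProbabilityMeasure_firstLaw : IsProbabilityMeasure N.firstLaw :=
  Measure.isProbabilityMeasure_map measurable_first.aemeasurable

/-- The requests after the first one are independent of it and have the original law. -/
theorem map_first_tailInput :
    N.requestLaw.map (fun ω => ((requestTime ω 0, requestPair ω 0), tailInput ω)) =
      N.firstLaw.prod N.requestLaw := by
  have hm : Measurable fun ω : RequestInput M L =>
      ((requestTime ω 0, requestPair ω 0), tailInput ω) :=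
    measurable_first.prodMk measurable_tailInput
  symm
  refine Measure.prod_eq fun s t hs ht => ?_
  rw [Measure.map_apply hm (hs.prod ht), firstLaw, Measure.map_apply measurable_first hs]
  have key : ∀ p : Fin M × Fin L, N.requestLaw {ω | requestTime ω 0 ∈ {a | (a, p) ∈ s} ∧
      requestPair ω 0 = p ∧ tailInput ω ∈ t} =
      N.requestLaw {ω | requestTime ω 0 ∈ {a | (a, p) ∈ s} ∧ requestPair ω 0 = p} *
        N.requestLaw t := by
    intro p
    obtain ⟨k, hk⟩ := N.exists_requestLaw_first_eq_mul p (measurable_prodMk_right hs)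
    have h1 := hk Set.univ MeasurableSet.univ
    simp only [Set.mem_univ, and_true, measure_univ, mul_one] at h1
    have h2 := hk t ht
    rw [← h1] at h2
    exact h2
  -- split along the stream of the first request
  have hpart : ∀ S : Set (RequestInput M L), N.requestLaw S =
      ∑ p : Fin M × Fin L, N.requestLaw ({ω | requestPair ω 0 = p} ∩ S) := by
    intro S
    have hp : ∀ p : Fin M × Fin L, MeasurableSet ((fun ω => requestPair ω 0) ⁻¹' {p}) :=
      fun p => measurable_requestPair_zero (measurableSet_singleton p)
    have h1 := sum_measure_preimage_singleton (μ := N.requestLaw.restrict S) Finset.univ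
      fun p _ => hp p
    simp only [Finset.coe_univ, Set.preimage_univ, Measure.restrict_apply_univ,
      Measure.restrict_apply (hp _)] at h1
    exact h1.symm
  rw [hpart, hpart ((fun ω => (requestTime ω 0, requestPair ω 0)) ⁻¹' s), Finset.sum_mul]
  refine Finset.sum_congr rfl fun p _ => ?_
  have h1 : ({ω : RequestInput M L | requestPair ω 0 = p} ∩
      (fun ω => ((requestTime ω 0, requestPair ω 0), tailInput ω)) ⁻¹' s ×ˢ t) =
      {ω | requestTime ω 0 ∈ {a | (a, p) ∈ s} ∧ requestPair ω 0 = p ∧ tailInput ω ∈ t} := by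
    ext ω
    constructor
    · rintro ⟨rfl, h2, h3⟩
      exact ⟨h2, rfl, h3⟩
    · rintro ⟨h2, rfl, h3⟩
      exact ⟨rfl, h2, h3⟩
  have h2 : ({ω : RequestInput M L | requestPair ω 0 = p} ∩
      (fun ω => (requestTime ω 0, requestPair ω 0)) ⁻¹' s) =
      {ω | requestTime ω 0 ∈ {a | (a, p) ∈ s} ∧ requestPair ω 0 = p} := by
    ext ω
    constructor
    · rintro ⟨rfl, h2⟩
      exact ⟨h2, rfl⟩
    · rintro ⟨h2, rfl⟩
      exact ⟨rfl, h2⟩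
  rw [h1, h2, key]

/-- Conditioning on the first request, for integrals. -/
theorem lintegral_first_tailInput
    {f : (ℝ × (Fin M × Fin L)) × RequestInput M L → ENNReal} (hf : Measurable f) :
    ∫⁻ ω, f ((requestTime ω 0, requestPair ω 0), tailInput ω) ∂N.requestLaw =
      ∫⁻ y, ∫⁻ ω, f (y, ω) ∂N.requestLaw ∂N.firstLaw := by
  rw [← lintegral_prod _ hf.aemeasurable, ← N.map_first_tailInput,
    lintegral_map hf (measurable_first.prodMk measurable_tailInput)]

/-- Conditioning on the first request, for events. -/
theorem requestLaw_first_tailInput {D : Set ((ℝ × (Fin M × Fin L)) × RequestInput M L)}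
    (hD : MeasurableSet D) :
    N.requestLaw {ω | ((requestTime ω 0, requestPair ω 0), tailInput ω) ∈ D} =
      ∫⁻ y, N.requestLaw {ω | (y, ω) ∈ D} ∂N.firstLaw := by
  have h1 : N.requestLaw {ω | ((requestTime ω 0, requestPair ω 0), tailInput ω) ∈ D} =
      N.requestLaw.map (fun ω => ((requestTime ω 0, requestPair ω 0), tailInput ω)) D :=
    (Measure.map_apply (measurable_first.prodMk measurable_tailInput) hD).symm
  rw [h1, N.map_first_tailInput, Measure.prod_apply hD]
  rfl

theorem measurePreserving_tailInput :
    MeasurePreserving tailInput N.requestLaw N.requestLaw := by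
  refine ⟨measurable_tailInput, ?_⟩
  have h := congrArg (fun m => m.map Prod.snd) N.map_first_tailInput
  rw [Measure.map_map measurable_snd (measurable_first.prodMk measurable_tailInput),
    Measure.map_snd_prod, measure_univ, one_smul] at h
  exact h

/-- Every stream may provide the first request in any given interval of time. -/
theorem firstLaw_Ioc_pos (p : Fin M × Fin L) {a b : ℝ} (ha : 0 ≤ a) (hab : a < b) :
    0 < N.firstLaw (Set.Ioc a b ×ˢ {p}) := by
  have hexp := fun q : Fin M × Fin L => isProbabilityMeasure_expMeasure (N.rate_pos q.1 q.2)
  have ht : ∀ q, MeasurableSet (if q = p then Set.Ioc a b else Set.Ioi b) := fun q => by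
    split_ifs
    · exact measurableSet_Ioc
    · exact measurableSet_Ioi
  have hsub : {ω : RequestInput M L | ∀ q, ω q 0 ∈ if q = p then Set.Ioc a b else Set.Ioi b} ⊆
      (fun ω => (requestTime ω 0, requestPair ω 0)) ⁻¹' (Set.Ioc a b ×ˢ {p}) := by
    intro ω hω
    have h1 : ω p 0 ∈ Set.Ioc a b := by simpa using hω p
    have h2 : requestPair ω 0 = p := by
      rw [requestPair_zero]
      refine earliest_eq_of_lt fun q hq => ?_
      have h3 : ω q 0 ∈ Set.Ioi b := by simpa [hq] using hω q
      exact h1.2.trans_lt h3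
    refine ⟨?_, h2⟩
    change requestTime ω 0 ∈ Set.Ioc a b
    rw [requestTime_zero, h2]
    exact h1
  rw [firstLaw, Measure.map_apply measurable_first (measurableSet_Ioc.prod
    (measurableSet_singleton p))]
  refine lt_of_lt_of_le ?_ (measure_mono hsub)
  rw [N.requestLaw_pi ht, CanonicallyOrderedAdd.prod_pos]
  intro q _
  have hr := N.rate_pos q.1 q.2
  split_ifs
  · rw [expMeasure_Ioc hr ha hab.le]
    refine ENNReal.ofReal_pos.2 (sub_pos.2 (Real.exp_lt_exp.2 ?_))
    exact neg_lt_neg (mul_lt_mul_of_pos_left hab hr)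
  · rw [expMeasure_Ioi hr (ha.trans hab.le)]
    exact ENNReal.ofReal_pos.2 (Real.exp_pos _)

theorem firstLaw_ae_pos : ∀ᵐ y ∂N.firstLaw, 0 < y.1 :=
  (ae_map_iff measurable_first.aemeasurable
    (measurableSet_lt measurable_const measurable_fst)).2 N.ae_requestTime_zero_pos

/-- No request before time `d` has positive probability. -/
theorem requestLaw_lt_pos {d : ℝ} (hd : 0 ≤ d) :
    0 < N.requestLaw {ω | d < requestTime ω 0} := by
  have h1 := N.firstLaw_Ioc_pos (0, 0) hd (lt_add_one d)
  rw [firstLaw, Measure.map_apply measurable_first (measurableSet_Ioc.prod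
    (measurableSet_singleton _))] at h1
  exact h1.trans_le (measure_mono fun ω hω => hω.1.1)

end MulticastNetwork

/-! ### Recurrence of events seen at requests -/

namespace MulticastNetwork

variable {M L : ℕ} (N : MulticastNetwork M L)

/-- The state after a first request at time `y.1` in stream `y.2`. -/
noncomputable def next (z : FullState M L) (y : ℝ × (Fin M × Fin L)) : FullState M L :=
  N.request y.2 (N.advance y.1 z)

theorem measurable_next :
    Measurable fun x : FullState M L × (ℝ × (Fin M × Fin L)) => N.next x.1 x.2 :=
  N.measurable_request.comp (measurable_snd.snd.prodMk
    (N.measurable_advance.comp (measurable_snd.fst.prodMk measurable_fst)))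

theorem valid_next {z : FullState M L} (hz : N.Valid z) {y : ℝ × (Fin M × Fin L)} (hy : 0 ≤ y.1) :
    N.Valid (N.next z y) := N.valid_request _ (N.valid_advance hy hz)

variable [NeZero M] [NeZero L]

/-- The state together with the first of the coming requests. -/
noncomputable def withFirst (x : FullState M L × RequestInput M L) :
    FullState M L × (ℝ × (Fin M × Fin L)) :=
  (x.1, (requestTime x.2 0, requestPair x.2 0))

theorem measurable_withFirst :
    Measurable (withFirst : FullState M L × RequestInput M L → _) :=
  measurable_fst.prodMk (measurable_first.comp measurable_snd)

/-- An event at a request whose probability is bounded below uniformly in the admissible states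
occurs sooner or later. -/
theorem ae_exists_iterate_step_mem {B : Set (FullState M L × (ℝ × (Fin M × Fin L)))}
    (hB : MeasurableSet B) {c : ENNReal} (hc : 0 < c)
    (h : ∀ z, N.Valid z → c ≤ N.firstLaw {y | (z, y) ∈ B}) {z : FullState M L} (hz : N.Valid z) :
    ∀ᵐ ω ∂N.requestLaw, ∃ n, withFirst (N.step^[n] (z, ω)) ∈ B := by
  have hmeas : ∀ n, MeasurableSet {x | ∀ k < n, withFirst (N.step^[k] x) ∉ B} := by
    intro n
    simp only [Set.ofPred_forall]
    exact MeasurableSet.iInter fun k => MeasurableSet.iInter fun _ =>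
      (measurable_withFirst.comp (N.measurable_step.iterate k)) hB.compl
  have key : ∀ n z, N.Valid z →
      N.requestLaw {ω | ∀ k < n, withFirst (N.step^[k] (z, ω)) ∉ B} ≤ (1 - c) ^ n := by
    intro n
    induction n with
    | zero => intro z _; simp
    | succ n ih =>
      intro z hz
      have hBz : MeasurableSet {y | (z, y) ∈ B} := measurable_prodMk_left hB
      let D : Set ((ℝ × (Fin M × Fin L)) × RequestInput M L) :=
        {u | (z, u.1) ∉ B ∧ ∀ k < n, withFirst (N.step^[k] (N.next z u.1, u.2)) ∉ B}
      have hD : MeasurableSet D := by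
        refine MeasurableSet.inter ((measurable_prodMk_left.comp measurable_fst) hB.compl) ?_
        have h1 : Measurable fun u : (ℝ × (Fin M × Fin L)) × RequestInput M L =>
            (N.next z u.1, u.2) :=
          (N.measurable_next.comp (measurable_const.prodMk measurable_fst)).prodMk measurable_snd
        exact h1 (hmeas n)
      have hset : {ω | ∀ k < n + 1, withFirst (N.step^[k] (z, ω)) ∉ B} =
          {ω | ((requestTime ω 0, requestPair ω 0), tailInput ω) ∈ D} := by
        ext ω
        constructor
        · intro h
          exact ⟨h 0 (Nat.succ_pos _), fun k hk => h (k + 1) (Nat.succ_lt_succ hk)⟩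
        · rintro ⟨h0, h⟩ (_ | k) hk
          · exact h0
          · exact h k (Nat.lt_of_succ_lt_succ hk)
      rw [hset, N.requestLaw_first_tailInput hD]
      calc ∫⁻ y, N.requestLaw {ω | (y, ω) ∈ D} ∂N.firstLaw
          ≤ ∫⁻ y, {y | (z, y) ∈ B}ᶜ.indicator (fun _ => (1 - c) ^ n) y ∂N.firstLaw := by
            refine lintegral_mono_ae ?_
            filter_upwards [N.firstLaw_ae_pos] with y hy
            by_cases hyB : (z, y) ∈ B
            · have : {ω | (y, ω) ∈ D} = ∅ := by
                ext ω
                simp [D, hyB]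
              rw [this, measure_empty]
              exact zero_le
            · rw [Set.indicator_of_mem (show y ∈ {y | (z, y) ∈ B}ᶜ from hyB)]
              exact (measure_mono fun ω hω => hω.2).trans (ih _ (N.valid_next hz hy.le))
        _ = (1 - c) ^ n * (1 - N.firstLaw {y | (z, y) ∈ B}) := by
            rw [lintegral_indicator_const hBz.compl, prob_compl_eq_one_sub hBz]
        _ ≤ (1 - c) ^ (n + 1) := by
            rw [pow_succ]
            gcongr
            exact h z hz
  have h0 : N.requestLaw {ω | ∀ n, withFirst (N.step^[n] (z, ω)) ∉ B} = 0 := by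
    have hlim : Tendsto (fun n : ℕ => (1 - c) ^ n) atTop (𝓝 0) :=
      ENNReal.tendsto_pow_atTop_nhds_zero_of_lt_one
        (ENNReal.sub_lt_self ENNReal.one_ne_top one_ne_zero hc.ne')
    refine le_antisymm (ge_of_tendsto' hlim fun n => ?_) zero_le
    refine (measure_mono ?_).trans (key n z hz)
    intro ω hω k _
    exact (show ∀ n, withFirst (N.step^[n] (z, ω)) ∉ B from hω) k
  rw [ae_iff]
  simpa using h0

omit [NeZero M] [NeZero L] in
theorem valid_empty : N.Valid (⟨[], fun _ => []⟩, 0) := by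
  simp [Valid]

/-- Almost every input is regular: interarrival times longer than any bound occur. -/
theorem ae_isRegularInput : ∀ᵐ ω ∂N.requestLaw, IsRegularInput ω := by
  have h1 : ∀ᵐ ω ∂N.requestLaw, ∀ n, 0 ≤ requestTime (tailInput^[n] ω) 0 := by
    refine ae_all_iff.2 fun n => ?_
    have := (N.measurePreserving_tailInput.iterate n).quasiMeasurePreserving.ae
      N.ae_requestTime_zero_pos
    filter_upwards [this] with ω hω using hω.le
  have h2 : ∀ᵐ ω ∂N.requestLaw, ∀ K : ℕ, ∃ n, (K : ℝ) < requestTime (tailInput^[n] ω) 0 := by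
    refine ae_all_iff.2 fun K => ?_
    have hB : MeasurableSet {x : FullState M L × (ℝ × (Fin M × Fin L)) | (K : ℝ) < x.2.1} :=
      measurableSet_lt measurable_const measurable_snd.fst
    have hc := N.firstLaw_Ioc_pos (0, 0) (Nat.cast_nonneg K) (lt_add_one (K : ℝ))
    have h3 := N.ae_exists_iterate_step_mem hB hc
      (fun z _ => measure_mono fun y hy => hy.1.1) N.valid_empty
    filter_upwards [h3] with ω hω
    obtain ⟨n, hn⟩ := hω
    refine ⟨n, ?_⟩
    have h4 := N.iterate_step_snd ((⟨[], fun _ => []⟩, 0), ω) n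
    dsimp only at h4
    rw [← h4]
    exact hn
  filter_upwards [h1, h2] with ω hω1 hω2
  refine ⟨hω1, fun t => ?_⟩
  obtain ⟨K, hK⟩ := exists_nat_gt t
  obtain ⟨n, hn⟩ := hω2 K
  have key : ∀ n (ω : RequestInput M L), (∀ n, 0 ≤ requestTime (tailInput^[n] ω) 0) →
      requestTime (tailInput^[n] ω) 0 ≤ requestTime ω n := by
    intro n
    induction n with
    | zero => intro ω _; exact le_rfl
    | succ n ih =>
      intro ω hω
      rw [Function.iterate_succ_apply, requestTime_succ]
      have := ih (tailInput ω) fun n => hω (n + 1)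
      have := hω 0
      simp only [Function.iterate_zero, id_eq] at this
      linarith
  exact ⟨n, hK.trans (hn.trans_le (key n ω hω1))⟩

/-- A lower bound for the probability of an event through one possibility for the first request. -/
theorem firstLaw_mul_le {S : Set (RequestInput M L)}
    {D : Set ((ℝ × (Fin M × Fin L)) × RequestInput M L)} (hD : MeasurableSet D)
    {A : Set ℝ} (hA : MeasurableSet A) {q : Fin M × Fin L} {δ : ENNReal}
    (hδ : ∀ a ∈ A, δ ≤ N.requestLaw {ω | ((a, q), ω) ∈ D})
    (hS : ∀ᵐ ω ∂N.requestLaw, requestTime ω 0 ∈ A → requestPair ω 0 = q →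
      ((requestTime ω 0, requestPair ω 0), tailInput ω) ∈ D → ω ∈ S) :
    N.firstLaw (A ×ˢ {q}) * δ ≤ N.requestLaw S := by
  have hAq : MeasurableSet (A ×ˢ {q}) := hA.prod (measurableSet_singleton q)
  calc N.firstLaw (A ×ˢ {q}) * δ
      = ∫⁻ y, (A ×ˢ {q}).indicator (fun _ => δ) y ∂N.firstLaw := by
        rw [lintegral_indicator_const hAq, mul_comm]
    _ ≤ ∫⁻ y, N.requestLaw {ω | (y, ω) ∈ D ∩ Prod.fst ⁻¹' (A ×ˢ {q})} ∂N.firstLaw := by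
        refine lintegral_mono fun y => ?_
        by_cases hy : y ∈ A ×ˢ ({q} : Set (Fin M × Fin L))
        · rw [Set.indicator_of_mem hy]
          obtain ⟨a, q'⟩ := y
          obtain ⟨ha, rfl⟩ := hy
          exact (hδ a ha).trans (measure_mono fun ω hω => ⟨hω, ha, rfl⟩)
        · rw [Set.indicator_of_notMem hy]
          exact zero_le
    _ ≤ N.requestLaw S := by
        rw [← N.requestLaw_first_tailInput (hD.inter (measurable_fst hAq))]
        refine measure_mono_ae ?_
        filter_upwards [hS] with ω hω hωD
        exact hω hωD.2.1 hωD.2.2 hωD.1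

/-! ### The Markov property at a fixed time -/

theorem measurableSet_requestCount_eq (t : ℝ) (n : ℕ) :
    MeasurableSet {ω : RequestInput M L | requestCount ω t = n} :=
  (measurable_requestCount.comp measurable_prodMk_left) (measurableSet_singleton n)

theorem measurable_shiftAt_section (t : ℝ) (z : FullState M L) :
    Measurable fun ω => N.shiftAt t (z, ω) :=
  N.measurable_shiftAt.comp (measurable_const.prodMk (measurable_const.prodMk measurable_id))

theorem setLIntegral_requestCount_zero (z : FullState M L) (t : ℝ)
    (f : FullState M L × RequestInput M L → ENNReal) :
    ∫⁻ ω in {ω | requestCount ω t = 0}, f (N.shiftAt t (z, ω)) ∂N.requestLaw =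
      ∫⁻ ω in {ω | t < requestTime ω 0}, f (N.wait t (z, ω)) ∂N.requestLaw := by
  have hset : {ω | requestCount ω t = 0} =ᵐ[N.requestLaw] {ω | t < requestTime ω 0} := by
    filter_upwards [N.ae_isRegularInput] with ω hω
    refine propext ⟨fun h => ?_, fun h => requestCount_eq_zero h⟩
    by_contra hlt
    have h' : requestCount ω t = 0 := h
    rw [requestCount_eq_succ hω (not_lt.1 hlt)] at h'
    omega
  rw [setLIntegral_congr hset]
  refine setLIntegral_congr_fun (measurableSet_lt measurable_const measurable_requestTime_zero)
    fun ω hω => ?_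
  rw [N.shiftAt_of_lt (x := (z, ω)) hω]

theorem setLIntegral_requestCount_succ (z : FullState M L) (t : ℝ) (n : ℕ)
    {f : FullState M L × RequestInput M L → ENNReal} (hf : Measurable f) :
    ∫⁻ ω in {ω | requestCount ω t = n + 1}, f (N.shiftAt t (z, ω)) ∂N.requestLaw =
      ∫⁻ y, (if y.1 ≤ t then ∫⁻ ω in {ω | requestCount ω (t - y.1) = n},
        f (N.shiftAt (t - y.1) (N.next z y, ω)) ∂N.requestLaw else 0) ∂N.firstLaw := by
  let D : Set ((ℝ × (Fin M × Fin L)) × RequestInput M L) :=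
    {u | u.1.1 ≤ t ∧ requestCount u.2 (t - u.1.1) = n}
  have hsub : Measurable fun u : (ℝ × (Fin M × Fin L)) × RequestInput M L => t - u.1.1 := by
    fun_prop
  have hD : MeasurableSet D :=
    (measurableSet_le measurable_fst.fst measurable_const).inter
      ((measurable_requestCount.comp (hsub.prodMk measurable_snd)) (measurableSet_singleton n))
  let g : (ℝ × (Fin M × Fin L)) × RequestInput M L → ENNReal :=
    D.indicator fun u => f (N.shiftAt (t - u.1.1) (N.next z u.1, u.2))
  have hg : Measurable g := by
    refine Measurable.indicator (hf.comp (N.measurable_shiftAt.comp (hsub.prodMk ?_))) hD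
    exact (N.measurable_next.comp (measurable_const.prodMk measurable_fst)).prodMk measurable_snd
  have h1 : ∫⁻ ω in {ω | requestCount ω t = n + 1}, f (N.shiftAt t (z, ω)) ∂N.requestLaw =
      ∫⁻ ω, g ((requestTime ω 0, requestPair ω 0), tailInput ω) ∂N.requestLaw := by
    rw [← lintegral_indicator (measurableSet_requestCount_eq t (n + 1))]
    refine lintegral_congr_ae ?_
    filter_upwards [N.ae_isRegularInput] with ω hω
    rcases lt_or_ge t (requestTime ω 0) with h | h
    · have h2 : ω ∉ {ω | requestCount ω t = n + 1} := by
        simp [requestCount_eq_zero h]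
      have h3 : ((requestTime ω 0, requestPair ω 0), tailInput ω) ∉ D := fun hD =>
        absurd hD.1 (not_le.2 h)
      simp only [g, Set.indicator_of_notMem h2, Set.indicator_of_notMem h3]
    · have h2 : ω ∈ {ω | requestCount ω t = n + 1} ↔
          ((requestTime ω 0, requestPair ω 0), tailInput ω) ∈ D := by
        simp only [D, Set.mem_ofPred_eq, requestCount_eq_succ hω h, h, true_and,
          Nat.add_right_cancel_iff]
      by_cases h3 : ω ∈ {ω | requestCount ω t = n + 1}
      · simp only [g, Set.indicator_of_mem h3, Set.indicator_of_mem (h2.1 h3)]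
        rw [N.shiftAt_of_le (x := (z, ω)) hω h]
        rfl
      · simp only [g, Set.indicator_of_notMem h3, Set.indicator_of_notMem (mt h2.2 h3)]
  rw [h1, N.lintegral_first_tailInput hg]
  refine lintegral_congr fun y => ?_
  split_ifs with hy
  · rw [← lintegral_indicator (measurableSet_requestCount_eq (t - y.1) n)]
    refine lintegral_congr fun ω => ?_
    simp only [g, D, Set.indicator, Set.mem_ofPred_eq, hy, true_and]
  · simp only [g, D, Set.indicator, Set.mem_ofPred_eq, hy, false_and, if_false, lintegral_zero]

/-- The Markov property at time `t`: the requests after time `t` are distributed as the original ones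
and independent of the state at time `t`. -/
theorem lintegral_shiftAt (z : FullState M L) {t : ℝ} (ht : 0 ≤ t)
    {f : FullState M L × RequestInput M L → ENNReal} (hf : Measurable f) :
    ∫⁻ ω, f (N.shiftAt t (z, ω)) ∂N.requestLaw =
      ∫⁻ ω, ∫⁻ ω', f ((N.shiftAt t (z, ω)).1, ω') ∂N.requestLaw ∂N.requestLaw := by
  let F : FullState M L → ENNReal := fun z => ∫⁻ ω', f (z, ω') ∂N.requestLaw
  have hF : Measurable F := hf.lintegral_prod_right'
  have key : ∀ n z t, 0 ≤ t →
      ∫⁻ ω in {ω | requestCount ω t = n}, f (N.shiftAt t (z, ω)) ∂N.requestLaw =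
        ∫⁻ ω in {ω | requestCount ω t = n}, F (N.shiftAt t (z, ω)).1 ∂N.requestLaw := by
    intro n
    induction n with
    | zero =>
      intro z t ht
      have hw : Measurable (waitInput t : RequestInput M L → RequestInput M L) :=
        measurable_waitInput.comp measurable_prodMk_left
      have hfz : Measurable fun ω => f (N.advance t z, ω) := hf.comp measurable_prodMk_left
      rw [N.setLIntegral_requestCount_zero z t f,
        N.setLIntegral_requestCount_zero z t fun x => F x.1]
      have h1 := lintegral_map (μ := N.requestLaw.restrict {ω | t < requestTime ω 0}) hfz hw
      rw [N.map_restrict_waitInput ht, lintegral_smul_measure, smul_eq_mul] at h1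
      simp only [wait]
      rw [← h1, setLIntegral_const, mul_comm]
    | succ n ih =>
      intro z t ht
      rw [N.setLIntegral_requestCount_succ z t n hf,
        N.setLIntegral_requestCount_succ z t n (f := fun x => F x.1) (hF.comp measurable_fst)]
      refine lintegral_congr fun y => ?_
      split_ifs with hy
      · exact ih _ _ (sub_nonneg.2 hy)
      · rfl
  have hsplit : ∀ g : RequestInput M L → ENNReal, ∫⁻ ω, g ω ∂N.requestLaw =
      ∑' n, ∫⁻ ω in {ω | requestCount ω t = n}, g ω ∂N.requestLaw := by
    intro g
    rw [← lintegral_iUnion (fun n => measurableSet_requestCount_eq t n)]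
    · have : ⋃ n, {ω : RequestInput M L | requestCount ω t = n} = Set.univ := by
        ext ω
        simp
      rw [this, Measure.restrict_univ]
    · intro m n hmn
      refine Set.disjoint_left.2 fun ω h1 h2 => hmn ?_
      exact Eq.trans (Eq.symm h1) h2
  rw [hsplit, hsplit (fun ω => ∫⁻ ω', f ((N.shiftAt t (z, ω)).1, ω') ∂N.requestLaw)]
  exact tsum_congr fun n => key n z t ht

theorem isMarkovShift_shiftAt :
    IsMarkovShift N.requestLaw {z | N.Valid z} fun t : ℝ≥0 => N.shiftAt t where
  measurable t := N.measurable_shiftAt.comp measurable_prodMk_left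
  map_eq z _ t := by
    have hm := N.measurable_shiftAt_section t z
    refine Measure.ext_of_lintegral _ fun f hf => ?_
    rw [lintegral_map hf hm, N.lintegral_shiftAt z t.coe_nonneg hf, lintegral_prod _ hf.aemeasurable,
      lintegral_map hf.lintegral_prod_right' hm.fst]
  mem z hz t := by
    filter_upwards [N.ae_isRegularInput] with ω hω
    exact N.valid_shiftAt (x := (z, ω)) t.coe_nonneg hz hω
  add z _ s t := by
    filter_upwards [N.ae_isRegularInput] with ω hω
    rw [NNReal.coe_add, N.shiftAt_add (x := (z, ω)) s.coe_nonneg t.coe_nonneg hω]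

/-! ### A state reached from everywhere in the same time -/

theorem exists_firstLaw_lower {a b : ℝ} (ha : 0 ≤ a) (hab : a < b) :
    ∃ c : ENNReal, 0 < c ∧ ∀ q, c ≤ N.firstLaw (Set.Ioc a b ×ˢ {q}) := by
  obtain ⟨q, hq⟩ := Finite.exists_min fun q => N.firstLaw (Set.Ioc a b ×ˢ {q})
  exact ⟨_, N.firstLaw_Ioc_pos q ha hab, hq⟩

theorem le_requestLaw_shiftAt_eq {c₁ : ENNReal}
    (hc₁ : ∀ q, c₁ ≤ N.firstLaw (Set.Ioc N.drainTime (N.drainTime + 1) ×ˢ {q}))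
    {T : ℝ} (c' : Fin L → List (Fin M)) (qs : List (Fin M × Fin L)) {z : FullState M L}
    {c : Fin L → List (Fin M)} (hz : N.DrainsTo z c) (hqs : qs.foldl N.touch c = c') {t : ℝ}
    (ht : qs.length * (N.drainTime + 1) + N.drainTime ≤ t) (htT : t ≤ T) :
    c₁ ^ qs.length * N.requestLaw {ω | T < requestTime ω 0} ≤
      N.requestLaw {ω | (N.shiftAt t (z, ω)).1 = (⟨[], c'⟩, 0)} := by
  have hB := N.drainTime_nonneg
  induction qs generalizing z c t with
  | nil =>
    rw [List.length_nil, pow_zero, one_mul]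
    refine measure_mono fun ω hω => ?_
    have hlt : t < requestTime ω 0 := htT.trans_lt hω
    change (N.shiftAt t (z, ω)).1 = _
    rw [N.shiftAt_of_lt (x := (z, ω)) hlt, ← hqs]
    refine hz.advance_eq ?_
    simpa using ht
  | cons q qs ih =>
    rw [List.length_cons, pow_succ', mul_assoc]
    let D : Set ((ℝ × (Fin M × Fin L)) × RequestInput M L) :=
      {u | (N.shiftAt (t - u.1.1) (N.next z u.1, u.2)).1 = (⟨[], c'⟩, 0)}
    have hD : MeasurableSet D := by
      have hsub : Measurable fun u : (ℝ × (Fin M × Fin L)) × RequestInput M L => t - u.1.1 := by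
        fun_prop
      have h1 : Measurable fun u : (ℝ × (Fin M × Fin L)) × RequestInput M L =>
          (N.shiftAt (t - u.1.1) (N.next z u.1, u.2)).1 :=
        (N.measurable_shiftAt.comp (hsub.prodMk ((N.measurable_next.comp
          (measurable_const.prodMk measurable_fst)).prodMk measurable_snd))).fst
      exact h1 (measurableSet_singleton _)
    simp only [List.length_cons, Nat.cast_add, Nat.cast_one] at ht
    refine (mul_le_mul_left (hc₁ q) _).trans
      (N.firstLaw_mul_le hD measurableSet_Ioc (fun a ha => ?_) ?_)
    · have h1 : N.DrainsTo (N.next z (a, q)) (N.touch c q) := by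
        rw [next, hz.advance_eq (le_of_lt ha.1)]
        exact N.drainsTo_request_idle q c
      exact ih h1 hqs (t := t - a) (by linarith [ha.2]) (by linarith [ha.1])
    · filter_upwards [N.ae_isRegularInput] with ω hω h1 h2 h3
      have h4 : requestTime ω 0 ≤ t := by
        have h5 : (0 : ℝ) ≤ qs.length * (N.drainTime + 1) := by positivity
        have := h1.2
        linarith
      change (N.shiftAt t (z, ω)).1 = _
      rw [N.shiftAt_of_le (x := (z, ω)) hω h4]
      exact h3

/-- The idle state with reset caches is reached at the same time from every admissible state, with
probability bounded below. -/
theorem exists_atom_shiftAt : ∃ (t : ℝ≥0) (z₀ : FullState M L) (ε : ℝ), 0 < ε ∧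
    ∀ z, N.Valid z → ε ≤ N.requestLaw.real {ω | (N.shiftAt t (z, ω)).1 = z₀} := by
  have hB := N.drainTime_nonneg
  obtain ⟨c₁, hc₁0, hc₁⟩ := N.exists_firstLaw_lower hB (lt_add_one N.drainTime)
  have hT : 0 ≤ (allRequests M L).length * (N.drainTime + 1) + N.drainTime := by positivity
  let δ : ENNReal := c₁ ^ (allRequests M L).length * N.requestLaw
    {ω | (allRequests M L).length * (N.drainTime + 1) + N.drainTime < requestTime ω 0}
  have key : ∀ z, N.Valid z → δ ≤ N.requestLaw {ω | (N.shiftAt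
      ((allRequests M L).length * (N.drainTime + 1) + N.drainTime) (z, ω)).1 =
        (⟨[], N.resetCache⟩, 0)} := by
    intro z hz
    obtain ⟨c, hc⟩ := N.exists_drainsTo hz
    exact N.le_requestLaw_shiftAt_eq hc₁ N.resetCache (allRequests M L) hc
      (N.foldl_touch_allRequests (DrainsTo.cache_valid hz hc)) le_rfl le_rfl
  have hδ0 : 0 < δ := ENNReal.mul_pos (ENNReal.pow_pos hc₁0 _).ne' (N.requestLaw_lt_pos hT).ne'
  have hδ1 : δ ≠ ⊤ := ne_top_of_le_ne_top (measure_ne_top _ _) (key _ N.valid_empty)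
  refine ⟨⟨_, hT⟩, (⟨[], N.resetCache⟩, 0), δ.toReal, ENNReal.toReal_pos hδ0.ne' hδ1,
    fun z hz => ?_⟩
  exact ENNReal.toReal_mono (measure_ne_top _ _) (key z hz)

/-! ### From the shift to the stationary laws -/

omit [NeZero M] [NeZero L] in
instance isProbabilityMeasure_law (μ : N.InitialLaw) : IsProbabilityMeasure (N.law μ) := by
  have := μ.2.1
  unfold law
  infer_instance

omit [NeZero M] [NeZero L] in
/-- A Markov shift with a uniformly charged atom yields the existence, uniqueness and attractiveness
of the stationary laws of every process that moves with the shift. -/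
theorem existsUnique_stationary_of_shift {T F : Type*} [AddCommMonoid T] [PartialOrder T]
    [CanonicallyOrderedAdd T] [IsDirectedOrder T] [MeasurableSpace F]
    {S : T → FullState M L × RequestInput M L → FullState M L × RequestInput M L}
    (h : IsMarkovShift N.requestLaw {z | N.Valid z} S)
    (hatom : ∃ (t₀ : T) (z₀ : FullState M L) (ε : ℝ), 0 < ε ∧
      ∀ z, N.Valid z → ε ≤ N.requestLaw.real {ω | (S t₀ (z, ω)).1 = z₀})
    {Y Y' : T → FullState M L × RequestInput M L → F} (hY : ∀ t, Measurable (Y t))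
    (hshift : ∀ z, N.Valid z → ∀ t, ∀ᵐ ω ∂N.requestLaw, ∀ u, Y (t + u) (z, ω) = Y u (S t (z, ω)))
    (hYY' : ∀ μ : N.InitialLaw, ∀ᵐ x ∂(N.law μ), ∀ t, Y' t x = Y t x) :
    (∃! π : Measure F, IsStationaryDistribution N.law Y' π) ∧
    (∃! Q : Measure (T → F), IsStationaryProcessLaw N.law Y' Q) ∧
    (∀ π : Measure F, IsStationaryDistribution N.law Y' π → ∀ μ : N.InitialLaw,
      Tendsto (fun t => tvDist ((N.law μ).map (Y' t)) π) atTop (𝓝 0)) ∧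
    (∀ Q : Measure (T → F), IsStationaryProcessLaw N.law Y' Q → ∀ μ : N.InitialLaw,
      Tendsto (fun t => tvDist (trajectoryLaw (N.law μ) Y' t) Q) atTop (𝓝 0)) := by
  obtain ⟨t₀, z₀, ε, hε0, hε⟩ := hatom
  have hV := N.measurableSet_valid
  have hVne : {z | N.Valid z}.Nonempty := ⟨_, N.valid_empty⟩
  have hz₀ : MeasurableSet {z₀} := measurableSet_singleton z₀
  have htraj : ∀ μ : N.InitialLaw, ∀ t,
      (fun ω u => Y' (t + u) ω) =ᵐ[N.law μ] fun ω u => Y (t + u) ω := by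
    intro μ t
    filter_upwards [hYY' μ] with x hx
    funext u
    exact hx _
  have hlaw : ∀ (μ : N.InitialLaw) t,
      trajectoryLaw (N.law μ) Y' t = trajectoryLaw (N.law μ) Y t := fun μ t =>
    Measure.map_congr (htraj μ t)
  obtain ⟨π, hπ, hπV, hinv⟩ := h.exists_invariant hV hz₀ hε0 hε hVne
  let μ₀ : N.InitialLaw := ⟨π, hπ, hπV⟩
  refine existsUnique_stationary_and_tendsto N.law Y' (fun μ t => ?_) μ₀
    (fun t => ?_) fun μ ν => ?_
  · exact (measurable_pi_iff.2 fun u => hY (t + u)).aemeasurable.congr (htraj μ t).symm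
  · rw [hlaw, hlaw]
    change trajectoryLaw (π.prod N.requestLaw) Y t = trajectoryLaw (π.prod N.requestLaw) Y 0
    rw [h.trajectoryLaw_eq hY hshift hπV, h.trajectoryLaw_eq hY hshift hπV, hinv, hinv]
  · simp only [hlaw]
    have := μ.2.1
    have := ν.2.1
    exact h.tendsto_tvDist_trajectoryLaw hV hz₀ hε0 hε hVne hY hshift μ.2.2 ν.2.2

end MulticastNetwork

/-! ### The requests that reach the server -/

/-- The iterates of a map that leaves an independent noise with its original law behind form a
Markov shift. -/
theorem isMarkovShift_iterate {E Ω : Type*} [MeasurableSpace E] [MeasurableSpace Ω]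
    {ρ : Measure Ω} [IsProbabilityMeasure ρ] {V : Set E} (hV : MeasurableSet V)
    {S : E × Ω → E × Ω} (hS : Measurable S)
    (hmarkov : ∀ z ∈ V, ∀ f : E × Ω → ENNReal, Measurable f →
      ∫⁻ ω, f (S (z, ω)) ∂ρ = ∫⁻ ω, ∫⁻ ω', f ((S (z, ω)).1, ω') ∂ρ ∂ρ)
    (hmem : ∀ z ∈ V, ∀ᵐ ω ∂ρ, (S (z, ω)).1 ∈ V) :
    IsMarkovShift ρ V fun k : ℕ => S^[k] := by
  have hstep : ∀ ν : Measure E, IsProbabilityMeasure ν → (∀ᵐ z ∂ν, z ∈ V) →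
      (ν.prod ρ).map S = ((ν.prod ρ).map fun x => (S x).1).prod ρ := by
    intro ν _ hν
    refine Measure.ext_of_lintegral _ fun f hf => ?_
    have h1 : Measurable fun x => f (S x) := hf.comp hS
    have h2 : Measurable fun x => ∫⁻ ω', f ((S x).1, ω') ∂ρ :=
      hf.lintegral_prod_right'.comp hS.fst
    rw [lintegral_map hf hS, lintegral_prod _ h1.aemeasurable,
      lintegral_prod _ hf.aemeasurable, lintegral_map hf.lintegral_prod_right' hS.fst,
      lintegral_prod _ h2.aemeasurable]
    refine lintegral_congr_ae ?_
    filter_upwards [hν] with z hz using hmarkov z hz f hf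
  have key : ∀ z ∈ V, ∀ k : ℕ,
      ρ.map (fun ω => S^[k] (z, ω)) = (ρ.map fun ω => (S^[k] (z, ω)).1).prod ρ ∧
      ∀ᵐ ω ∂ρ, (S^[k] (z, ω)).1 ∈ V := by
    intro z hz k
    have hsec : ∀ k, Measurable fun ω => S^[k] (z, ω) := fun k =>
      (hS.iterate k).comp measurable_prodMk_left
    induction k with
    | zero =>
      refine ⟨?_, ae_of_all _ fun ω => hz⟩
      simp only [Function.iterate_zero, id_eq, Measure.map_const, measure_univ, one_smul,
        Measure.dirac_prod]
    | succ k ih =>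
      obtain ⟨h1, h2⟩ := ih
      have hν : IsProbabilityMeasure (ρ.map fun ω => (S^[k] (z, ω)).1) :=
        Measure.isProbabilityMeasure_map (hsec k).fst.aemeasurable
      have hνV : ∀ᵐ z ∂(ρ.map fun ω => (S^[k] (z, ω)).1), z ∈ V :=
        (ae_map_iff (hsec k).fst.aemeasurable hV).2 h2
      have h3 : (fun ω => S^[k + 1] (z, ω)) = S ∘ fun ω => S^[k] (z, ω) := by
        funext ω
        exact Function.iterate_succ_apply' _ _ _
      have h4 : (fun ω => (S^[k + 1] (z, ω)).1) = (fun x => (S x).1) ∘ fun ω => S^[k] (z, ω) := by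
        funext ω
        exact congrArg Prod.fst (Function.iterate_succ_apply' _ _ _)
      have h5 := hstep _ hν hνV
      rw [← h1, Measure.map_map hS (hsec k), Measure.map_map hS.fst (hsec k)] at h5
      refine ⟨by rw [h3, h4, h5], ?_⟩
      have h6 : ∀ᵐ x ∂((ρ.map fun ω => (S^[k] (z, ω)).1).prod ρ), (S x).1 ∈ V := by
        refine (Measure.ae_prod_iff_ae_ae (p := fun x => (S x).1 ∈ V) (hS.fst hV)).2 ?_
        filter_upwards [hνV] with z hz using hmem z hz
      rw [← h1] at h6
      have h7 := (ae_map_iff (p := fun x => (S x).1 ∈ V) (hsec k).aemeasurable (hS.fst hV)).1 h6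
      filter_upwards [h7] with ω hω
      rw [Function.iterate_succ_apply']
      exact hω
  exact {
    measurable := fun k => hS.iterate k
    map_eq := fun z hz k => (key z hz k).1
    mem := fun z hz k => (key z hz k).2
    add := fun z _ s t => ae_of_all _ fun ω => by
      rw [add_comm s t, Function.iterate_add_apply] }

namespace MulticastNetwork

variable {M L : ℕ} (N : MulticastNetwork M L)

/-- A first request `x.2` that is a miss when it finds the system in the state to which `x.1` has
moved by then. -/
def firstMisses : Set (FullState M L × (ℝ × (Fin M × Fin L))) :=
  {x | x.2.2.1 ∉ (N.advance x.2.1 x.1).1.cache x.2.2.2}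

theorem measurableSet_firstMisses : MeasurableSet N.firstMisses := by
  have h1 : MeasurableSet {u : (Fin M × Fin L) × SystemState M L | u.1.1 ∉ u.2.cache u.1.2} :=
    (Set.to_countable _).measurableSet
  have h2 : Measurable fun x : FullState M L × (ℝ × (Fin M × Fin L)) =>
      (x.2.2, (N.advance x.2.1 x.1).1) :=
    measurable_snd.snd.prodMk
      (N.measurable_advance.comp (measurable_snd.fst.prodMk measurable_fst)).fst
  exact h2 h1

variable [NeZero M] [NeZero L]

/-- The first of the coming requests is a miss. -/
def missSet : Set (FullState M L × RequestInput M L) := withFirst ⁻¹' N.firstMisses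

theorem measurableSet_missSet : MeasurableSet N.missSet :=
  measurable_withFirst N.measurableSet_firstMisses

theorem isMiss_iff (x : FullState M L × RequestInput M L) (n : ℕ) :
    N.IsMiss x n ↔ N.step^[n] x ∈ N.missSet := by
  have h1 := N.requestPair_iterate x n 0
  have h2 := N.beforeRequest_iterate x n 0
  rw [zero_add] at h1 h2
  rw [IsMiss, h1, h2, N.beforeRequest_zero]
  rfl

/-- The index of the first miss. -/
noncomputable def missIndex (x : FullState M L × RequestInput M L) : ℕ :=
  sInf {n | N.step^[n] x ∈ N.missSet}

/-- Lapse of the time until just after the first miss. -/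
noncomputable def missShift (x : FullState M L × RequestInput M L) :
    FullState M L × RequestInput M L :=
  N.step^[N.missIndex x + 1] x

/-- The queuing delay of the first of the coming requests, should it be a miss. -/
noncomputable def firstDelay (x : FullState M L × RequestInput M L) : ℝ :=
  N.queuingDelay (requestPair x.2 0).1 (N.advance (requestTime x.2 0) x.1)

theorem measurable_missIndex : Measurable N.missIndex :=
  measurable_sInf_nat fun n => (N.measurable_step.iterate n) N.measurableSet_missSet

theorem measurable_missShift : Measurable N.missShift := by
  have h : Measurable fun y : ℕ × (FullState M L × RequestInput M L) => N.step^[y.1 + 1] y.2 :=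
    measurable_from_prod_countable_right fun n => N.measurable_step.iterate (n + 1)
  exact h.comp (N.measurable_missIndex.prodMk measurable_id)

theorem measurable_firstDelay : Measurable N.firstDelay := by
  have h1 : Measurable fun x : FullState M L × RequestInput M L => (requestPair x.2 0).1 :=
    (measurable_of_countable fun p : Fin M × Fin L => p.1).comp
      (measurable_requestPair_zero.comp measurable_snd)
  have h2 : Measurable fun x : FullState M L × RequestInput M L =>
      (requestTime x.2 0, x.1) :=
    (measurable_requestTime_zero.comp measurable_snd).prodMk measurable_fst
  have h3 : Measurable fun x : FullState M L × RequestInput M L =>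
      N.advance (requestTime x.2 0) x.1 := N.measurable_advance.comp h2
  exact N.measurable_queuingDelay.comp (h1.prodMk h3)

theorem measurable_firstDelay_missIndex :
    Measurable fun x => N.firstDelay (N.step^[N.missIndex x] x) := by
  have h : Measurable fun y : ℕ × (FullState M L × RequestInput M L) => N.step^[y.1] y.2 :=
    measurable_from_prod_countable_right fun n => N.measurable_step.iterate n
  have h1 : Measurable fun x => N.step^[N.missIndex x] x :=
    h.comp (N.measurable_missIndex.prodMk measurable_id)
  exact N.measurable_firstDelay.comp h1

theorem missIndex_of_mem {x : FullState M L × RequestInput M L} (hx : x ∈ N.missSet) :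
    N.missIndex x = 0 := Nat.sInf_eq_zero.2 (Or.inl hx)

theorem missIndex_of_notMem {x : FullState M L × RequestInput M L} (hx : x ∉ N.missSet)
    (h : ∃ n, N.step^[n] x ∈ N.missSet) : N.missIndex x = N.missIndex (N.step x) + 1 := by
  have h1 : 1 ≤ sInf {n | N.step^[n] x ∈ N.missSet} := by
    rw [Nat.one_le_iff_ne_zero]
    intro h0
    rcases Nat.sInf_eq_zero.1 h0 with h0 | h0
    · exact hx h0
    · obtain ⟨n, hn⟩ := h
      exact (Set.eq_empty_iff_forall_notMem.1 h0 n) hn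
  exact (Nat.sInf_add h1).symm

theorem missShift_of_mem {x : FullState M L × RequestInput M L} (hx : x ∈ N.missSet) :
    N.missShift x = N.step x := by
  rw [missShift, N.missIndex_of_mem hx]
  rfl

theorem missShift_of_notMem {x : FullState M L × RequestInput M L} (hx : x ∉ N.missSet)
    (h : ∃ n, N.step^[n] x ∈ N.missSet) : N.missShift x = N.missShift (N.step x) := by
  rw [missShift, N.missIndex_of_notMem hx h, Function.iterate_succ_apply]
  rfl

theorem delay_eq (k : ℕ) (x : FullState M L × RequestInput M L) :
    N.delay k x = N.firstDelay (N.step^[Nat.nth (N.IsMiss x) k] x) := by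
  have h1 := N.requestPair_iterate x (Nat.nth (N.IsMiss x) k) 0
  have h2 := N.beforeRequest_iterate x (Nat.nth (N.IsMiss x) k) 0
  rw [zero_add] at h1 h2
  rw [delay, h1, h2, N.beforeRequest_zero]
  rfl

theorem isMiss_missShift (x : FullState M L × RequestInput M L) (n : ℕ) :
    N.IsMiss (N.missShift x) n ↔ N.IsMiss x (N.missIndex x + 1 + n) := by
  rw [isMiss_iff, isMiss_iff, add_comm, Function.iterate_add_apply]
  rfl

theorem infinite_isMiss_missShift {x : FullState M L × RequestInput M L}
    (hx : {n | N.IsMiss x n}.Infinite) : {n | N.IsMiss (N.missShift x) n}.Infinite := by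
  refine Set.infinite_of_forall_exists_gt fun a => ?_
  obtain ⟨b, hb, hab⟩ := hx.exists_gt (N.missIndex x + 1 + a)
  refine ⟨b - (N.missIndex x + 1), ?_, by omega⟩
  change N.IsMiss (N.missShift x) _
  rw [isMiss_missShift]
  have h1 : N.missIndex x + 1 + (b - (N.missIndex x + 1)) = b := by omega
  rw [h1]
  exact hb

theorem nth_isMiss_succ {x : FullState M L × RequestInput M L}
    (hx : {n | N.IsMiss x n}.Infinite) (k : ℕ) :
    Nat.nth (N.IsMiss x) (k + 1) =
      N.missIndex x + 1 + Nat.nth (N.IsMiss (N.missShift x)) k := by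
  classical
  have hx' := N.infinite_isMiss_missShift hx
  have hset : {n | N.step^[n] x ∈ N.missSet} = {n | N.IsMiss x n} := by
    ext n
    exact (N.isMiss_iff x n).symm
  have hmem : N.IsMiss x (N.missIndex x) := by
    have : N.missIndex x ∈ {n | N.IsMiss x n} := by
      rw [missIndex, hset]
      exact Nat.sInf_mem hx.nonempty
    exact this
  have hcount : Nat.count (N.IsMiss x) (N.missIndex x + 1) = 1 := by
    rw [Nat.count_succ, if_pos hmem]
    have : Nat.count (N.IsMiss x) (N.missIndex x) = 0 := by
      have h0 : N.missIndex x = Nat.nth (N.IsMiss x) 0 := by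
        rw [Nat.nth_zero, missIndex, hset]
      rw [h0]
      exact Nat.count_nth_zero _
    rw [this]
  have h1 := Nat.nth_mem_of_infinite hx' k
  have h2 := Nat.count_nth_of_infinite hx' k
  have h3 : Nat.count (N.IsMiss x)
      (N.missIndex x + 1 + Nat.nth (N.IsMiss (N.missShift x)) k) = k + 1 := by
    rw [Nat.count_add, hcount, add_comm]
    congr 1
    conv_rhs => rw [← h2]
    congr 1
    funext n
    exact propext (N.isMiss_missShift x n).symm
  rw [← h3]
  exact Nat.nth_count ((N.isMiss_missShift x _).1 h1)

theorem delay_eq_iterate {x : FullState M L × RequestInput M L}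
    (hx : {n | N.IsMiss x n}.Infinite) (k : ℕ) :
    N.delay k x = N.firstDelay (N.step^[N.missIndex (N.missShift^[k] x)] (N.missShift^[k] x)) := by
  induction k generalizing x with
  | zero =>
    rw [N.delay_eq, Nat.nth_zero]
    have : sInf {n | N.IsMiss x n} = N.missIndex x := by
      rw [missIndex]
      congr 1
      ext n
      exact N.isMiss_iff x n
    rw [this]
    rfl
  | succ k ih =>
    rw [Function.iterate_succ_apply, ← ih (N.infinite_isMiss_missShift hx), N.delay_eq,
      N.delay_eq, N.nth_isMiss_succ hx, add_comm, Function.iterate_add_apply]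
    rfl

/-! ### Misses recur when some cache cannot hold the library -/

omit [NeZero M] [NeZero L] in
theorem exists_notMem_of_length_lt {l : List (Fin M)} (h : l.length < M) : ∃ i, i ∉ l := by
  by_contra! hcon
  have h1 : (Finset.univ : Finset (Fin M)) ⊆ l.toFinset := fun i _ => List.mem_toFinset.2 (hcon i)
  have h2 := (Finset.card_le_card h1).trans (List.toFinset_card_le l)
  rw [Finset.card_univ, Fintype.card_fin] at h2
  omega

variable (hcap : ∃ j, N.capacity j < M)
include hcap

theorem ae_exists_miss {z : FullState M L} (hz : N.Valid z) :
    ∀ᵐ ω ∂N.requestLaw, ∃ n, N.step^[n] (z, ω) ∈ N.missSet := by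
  obtain ⟨j, hj⟩ := hcap
  obtain ⟨c₁, hc₁0, hc₁⟩ := N.exists_firstLaw_lower N.drainTime_nonneg (lt_add_one N.drainTime)
  refine N.ae_exists_iterate_step_mem N.measurableSet_firstMisses hc₁0 (fun z hz => ?_) hz
  obtain ⟨c, hc⟩ := N.exists_drainsTo hz
  obtain ⟨i, hi⟩ := exists_notMem_of_length_lt
    ((DrainsTo.cache_valid hz hc j).2.trans_lt hj)
  refine (hc₁ (i, j)).trans (measure_mono ?_)
  rintro ⟨a, q⟩ ⟨ha, rfl⟩
  change i ∉ (N.advance a z).1.cache j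
  rw [hc.advance_eq (le_of_lt ha.1)]
  exact hi

omit hcap in
theorem ae_step {P : Set (FullState M L × RequestInput M L)} (hP : MeasurableSet P)
    (h : ∀ z, N.Valid z → ∀ᵐ ω ∂N.requestLaw, (z, ω) ∈ P) {z : FullState M L} (hz : N.Valid z) :
    ∀ᵐ ω ∂N.requestLaw, N.step (z, ω) ∈ P := by
  let D : Set ((ℝ × (Fin M × Fin L)) × RequestInput M L) := {u | (N.next z u.1, u.2) ∈ Pᶜ}
  have hD : MeasurableSet D :=
    ((N.measurable_next.comp (measurable_const.prodMk measurable_fst)).prodMk measurable_snd)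
      hP.compl
  have h1 := N.requestLaw_first_tailInput hD
  change N.requestLaw {ω | ((requestTime ω 0, requestPair ω 0), tailInput ω) ∈ D} = 0
  rw [h1]
  refine lintegral_eq_zero_of_ae_eq_zero ?_
  filter_upwards [N.firstLaw_ae_pos] with y hy
  exact h _ (N.valid_next hz hy.le)

theorem ae_infinite_isMiss (μ : N.InitialLaw) :
    ∀ᵐ x ∂(N.law μ), {n | N.IsMiss x n}.Infinite := by
  have hmeas : ∀ n, MeasurableSet {x | ∃ m, N.step^[m] (N.step^[n] x) ∈ N.missSet} := by
    intro n
    simp only [Set.ofPred_exists]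
    exact MeasurableSet.iUnion fun m =>
      ((N.measurable_step.iterate m).comp (N.measurable_step.iterate n)) N.measurableSet_missSet
  have key : ∀ n z, N.Valid z → ∀ᵐ ω ∂N.requestLaw,
      ∃ m, N.step^[m] (N.step^[n] (z, ω)) ∈ N.missSet := by
    intro n
    induction n with
    | zero => exact fun z hz => N.ae_exists_miss hcap hz
    | succ n ih =>
      intro z hz
      exact N.ae_step (hmeas n) ih hz
  have hprob := μ.2.1
  have h1 : ∀ᵐ x ∂(N.law μ), ∀ n, ∃ m, N.step^[m] (N.step^[n] x) ∈ N.missSet := by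
    refine ae_all_iff.2 fun n => ?_
    rw [law]
    refine (Measure.ae_prod_iff_ae_ae (hmeas n)).2 ?_
    filter_upwards [μ.2.2] with z hz using key n z hz
  filter_upwards [h1] with x hx
  refine Set.infinite_of_forall_exists_gt fun a => ?_
  obtain ⟨m, hm⟩ := hx (a + 1)
  refine ⟨m + (a + 1), ?_, by omega⟩
  change N.IsMiss x _
  rw [N.isMiss_iff, Function.iterate_add_apply]
  exact hm

/-! ### The Markov property at the first miss -/

omit hcap in
theorem measurableSet_missIndex_eq (z : FullState M L) (n : ℕ) :
    MeasurableSet {ω | N.missIndex (z, ω) = n} :=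
  (N.measurable_missIndex.comp measurable_prodMk_left) (measurableSet_singleton n)

omit [NeZero M] [NeZero L] hcap in
theorem measurable_next_prod (z : FullState M L) :
    Measurable fun u : (ℝ × (Fin M × Fin L)) × RequestInput M L => (N.next z u.1, u.2) :=
  (N.measurable_next.comp (measurable_const.prodMk measurable_fst)).prodMk measurable_snd

theorem setLIntegral_missIndex_zero {z : FullState M L} (hz : N.Valid z)
    {f : FullState M L × RequestInput M L → ENNReal} (hf : Measurable f) :
    ∫⁻ ω in {ω | N.missIndex (z, ω) = 0}, f (N.missShift (z, ω)) ∂N.requestLaw =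
      ∫⁻ y, {y | (z, y) ∈ N.firstMisses}.indicator
        (fun y => ∫⁻ ω, f (N.next z y, ω) ∂N.requestLaw) y ∂N.firstLaw := by
  have hB : MeasurableSet {y | (z, y) ∈ N.firstMisses} :=
    measurable_prodMk_left N.measurableSet_firstMisses
  let g : (ℝ × (Fin M × Fin L)) × RequestInput M L → ENNReal :=
    (Prod.fst ⁻¹' {y | (z, y) ∈ N.firstMisses}).indicator fun u => f (N.next z u.1, u.2)
  have hg : Measurable g := (hf.comp (N.measurable_next_prod z)).indicator (measurable_fst hB)
  have h1 : ∫⁻ ω in {ω | N.missIndex (z, ω) = 0}, f (N.missShift (z, ω)) ∂N.requestLaw =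
      ∫⁻ ω, g ((requestTime ω 0, requestPair ω 0), tailInput ω) ∂N.requestLaw := by
    rw [← lintegral_indicator (N.measurableSet_missIndex_eq z 0)]
    refine lintegral_congr_ae ?_
    filter_upwards [N.ae_exists_miss hcap hz] with ω hω
    by_cases hm : (z, ω) ∈ N.missSet
    · have h2 : ω ∈ {ω | N.missIndex (z, ω) = 0} := N.missIndex_of_mem hm
      have h3 : ((requestTime ω 0, requestPair ω 0), tailInput ω) ∈
          (Prod.fst ⁻¹' {y | (z, y) ∈ N.firstMisses} :
            Set ((ℝ × (Fin M × Fin L)) × RequestInput M L)) := hm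
      simp only [g]
      rw [Set.indicator_of_mem h2, Set.indicator_of_mem h3, N.missShift_of_mem hm]
      rfl
    · have h2 : ω ∉ {ω | N.missIndex (z, ω) = 0} := by
        intro h0
        have h0' : N.missIndex (z, ω) = 0 := h0
        rw [N.missIndex_of_notMem hm hω] at h0'
        omega
      have h3 : ((requestTime ω 0, requestPair ω 0), tailInput ω) ∉
          (Prod.fst ⁻¹' {y | (z, y) ∈ N.firstMisses} :
            Set ((ℝ × (Fin M × Fin L)) × RequestInput M L)) := hm
      simp only [g]
      rw [Set.indicator_of_notMem h2, Set.indicator_of_notMem h3]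
  rw [h1, N.lintegral_first_tailInput hg]
  refine lintegral_congr fun y => ?_
  by_cases hy : (z, y) ∈ N.firstMisses <;> simp [g, Set.indicator, hy]

theorem setLIntegral_missIndex_succ {z : FullState M L} (hz : N.Valid z) (n : ℕ)
    {f : FullState M L × RequestInput M L → ENNReal} (hf : Measurable f) :
    ∫⁻ ω in {ω | N.missIndex (z, ω) = n + 1}, f (N.missShift (z, ω)) ∂N.requestLaw =
      ∫⁻ y, {y | (z, y) ∈ N.firstMisses}ᶜ.indicator
        (fun y => ∫⁻ ω in {ω | N.missIndex (N.next z y, ω) = n},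
          f (N.missShift (N.next z y, ω)) ∂N.requestLaw) y ∂N.firstLaw := by
  have hB : MeasurableSet {y | (z, y) ∈ N.firstMisses} :=
    measurable_prodMk_left N.measurableSet_firstMisses
  let D : Set ((ℝ × (Fin M × Fin L)) × RequestInput M L) :=
    {u | (z, u.1) ∉ N.firstMisses ∧ N.missIndex (N.next z u.1, u.2) = n}
  have hD : MeasurableSet D :=
    (measurable_fst hB.compl).inter ((N.measurable_missIndex.comp (N.measurable_next_prod z))
      (measurableSet_singleton n))
  let g : (ℝ × (Fin M × Fin L)) × RequestInput M L → ENNReal :=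
    D.indicator fun u => f (N.missShift (N.next z u.1, u.2))
  have hg : Measurable g :=
    ((hf.comp N.measurable_missShift).comp (N.measurable_next_prod z)).indicator hD
  have h1 : ∫⁻ ω in {ω | N.missIndex (z, ω) = n + 1}, f (N.missShift (z, ω)) ∂N.requestLaw =
      ∫⁻ ω, g ((requestTime ω 0, requestPair ω 0), tailInput ω) ∂N.requestLaw := by
    rw [← lintegral_indicator (N.measurableSet_missIndex_eq z (n + 1))]
    refine lintegral_congr_ae ?_
    filter_upwards [N.ae_exists_miss hcap hz] with ω hω
    by_cases hm : (z, ω) ∈ N.missSet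
    · have h2 : ω ∉ {ω | N.missIndex (z, ω) = n + 1} := by
        intro h0
        have h0' : N.missIndex (z, ω) = n + 1 := h0
        rw [N.missIndex_of_mem hm] at h0'
        omega
      have h3 : ((requestTime ω 0, requestPair ω 0), tailInput ω) ∉ D := fun hD => hD.1 hm
      simp only [g]
      rw [Set.indicator_of_notMem h2, Set.indicator_of_notMem h3]
    · have h2 : ω ∈ {ω | N.missIndex (z, ω) = n + 1} ↔
          ((requestTime ω 0, requestPair ω 0), tailInput ω) ∈ D := by
        change N.missIndex (z, ω) = n + 1 ↔ (_ ∧ N.missIndex (N.step (z, ω)) = n)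
        rw [N.missIndex_of_notMem hm hω, Nat.add_right_cancel_iff]
        exact ⟨fun h => ⟨hm, h⟩, fun h => h.2⟩
      simp only [g]
      by_cases h3 : ω ∈ {ω | N.missIndex (z, ω) = n + 1}
      · rw [Set.indicator_of_mem h3, Set.indicator_of_mem (h2.1 h3),
          N.missShift_of_notMem hm hω]
        rfl
      · rw [Set.indicator_of_notMem h3, Set.indicator_of_notMem (mt h2.2 h3)]
  rw [h1, N.lintegral_first_tailInput hg]
  refine lintegral_congr fun y => ?_
  by_cases hy : (z, y) ∈ N.firstMisses
  · simp [g, D, Set.indicator, hy]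
  · rw [Set.indicator_of_mem (show y ∈ {y | (z, y) ∈ N.firstMisses}ᶜ from hy),
      ← lintegral_indicator (N.measurableSet_missIndex_eq _ n)]
    refine lintegral_congr fun ω => ?_
    simp [g, D, Set.indicator, hy]

/-- The Markov property at the first miss. -/
theorem lintegral_missShift {z : FullState M L} (hz : N.Valid z)
    {f : FullState M L × RequestInput M L → ENNReal} (hf : Measurable f) :
    ∫⁻ ω, f (N.missShift (z, ω)) ∂N.requestLaw =
      ∫⁻ ω, ∫⁻ ω', f ((N.missShift (z, ω)).1, ω') ∂N.requestLaw ∂N.requestLaw := by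
  let F : FullState M L → ENNReal := fun z => ∫⁻ ω', f (z, ω') ∂N.requestLaw
  have hF : Measurable F := hf.lintegral_prod_right'
  have key : ∀ n z, N.Valid z →
      ∫⁻ ω in {ω | N.missIndex (z, ω) = n}, f (N.missShift (z, ω)) ∂N.requestLaw =
        ∫⁻ ω in {ω | N.missIndex (z, ω) = n}, F (N.missShift (z, ω)).1 ∂N.requestLaw := by
    intro n
    induction n with
    | zero =>
      intro z hz
      rw [N.setLIntegral_missIndex_zero hcap hz hf,
        N.setLIntegral_missIndex_zero hcap hz (f := fun x => F x.1) (hF.comp measurable_fst)]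
      simp [F]
    | succ n ih =>
      intro z hz
      rw [N.setLIntegral_missIndex_succ hcap hz n hf,
        N.setLIntegral_missIndex_succ hcap hz n (f := fun x => F x.1) (hF.comp measurable_fst)]
      refine lintegral_congr_ae ?_
      filter_upwards [N.firstLaw_ae_pos] with y hy
      by_cases hyB : y ∈ {y | (z, y) ∈ N.firstMisses}ᶜ
      · rw [Set.indicator_of_mem hyB, Set.indicator_of_mem hyB]
        exact ih _ (N.valid_next hz hy.le)
      · rw [Set.indicator_of_notMem hyB, Set.indicator_of_notMem hyB]
  have hsplit : ∀ g : RequestInput M L → ENNReal, ∫⁻ ω, g ω ∂N.requestLaw =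
      ∑' n, ∫⁻ ω in {ω | N.missIndex (z, ω) = n}, g ω ∂N.requestLaw := by
    intro g
    rw [← lintegral_iUnion (fun n => N.measurableSet_missIndex_eq z n)]
    · have : ⋃ n, {ω : RequestInput M L | N.missIndex (z, ω) = n} = Set.univ := by
        ext ω
        simp
      rw [this, Measure.restrict_univ]
    · intro m n hmn
      refine Set.disjoint_left.2 fun ω h1 h2 => hmn ?_
      exact Eq.trans (Eq.symm h1) h2
  rw [hsplit, hsplit (fun ω => ∫⁻ ω', f ((N.missShift (z, ω)).1, ω') ∂N.requestLaw)]
  exact tsum_congr fun n => key n z hz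

theorem isMarkovShift_missShift :
    IsMarkovShift N.requestLaw {z | N.Valid z} fun k : ℕ => N.missShift^[k] := by
  refine isMarkovShift_iterate N.measurableSet_valid N.measurable_missShift
    (fun z hz f hf => N.lintegral_missShift hcap hz hf) fun z hz => ?_
  filter_upwards [N.ae_isRegularInput] with ω hω
  exact N.valid_iterate_step (x := (z, ω)) hz hω _

end MulticastNetwork

/-! ### A state reached from everywhere after the same number of misses -/

namespace MulticastNetwork

variable {M L : ℕ} (N : MulticastNetwork M L)

/-- The state with two entries for the same request `p`, the first one in transmission for another
`r` units of time.  As long as this transmission lasts, each further request `p` is a miss that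
merges with the second entry and changes nothing. -/
def congested (p : Fin M × Fin L) (c : Fin L → List (Fin M)) (r : ℝ) : FullState M L :=
  (⟨[(p.1, {p.2}), (p.1, {p.2})], c⟩, r)

theorem advance_congested (p : Fin M × Fin L) (c : Fin L → List (Fin M)) {a r : ℝ} (h : a < r) :
    N.advance a (congested p c r) = congested p c (r - a) := by
  simp [advance, congested, serve, h]

theorem request_congested {p : Fin M × Fin L} {c : Fin L → List (Fin M)} (hp : p.1 ∉ c p.2)
    (r : ℝ) : N.request p (congested p c r) = congested p c r := by
  simp [request, congested, hp, enqueue, mergeRequest]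

theorem drainsTo_congested (p : Fin M × Fin L) (c : Fin L → List (Fin M)) {r : ℝ}
    (hr : r ≤ N.serviceTime p.1) :
    N.DrainsTo (congested p c r) (N.touch (N.touch c p) p) := by
  have h1 := N.serviceTime_le_drainTime_half p.1
  have h2 := N.serviceTime_pos p.1
  have h3 : ¬ N.drainTime < r := by
    rw [drainTime]
    linarith
  have h4 : ¬ N.drainTime - r < N.serviceTime p.1 := by
    rw [drainTime]
    linarith
  simp only [DrainsTo, advance, congested, serve, headTime, if_neg h3, if_neg h4,
    N.deliver_singleton p]

variable [NeZero M] [NeZero L]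

/-- The probability that the state just after the `m`-th miss is `w`, from the state `z`. -/
noncomputable def missProb (w : FullState M L) (m : ℕ) (z : FullState M L) : ENNReal :=
  N.requestLaw {ω | (N.missShift^[m] (z, ω)).1 = w}

theorem measurableSet_iterate_missShift_next (w : FullState M L) (m : ℕ) (z : FullState M L) :
    MeasurableSet {u : (ℝ × (Fin M × Fin L)) × RequestInput M L |
      (N.missShift^[m] (N.next z u.1, u.2)).1 = w} :=
  ((N.measurable_missShift.iterate m).comp (N.measurable_next_prod z)).fst
    (measurableSet_singleton w)

theorem missProb_zero_self (w : FullState M L) : N.missProb w 0 w = 1 := by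
  simp [missProb]

theorem mul_le_missProb_of_miss {w z : FullState M L} {m : ℕ} {A : Set ℝ} (hA : MeasurableSet A)
    {q : Fin M × Fin L} {c δ : ENNReal} (hc : c ≤ N.firstLaw (A ×ˢ {q}))
    (hmiss : ∀ a ∈ A, q.1 ∉ (N.advance a z).1.cache q.2)
    (hδ : ∀ a ∈ A, δ ≤ N.missProb w m (N.next z (a, q))) :
    c * δ ≤ N.missProb w (m + 1) z := by
  refine (mul_le_mul_left hc _).trans (N.firstLaw_mul_le
    (N.measurableSet_iterate_missShift_next w m z) hA hδ (ae_of_all _ fun ω h1 h2 h3 => ?_))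
  have hmem : (z, ω) ∈ N.missSet := by
    change (requestPair ω 0).1 ∉ (N.advance (requestTime ω 0) z).1.cache (requestPair ω 0).2
    rw [h2]
    exact hmiss _ h1
  change (N.missShift^[m + 1] (z, ω)).1 = w
  rw [Function.iterate_succ_apply, N.missShift_of_mem hmem]
  exact h3

theorem mul_le_missProb_of_hit (hcap : ∃ j, N.capacity j < M) {w z : FullState M L}
    (hz : N.Valid z) {m : ℕ} {A : Set ℝ} (hA : MeasurableSet A)
    {q : Fin M × Fin L} {c δ : ENNReal} (hc : c ≤ N.firstLaw (A ×ˢ {q}))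
    (hhit : ∀ a ∈ A, q.1 ∈ (N.advance a z).1.cache q.2)
    (hδ : ∀ a ∈ A, δ ≤ N.missProb w (m + 1) (N.next z (a, q))) :
    c * δ ≤ N.missProb w (m + 1) z := by
  refine (mul_le_mul_left hc _).trans (N.firstLaw_mul_le
    (N.measurableSet_iterate_missShift_next w (m + 1) z) hA hδ ?_)
  filter_upwards [N.ae_exists_miss hcap hz] with ω hω h1 h2 h3
  have hmem : (z, ω) ∉ N.missSet := by
    change ¬ (requestPair ω 0).1 ∉ (N.advance (requestTime ω 0) z).1.cache (requestPair ω 0).2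
    rw [h2, not_not]
    exact hhit _ h1
  change (N.missShift^[m + 1] (z, ω)).1 = w
  rw [Function.iterate_succ_apply, N.missShift_of_notMem hmem hω, ← Function.iterate_succ_apply]
  exact h3

section Paths

variable {N} {c₁ c₂ δ : ENNReal} {w : FullState M L}
  (hc₁ : ∀ q, c₁ ≤ N.firstLaw (Set.Ioc N.drainTime (N.drainTime + 1) ×ˢ {q}))

include hc₁ in
theorem DrainsTo.le_missProb_one {p : Fin M × Fin L} {c : Fin L → List (Fin M)}
    (hp : p.1 ∉ c p.2) {z : FullState M L} (hz : N.DrainsTo z c) :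
    c₁ ≤ N.missProb (⟨[(p.1, {p.2})], c⟩, N.serviceTime p.1) 1 z := by
  have h := N.mul_le_missProb_of_miss (w := (⟨[(p.1, {p.2})], c⟩, N.serviceTime p.1)) (m := 0)
    (δ := 1) measurableSet_Ioc (hc₁ p) (z := z) (fun a ha => ?_) (fun a ha => ?_)
  · simpa using h
  · rw [hz.advance_eq ha.1.le]
    exact hp
  · rw [next, hz.advance_eq ha.1.le, N.request_idle_of_notMem hp, missProb_zero_self]

variable {η : ℝ} (hc₂ : ∀ q, c₂ ≤ N.firstLaw (Set.Ioc 0 η ×ˢ {q}))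
  {p : Fin M × Fin L} {c : Fin L → List (Fin M)} (hp : p.1 ∉ c p.2)
  (hδ : ∀ z, N.DrainsTo z (N.touch (N.touch c p) p) → δ ≤ N.missProb w 1 z)
include hc₂ hp hδ

theorem le_missProb_congested (k : ℕ) {r : ℝ} (hr : k * η < r) (hr' : r ≤ N.serviceTime p.1) :
    c₂ ^ k * δ ≤ N.missProb w (k + 1) (congested p c r) := by
  induction k generalizing r with
  | zero =>
    rw [pow_zero, one_mul]
    exact hδ _ (N.drainsTo_congested p c hr')
  | succ k ih =>
    rw [pow_succ', mul_assoc]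
    push_cast at hr
    have hlt : ∀ a ∈ Set.Ioc 0 η, a < r := fun a ha => by
      have h1 : 0 ≤ (k : ℝ) * η := mul_nonneg k.cast_nonneg (ha.1.le.trans ha.2)
      linarith [ha.2]
    refine N.mul_le_missProb_of_miss measurableSet_Ioc (hc₂ p) (fun a ha => ?_) fun a ha => ?_
    · rw [N.advance_congested p c (hlt a ha)]
      exact hp
    · rw [next, N.advance_congested p c (hlt a ha), N.request_congested hp]
      exact ih (by linarith [ha.2]) (by linarith [ha.1])

include hc₁ in
/-- From a state that drains to caches without the file of `p`, the request `p` repeated at short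
intervals produces any prescribed number of misses, up to a limit set by the transmission time, before
a long pause. -/
theorem DrainsTo.le_missProb_add_three (k : ℕ) (hk : (k + 1) * η < N.serviceTime p.1)
    {z : FullState M L} (hz : N.DrainsTo z c) :
    c₁ * (c₂ ^ (k + 1) * δ) ≤ N.missProb w (k + 3) z := by
  refine N.mul_le_missProb_of_miss measurableSet_Ioc (hc₁ p) (fun a ha => ?_) fun a ha => ?_
  · rw [hz.advance_eq ha.1.le]
    exact hp
  rw [next, hz.advance_eq ha.1.le, N.request_idle_of_notMem hp, pow_succ', mul_assoc]
  have hadv : ∀ b ∈ Set.Ioc 0 η,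
      N.advance b (⟨[(p.1, {p.2})], c⟩, N.serviceTime p.1) =
        (⟨[(p.1, {p.2})], c⟩, N.serviceTime p.1 - b) := fun b hb => by
    have h1 : 0 ≤ (k : ℝ) * η := mul_nonneg k.cast_nonneg (hb.1.le.trans hb.2)
    have h2 : b < N.serviceTime p.1 := by linarith [hb.2]
    simp [MulticastNetwork.advance, serve, h2]
  refine N.mul_le_missProb_of_miss measurableSet_Ioc (hc₂ p) (fun b hb => ?_) fun b hb => ?_
  · rw [hadv b hb]
    exact hp
  · have h3 : N.next (⟨[(p.1, {p.2})], c⟩, N.serviceTime p.1) (b, p) =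
        congested p c (N.serviceTime p.1 - b) := by
      rw [next, hadv b hb]
      simp [request, hp, enqueue, mergeRequest, congested]
    rw [h3]
    exact le_missProb_congested hc₂ hp hδ k (by linarith [hb.2]) (by linarith [hb.1])

omit hc₂ hp hδ
include hc₁

/-- Requests at long intervals bring the caches from `c` to `qs.foldl N.touch c`.  The number `m` of
misses on the way depends on `c` and `qs` only. -/
theorem exists_mul_le_missProb_foldl (hcap : ∃ j, N.capacity j < M) (qs : List (Fin M × Fin L))
    (c : Fin L → List (Fin M)) :
    ∃ m ≤ qs.length, ∀ z, N.Valid z → N.DrainsTo z c → ∀ k : ℕ,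
      (∀ z', N.DrainsTo z' (qs.foldl N.touch c) → δ ≤ N.missProb w (k + 1) z') →
        c₁ ^ qs.length * δ ≤ N.missProb w (k + m + 1) z := by
  induction qs generalizing c with
  | nil => exact ⟨0, le_rfl, fun z _ hzc k h => by simpa using h z hzc⟩
  | cons q qs ih =>
    obtain ⟨m, hm, h⟩ := ih (N.touch c q)
    have hnext : ∀ z, N.Valid z → N.DrainsTo z c → ∀ k : ℕ,
        (∀ z', N.DrainsTo z' ((q :: qs).foldl N.touch c) → δ ≤ N.missProb w (k + 1) z') →
        ∀ a ∈ Set.Ioc N.drainTime (N.drainTime + 1),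
          c₁ ^ qs.length * δ ≤ N.missProb w (k + m + 1) (N.next z (a, q)) := by
      intro z hz hzc k hk a ha
      refine h _ (N.valid_next hz (N.drainTime_nonneg.trans ha.1.le)) ?_ k hk
      rw [next, hzc.advance_eq ha.1.le]
      exact N.drainsTo_request_idle q c
    by_cases hq : q.1 ∈ c q.2
    · refine ⟨m, hm.trans (Nat.le_succ _), fun z hz hzc k hk => ?_⟩
      rw [List.length_cons, pow_succ', mul_assoc]
      refine N.mul_le_missProb_of_hit hcap hz measurableSet_Ioc (hc₁ q) (fun a ha => ?_)
        (hnext z hz hzc k hk)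
      rw [hzc.advance_eq ha.1.le]
      exact hq
    · refine ⟨m + 1, Nat.succ_le_succ hm, fun z hz hzc k hk => ?_⟩
      rw [List.length_cons, pow_succ', mul_assoc]
      refine N.mul_le_missProb_of_miss measurableSet_Ioc (hc₁ q) (fun a ha => ?_)
        (hnext z hz hzc k hk)
      rw [hzc.advance_eq ha.1.le]
      exact hq

end Paths

/-- Some state is reached from every admissible state after the same number of misses, with
probability bounded below. -/
theorem exists_atom_missShift (hcap : ∃ j, N.capacity j < M) :
    ∃ (m : ℕ) (w : FullState M L) (ε : ℝ), 0 < ε ∧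
      ∀ z, N.Valid z → ε ≤ N.requestLaw.real {ω | (N.missShift^[m] (z, ω)).1 = w} := by
  obtain ⟨j, hj⟩ := hcap
  obtain ⟨i, hi⟩ := exists_notMem_of_length_lt (l := N.resetCache j)
    ((List.length_take_le _ _).trans_lt hj)
  let p : Fin M × Fin L := (i, j)
  have hp : p.1 ∉ N.resetCache p.2 := hi
  let c := N.touch (N.touch N.resetCache p) p
  obtain ⟨i', hi'⟩ := exists_notMem_of_length_lt (l := c j) (by
    refine lt_of_le_of_lt ?_ hj
    simp only [c, p, touch, Function.update_self]
    exact length_lruUpdate_le _ _ _)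
  let p' : Fin M × Fin L := (i', j)
  let w : FullState M L := (⟨[(p'.1, {p'.2})], c⟩, N.serviceTime p'.1)
  let n := (allRequests M L).length
  -- `n + 1` intervals of length at most `η` fit into the transmission time of the file of `p`.
  let η : ℝ := N.serviceTime p.1 / (n + 2)
  have hs := N.serviceTime_pos p.1
  have hη : 0 < η := by positivity
  have hnη : (n + 2 : ℝ) * η = N.serviceTime p.1 := by
    simp only [η]
    field_simp
  obtain ⟨c₁, hc₁0, hc₁⟩ := N.exists_firstLaw_lower N.drainTime_nonneg (lt_add_one N.drainTime)
  obtain ⟨c₂, hc₂0, hc₂⟩ := N.exists_firstLaw_lower le_rfl hη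
  have hc₂1 : c₂ ≤ 1 := (hc₂ p).trans prob_le_one
  let δ := c₁ ^ n * (c₁ * (c₂ ^ (n + 1) * c₁))
  have hfirst : ∀ z, N.DrainsTo z c → c₁ ≤ N.missProb w 1 z := fun z hz =>
    hz.le_missProb_one hc₁ (p := p') hi'
  have key : ∀ z, N.Valid z → δ ≤ N.missProb w (n + 3) z := by
    intro z hz
    obtain ⟨c', hc'⟩ := N.exists_drainsTo hz
    obtain ⟨m, hm, h⟩ := exists_mul_le_missProb_foldl (w := w)
      (δ := c₁ * (c₂ ^ (n + 1) * c₁)) hc₁ ⟨j, hj⟩ (allRequests M L) c'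
    rw [N.foldl_touch_allRequests (DrainsTo.cache_valid hz hc')] at h
    -- The `n - m` misses lacking from the reset are made up for by misses that merge.
    have h1 := h z hz hc' (n - m + 2) fun z' hz' => by
      refine le_trans ?_ (hz'.le_missProb_add_three hc₁ hc₂ hp hfirst (n - m) ?_)
      · gcongr c₁ * (?_ * c₁)
        exact pow_le_pow_right_of_le_one' hc₂1 (by omega)
      · have h2 : ((n - m : ℕ) : ℝ) ≤ n := by exact_mod_cast Nat.sub_le n m
        nlinarith
    have h3 : n - m + 2 + m + 1 = n + 3 := by omega
    rwa [h3] at h1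
  have hδ0 : 0 < δ := by
    refine ENNReal.mul_pos (ENNReal.pow_pos hc₁0 _).ne' (ENNReal.mul_pos hc₁0.ne' ?_).ne'
    exact (ENNReal.mul_pos (ENNReal.pow_pos hc₂0 _).ne' hc₁0.ne').ne'
  have hδ1 : δ ≠ ⊤ := ne_top_of_le_ne_top (measure_ne_top _ _) (key _ N.valid_empty)
  refine ⟨n + 3, w, δ.toReal, ENNReal.toReal_pos hδ0.ne' hδ1, fun z hz => ?_⟩
  exact ENNReal.toReal_mono (measure_ne_top _ _) (key z hz)

end MulticastNetwork

/-! ### Stationary laws of the state and of the delays -/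

theorem proposition2 {M L : ℕ} [NeZero M] [NeZero L] (N : MulticastNetwork M L) :
    ((∃! π : Measure (SystemState M L), IsStationaryDistribution N.law N.stateAt π) ∧
      (∃! Q : Measure (ℝ≥0 → SystemState M L), IsStationaryProcessLaw N.law N.stateAt Q) ∧
      (∀ π : Measure (SystemState M L), IsStationaryDistribution N.law N.stateAt π →
        ∀ μ : N.InitialLaw,
          Tendsto (fun t : ℝ≥0 => tvDist ((N.law μ).map (N.stateAt t)) π) atTop (𝓝 0)) ∧
      (∀ Q : Measure (ℝ≥0 → SystemState M L), IsStationaryProcessLaw N.law N.stateAt Q →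
        ∀ μ : N.InitialLaw,
          Tendsto (fun t : ℝ≥0 => tvDist (trajectoryLaw (N.law μ) N.stateAt t) Q)
            atTop (𝓝 0))) ∧
    ((∃ j, N.capacity j < M) →
      (∀ μ : N.InitialLaw, ∀ᵐ ω ∂(N.law μ), {n | N.IsMiss ω n}.Infinite) ∧
      (∃! π : Measure ℝ, IsStationaryDistribution N.law N.delay π) ∧
      (∃! Q : Measure (ℕ → ℝ), IsStationaryProcessLaw N.law N.delay Q) ∧
      (∀ π : Measure ℝ, IsStationaryDistribution N.law N.delay π →
        ∀ μ : N.InitialLaw,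
          Tendsto (fun k : ℕ => tvDist ((N.law μ).map (N.delay k)) π) atTop (𝓝 0)) ∧
      (∀ Q : Measure (ℕ → ℝ), IsStationaryProcessLaw N.law N.delay Q →
        ∀ μ : N.InitialLaw,
          Tendsto (fun k : ℕ => tvDist (trajectoryLaw (N.law μ) N.delay k) Q)
            atTop (𝓝 0))) := by
  refine ⟨?_, fun hcap => ⟨N.ae_infinite_isMiss hcap, ?_⟩⟩
  · refine N.existsUnique_stationary_of_shift N.isMarkovShift_shiftAt N.exists_atom_shiftAt
      (Y := N.stateAt) (fun t => ?_) (fun z _ s => ?_) fun μ => ae_of_all _ fun x t => rfl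
    · have h : N.stateAt t = fun x => (N.shiftAt t x).1.1 := by
        funext x
        rw [MulticastNetwork.stateAt, N.fullStateAt_eq]
      rw [h]
      exact (N.isMarkovShift_shiftAt.measurable t).fst.fst
    · filter_upwards [N.ae_isRegularInput] with ω hω u
      rw [MulticastNetwork.stateAt, MulticastNetwork.stateAt, N.fullStateAt_eq, N.fullStateAt_eq,
        NNReal.coe_add, N.shiftAt_add (x := (z, ω)) s.coe_nonneg u.coe_nonneg hω]
  · refine N.existsUnique_stationary_of_shift (N.isMarkovShift_missShift hcap)
      (N.exists_atom_missShift hcap)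
      (Y := fun k x => N.firstDelay (N.step^[N.missIndex (N.missShift^[k] x)] (N.missShift^[k] x)))
      (fun k => N.measurable_firstDelay_missIndex.comp (N.measurable_missShift.iterate k))
      (fun z _ s => ae_of_all _ fun ω u => ?_) fun μ => ?_
    · rw [add_comm s u, Function.iterate_add_apply]
    · filter_upwards [N.ae_infinite_isMiss hcap μ] with x hx k
      exact N.delay_eq_iterate hx k
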